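/- Let $(M,g)$ be a compact static spacetime; that is, $M$ is a compact connected (Hausdorff) smooth manifold of dimension at least $2$, $g$ is a smooth Lorentzian metric on $M$ of signature $(-,+,\dots,+)$, and $K$ is a smooth timelike Killing vector field on $M$ which is irrotational (the distribution orthogonal to $K$ is involutive); $M$ is time-oriented by $K$. Then: (1) Let $\Pi:(\bar M,\bar g)\to(M,g)$ be the universal Lorentzian covering, i.e. $\bar M$ is a simply connected manifold and $\Pi$ is a smooth covering map with $\bar g=\Pi^*g$, and let $\bar M$ carry the lifted time orientation. Then $(\bar M,\bar g)$ is standard static: there are a smooth manifold $S$ with a Riemannian metric $g_S$, a smooth function $\beta:S\to(0,\infty)$, and an isometry from $\mathbb R\times S$ with the metric $-\beta(x)\,dt^2+g_S$ onto $(\bar M,\bar g)$. Moreover, $(\bar M,\bar g)$ admits a (not necessarily compact) Cauchy hypersurface, i.e. a subset which every inextendible piecewise smooth causal curve meets exactly once. (2) $(M,g)$ is totally vicious: $I^+(p)=I^-(p)=M$ for every $p\in M$, where $I^+(p)$ (respectively $I^-(p)$) is the set of all $q\in M$ such that there is a piecewise smooth future-directed timelike curve from $p$ to $q$ (respectively from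 $q$ to $p$). -/

import Mathlib

open Set Filter Bundle Manifold
open scoped Manifold ContDiff Topology

universe u v

noncomputable section

/-- A smooth Lorentzian metric of signature `(-, +, …, +)` on a `d`-dimensional manifold `M`. -/
structure LorentzMetric (d : ℕ) (M : Type u) [TopologicalSpace M]
    [ChartedSpace (EuclideanSpace ℝ (Fin d)) M] [IsManifold (𝓡 d) ∞ M] where
  /-- The bilinear form on each tangent space. -/
  val (x : M) : TangentSpace (𝓡 d) x →L[ℝ] TangentSpace (𝓡 d) x →L[ℝ] ℝ
  symm (x : M) (v w : TangentSpace (𝓡 d) x) : val x v w = val x w v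
  /-- Signature `(-, +, …, +)`: some vector `v` is negative and the form is positive definite on
  the orthogonal complement of `v`. -/
  signature (x : M) : ∃ v : TangentSpace (𝓡 d) x, val x v v < 0 ∧
    ∀ w : TangentSpace (𝓡 d) x, val x v w = 0 → w ≠ 0 → 0 < val x w w
  contMDiff : ContMDiff (𝓡 d)
    ((𝓡 d).prod 𝓘(ℝ, EuclideanSpace ℝ (Fin d) →L[ℝ] EuclideanSpace ℝ (Fin d) →L[ℝ] ℝ)) ∞
    (fun x : M ↦ TotalSpace.mk'
      (EuclideanSpace ℝ (Fin d) →L[ℝ] EuclideanSpace ℝ (Fin d) →L[ℝ] ℝ) x (val x))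

namespace LorentzMetric

section General

variable {d : ℕ} {M : Type u} [TopologicalSpace M]
  [ChartedSpace (EuclideanSpace ℝ (Fin d)) M] [IsManifold (𝓡 d) ∞ M]

/-- `K` is a Killing vector field, `L_K g = 0`: for all smooth vector fields `X`, `Y` on an open
set, `K (g (X, Y)) = g ([K, X], Y) + g (X, [K, Y])`. -/
def IsKilling (g : LorentzMetric d M) (K : Π x : M, TangentSpace (𝓡 d) x) : Prop :=
  ∀ U : Set M, IsOpen U → ∀ X Y : Π x : M, TangentSpace (𝓡 d) x,
    ContMDiffOn (𝓡 d) (𝓡 d).tangent ∞ (fun x ↦ (⟨x, X x⟩ : TangentBundle (𝓡 d) M)) U →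
    ContMDiffOn (𝓡 d) (𝓡 d).tangent ∞ (fun x ↦ (⟨x, Y x⟩ : TangentBundle (𝓡 d) M)) U →
    ∀ x ∈ U, mfderiv (𝓡 d) 𝓘(ℝ, ℝ) (fun y ↦ g.val y (X y) (Y y)) x (K x) =
      g.val x (VectorField.mlieBracket (𝓡 d) K X x) (Y x) +
        g.val x (X x) (VectorField.mlieBracket (𝓡 d) K Y x)

/-- `K` is irrotational: the distribution orthogonal to `K` is involutive, that is, the bracket of
two smooth local sections of it is again a section of it. -/
def IsIrrotational (g : LorentzMetric d M) (K : Π x : M, TangentSpace (𝓡 d) x) : Prop :=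
  ∀ U : Set M, IsOpen U → ∀ X Y : Π x : M, TangentSpace (𝓡 d) x,
    ContMDiffOn (𝓡 d) (𝓡 d).tangent ∞ (fun x ↦ (⟨x, X x⟩ : TangentBundle (𝓡 d) M)) U →
    ContMDiffOn (𝓡 d) (𝓡 d).tangent ∞ (fun x ↦ (⟨x, Y x⟩ : TangentBundle (𝓡 d) M)) U →
    (∀ x ∈ U, g.val x (X x) (K x) = 0) → (∀ x ∈ U, g.val x (Y x) (K x) = 0) →
    ∀ x ∈ U, g.val x (VectorField.mlieBracket (𝓡 d) X Y x) (K x) = 0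

/-- `K` is a static vector field: a smooth, timelike, irrotational Killing vector field. -/
structure IsStaticField (g : LorentzMetric d M) (K : Π x : M, TangentSpace (𝓡 d) x) : Prop where
  smooth : ContMDiff (𝓡 d) (𝓡 d).tangent ∞ (fun x ↦ (⟨x, K x⟩ : TangentBundle (𝓡 d) M))
  timelike : ∀ x, g.val x (K x) (K x) < 0
  killing : g.IsKilling K
  irrotational : g.IsIrrotational K

/-- Future-directed timelike tangent vectors, for the time orientation given by the timelike
vector field `T`. -/
def FutureTimelike (g : LorentzMetric d M) (T : Π x : M, TangentSpace (𝓡 d) x)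
    (x : M) (v : TangentSpace (𝓡 d) x) : Prop :=
  g.val x v v < 0 ∧ g.val x v (T x) < 0

/-- Future-directed causal (nonspacelike, nonzero) tangent vectors, for the time orientation given
by the timelike vector field `T`; the second condition forces `v ≠ 0`. -/
def FutureCausal (g : LorentzMetric d M) (T : Π x : M, TangentSpace (𝓡 d) x)
    (x : M) (v : TangentSpace (𝓡 d) x) : Prop :=
  g.val x v v ≤ 0 ∧ g.val x v (T x) < 0

end General

end LorentzMetric

section Curves

variable {d : ℕ} {M : Type u} [TopologicalSpace M] [ChartedSpace (EuclideanSpace ℝ (Fin d)) M]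

/-- `γ` is a piecewise smooth curve on the interval `J` all of whose velocities satisfy `C`.
There is a set `B` of break points, finite in every compact subinterval of `J`, such that on every
compact subinterval `[a, b]` of `J` without break points in its interior `γ` is smooth up to the
end points with (at the end points one-sided) velocities satisfying `C`. -/
structure IsPiecewiseSmoothCurve (C : Π x : M, TangentSpace (𝓡 d) x → Prop)
    (J : Set ℝ) (γ : ℝ → M) : Prop where
  ordConnected : J.OrdConnected
  continuousOn : ContinuousOn γ J
  pieces : ∃ B : Set ℝ, (∀ a ∈ J, ∀ b ∈ J, (B ∩ Icc a b).Finite) ∧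
    ∀ a ∈ J, ∀ b ∈ J, a < b → Disjoint B (Ioo a b) →
      ContMDiffOn 𝓘(ℝ, ℝ) (𝓡 d) ∞ γ (Icc a b) ∧
      ∀ t ∈ Icc a b, C (γ t) (mfderivWithin 𝓘(ℝ, ℝ) (𝓡 d) γ (Icc a b) t (1 : ℝ))

end Curves

/-- A curve on the interval `J` is inextendible: it has neither a future nor a past end point. (If
`J` contains its supremum or infimum, that value of `γ` is an end point, so `J` is open.) -/
def IsInextendible {M : Type u} [TopologicalSpace M] (J : Set ℝ) (γ : ℝ → M) : Prop :=
  ∀ x : M, ¬ Tendsto (fun t : J ↦ γ t) atTop (𝓝 x) ∧ ¬ Tendsto (fun t : J ↦ γ t) atBot (𝓝 x)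

namespace LorentzMetric

section Causality

variable {d : ℕ} {M : Type u} [TopologicalSpace M]
  [ChartedSpace (EuclideanSpace ℝ (Fin d)) M] [IsManifold (𝓡 d) ∞ M]

/-- The chronological future `I⁺(p)`: end points of piecewise smooth future-directed timelike
curves that start at `p`. -/
def chronologicalFuture (g : LorentzMetric d M) (T : Π x : M, TangentSpace (𝓡 d) x)
    (p : M) : Set M :=
  {q | ∃ (γ : ℝ → M) (a b : ℝ), a < b ∧ γ a = p ∧ γ b = q ∧
    IsPiecewiseSmoothCurve (g.FutureTimelike T) (Icc a b) γ}

/-- The chronological past `I⁻(p)`. -/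
def chronologicalPast (g : LorentzMetric d M) (T : Π x : M, TangentSpace (𝓡 d) x)
    (p : M) : Set M :=
  {q | p ∈ g.chronologicalFuture T q}

/-- A Cauchy hypersurface: a subset that every inextendible piecewise smooth causal curve meets
exactly once. (As the spacetime is time-oriented by `T`, every causal curve is future-directed
after reversing its parameter, if necessary.) -/
def IsCauchyHypersurface (g : LorentzMetric d M) (T : Π x : M, TangentSpace (𝓡 d) x)
    (A : Set M) : Prop :=
  ∀ (J : Set ℝ) (γ : ℝ → M), IsPiecewiseSmoothCurve (g.FutureCausal T) J γ →
    IsInextendible J γ → ∃! t : ℝ, t ∈ J ∧ γ t ∈ A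

/-- `(N, gN)` with the projection `proj` is a universal Lorentzian covering of `(M, g)`: `N` is simply
connected (in particular path connected) and `proj` is a smooth covering map and a local isometry. -/
structure IsUniversalLorentzianCovering (g : LorentzMetric d M) {N : Type v} [TopologicalSpace N]
    [ChartedSpace (EuclideanSpace ℝ (Fin d)) N] [IsManifold (𝓡 d) ∞ N]
    (gN : LorentzMetric d N) (proj : N → M) : Prop where
  simplyConnected : SimplyConnectedSpace N
  surjective : Function.Surjective proj
  isCoveringMap : IsCoveringMap proj
  isLocalDiffeomorph : IsLocalDiffeomorph (𝓡 d) (𝓡 d) ∞ proj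
  isometry : ∀ (x : N) (v w : TangentSpace (𝓡 d) x), gN.val x v w =
    g.val (proj x) (mfderiv (𝓡 d) (𝓡 d) proj x v) (mfderiv (𝓡 d) (𝓡 d) proj x w)

end Causality

/-- `(M, g)` is a standard static spacetime: it is isometric to a product `ℝ × S` with the metric
`-β(x) dt² + g_S`, where `(S, g_S)` is a Riemannian manifold and `β` is a positive smooth function
on `S`. -/
def IsStandardStatic {n : ℕ} {M : Type u} [TopologicalSpace M]
    [ChartedSpace (EuclideanSpace ℝ (Fin (n + 1))) M] [IsManifold (𝓡 (n + 1)) ∞ M]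
    (g : LorentzMetric (n + 1) M) : Prop :=
  ∃ (S : Type u) (_ : TopologicalSpace S) (_ : T2Space S) (_ : SecondCountableTopology S)
    (_ : ChartedSpace (EuclideanSpace ℝ (Fin n)) S) (_ : IsManifold (𝓡 n) ∞ S)
    (gS : ContMDiffRiemannianMetric (𝓡 n) ∞ (EuclideanSpace ℝ (Fin n))
      (fun x : S ↦ TangentSpace (𝓡 n) x))
    (β : S → ℝ)
    (Φ : Diffeomorph (𝓘(ℝ, ℝ).prod (𝓡 n)) (𝓡 (n + 1)) (ℝ × S) M ∞),
    ContMDiff (𝓡 n) 𝓘(ℝ, ℝ) ∞ β ∧ (∀ x, 0 < β x) ∧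
    ∀ (t : ℝ) (x : S) (a b : ℝ) (v w : TangentSpace (𝓡 n) x),
      g.val (Φ (t, x))
          (mfderiv (𝓘(ℝ, ℝ).prod (𝓡 n)) (𝓡 (n + 1)) Φ (t, x)
            ((a, v) : ℝ × TangentSpace (𝓡 n) x))
          (mfderiv (𝓘(ℝ, ℝ).prod (𝓡 n)) (𝓡 (n + 1)) Φ (t, x)
            ((b, w) : ℝ × TangentSpace (𝓡 n) x)) =
        -β x * (a * b) + gS.inner x v w

end LorentzMetric

end

/-! Everything rests on the 1-form θ = g(K, ·) / g(K, K), for which θ(K) = 1 and ker θ = K^⊥. The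
Killing equation gives L_K θ = 0, hence i_K dθ = L_K θ - d(θ(K)) = 0; involutivity of K^⊥ makes dθ
vanish on K^⊥ × K^⊥. So θ is closed (`fderiv_symm_of_killing_of_irrotational`), and its pull-back to
a simply connected covering N is dτ for a smooth function τ (`exists_primitive`).

Splitting. As M is compact, K is complete; its flow consists of isometries and lifts to a flow φ_t
of isometries of N with τ(φ_t x) = τ(x) + t. Hence (t, x) ↦ φ_t x is a diffeomorphism from ℝ × {τ =
0} onto N. The slice is tangent to K^⊥, on which the metric is positive definite, and the flow
carries its geometry to every time; the metric becomes -β dt² + g_S with β = -g(K, K)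
(`isStandardStatic_of_flow`).

Cauchy hypersurface. It is {τ = 0}. On future causal vectors dτ > 0, so τ increases strictly along a
causal curve γ and vanishes at most once. Suppose it never vanishes. Then τ is bounded above towards
the future, or below towards the past, and has a limit there. For every smooth F on M, compactness
gives a constant C with |dF(v)| ≤ C θ(v) for future causal v (`exists_bound`), so F composed with
the projected curve is Lipschitz in τ and converges too. Smooth functions separate the points of the
compact space M, so the projection of γ converges; by the covering property γ itself converges,
contrary to inextendibility.

Total viciousness. Each q has a neighbourhood V and a δ such that every r in V precedes φ_δ r' for
every r' in V. Therefore the set of q for which p precedes some φ_s q is open and closed, hence all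
of M. A finite subcover yields one time S that works for all points at once: p precedes φ_S r for
every r. Since φ_S is onto, p precedes every point. -/

section SmoothDependence

/-! ### Smooth dependence of ODE solutions on time and initial value -/

/-- A continuous bilinear map, applied pointwise to continuous functions. -/
noncomputable def ContinuousMap.pointwiseBilinear (X : Type*) [TopologicalSpace X]
    [CompactSpace X] {G E F : Type u} [NormedAddCommGroup G] [NormedSpace ℝ G]
    [NormedAddCommGroup E] [NormedSpace ℝ E] [NormedAddCommGroup F] [NormedSpace ℝ F]
    (B : G →L[ℝ] E →L[ℝ] F) : C(X, G) →L[ℝ] C(X, E) →L[ℝ] C(X, F) :=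
  LinearMap.mkContinuous₂
    (LinearMap.mk₂ ℝ (fun (A : C(X, G)) (h : C(X, E)) ↦
        (⟨fun x ↦ B (A x) (h x), by fun_prop⟩ : C(X, F)))
      (fun _ _ _ ↦ by ext; simp) (fun _ _ _ ↦ by ext; simp)
      (fun _ _ _ ↦ by ext; simp) (fun _ _ _ ↦ by ext; simp)) ‖B‖
    (fun A h ↦ by
      rw [ContinuousMap.norm_le _ (by positivity)]
      intro x
      refine (B.le_opNorm₂ _ _).trans ?_
      gcongr
      exacts [A.norm_coe_le_norm x, h.norm_coe_le_norm x])

@[simp]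
theorem ContinuousMap.pointwiseBilinear_apply {X : Type*} [TopologicalSpace X]
    [CompactSpace X] {G E F : Type u} [NormedAddCommGroup G] [NormedSpace ℝ G]
    [NormedAddCommGroup E] [NormedSpace ℝ E] [NormedAddCommGroup F] [NormedSpace ℝ F]
    (B : G →L[ℝ] E →L[ℝ] F) (A : C(X, G)) (h : C(X, E)) (x : X) :
    ContinuousMap.pointwiseBilinear X B A h x = B (A x) (h x) := rfl

set_option synthInstance.maxHeartbeats 400000 in
-- The range of `u` is compact, so `f'` is uniformly continuous near it; the mean value inequality
-- then bounds the remainder uniformly in the point of `X`, that is, in the sup norm.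
theorem ContinuousMap.hasFDerivAt_postcomp {X : Type*} [TopologicalSpace X] [CompactSpace X]
    {E F : Type u} [NormedAddCommGroup E] [NormedSpace ℝ E] [NormedAddCommGroup F]
    [NormedSpace ℝ F] (f : C(E, F)) (f' : C(E, E →L[ℝ] F)) (hf : ∀ x, HasFDerivAt f (f' x) x)
    (u : C(X, E)) :
    HasFDerivAt (fun u : C(X, E) ↦ f.comp u)
      (ContinuousMap.pointwiseBilinear X (ContinuousLinearMap.id ℝ (E →L[ℝ] F)) (f'.comp u)) u := by
  rw [hasFDerivAt_iff_isLittleO_nhds_zero, Asymptotics.isLittleO_iff]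
  intro c hc
  have hK : IsCompact (range u) := isCompact_range u.continuous
  obtain ⟨δ, hδ, h⟩ : ∃ δ > 0, ∀ x ∈ range u, ∀ y, dist y x < δ → dist (f' y) (f' x) < c := by
    have := hK.uniformContinuousAt_of_continuousAt f' (fun x _ ↦ f'.continuous.continuousAt)
      (Metric.dist_mem_uniformity hc)
    obtain ⟨δ, hδ, h⟩ := Metric.mem_uniformity_dist.1 this
    refine ⟨δ, hδ, fun x hx y hy ↦ ?_⟩
    have := @h x y (by rwa [dist_comm])
    rw [dist_comm]
    exact this hx
  filter_upwards [Metric.ball_mem_nhds (0 : C(X, E)) hδ] with w hw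
  rw [ContinuousMap.norm_le _ (by positivity)]
  intro x
  have hwx : ‖w x‖ ≤ ‖w‖ := w.norm_coe_le_norm x
  have hwδ : ‖w‖ < δ := by simpa using hw
  have key := (convex_ball (u x) δ).norm_image_sub_le_of_norm_hasFDerivWithin_le'
    (f := f) (f' := f') (φ := f' (u x)) (C := c) (x := u x) (y := u x + w x)
    (fun y _ ↦ (hf y).hasFDerivWithinAt)
    (fun y hy ↦ by
      rw [← dist_eq_norm]
      exact (h (u x) ⟨x, rfl⟩ y hy).le)
    (Metric.mem_ball_self hδ) (by simpa using hwx.trans_lt hwδ)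
  rw [add_sub_cancel_left] at key
  calc _ = ‖f (u x + w x) - f (u x) - f' (u x) (w x)‖ := by simp
    _ ≤ c * ‖w x‖ := key
    _ ≤ c * ‖w‖ := by gcongr

set_option synthInstance.maxHeartbeats 400000 in
-- The derivative of postcomposition with `f` is postcomposition with `f'` followed by a fixed
-- bounded linear map, whence an induction on the order. The target `F` varies, since `E →L[ℝ] F`
-- replaces it; this is why `E` and `F` share a universe.
theorem ContinuousMap.contDiff_postcomp_nat {X : Type*} [TopologicalSpace X] [CompactSpace X]
    {E : Type u} [NormedAddCommGroup E] [NormedSpace ℝ E] (m : ℕ) :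
    ∀ {F : Type u} [NormedAddCommGroup F] [NormedSpace ℝ F] (f : C(E, F)),
    ContDiff ℝ m f → ContDiff ℝ m (fun u : C(X, E) ↦ f.comp u) := by
  induction m with
  | zero =>
    intro F _ _ f hf
    rw [Nat.cast_zero, contDiff_zero]
    exact f.continuous_postcomp
  | succ m ih =>
    intro F _ _ f hf
    rw [Nat.cast_succ] at hf ⊢
    have hf1 : ContDiff ℝ 1 f := hf.of_le (by simp)
    let f' : C(E, E →L[ℝ] F) := ⟨fderiv ℝ f, hf1.continuous_fderiv one_ne_zero⟩
    have hf' : ContDiff ℝ m f' := ((contDiff_succ_iff_fderiv.1 hf).2.2)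
    have hd : ∀ u : C(X, E), HasFDerivAt (fun u : C(X, E) ↦ f.comp u)
        (ContinuousMap.pointwiseBilinear X (ContinuousLinearMap.id ℝ (E →L[ℝ] F)) (f'.comp u)) u :=
      ContinuousMap.hasFDerivAt_postcomp f f'
        (fun x ↦ (hf1.differentiable one_ne_zero x).hasFDerivAt)
    rw [contDiff_succ_iff_hasFDerivAt]
    exact ⟨_, (ContinuousMap.pointwiseBilinear X (ContinuousLinearMap.id ℝ (E →L[ℝ] F))).contDiff.comp (ih f' hf'), hd⟩

theorem ContinuousMap.contDiff_postcomp {X : Type*} [TopologicalSpace X] [CompactSpace X]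
    {E F : Type u} [NormedAddCommGroup E] [NormedSpace ℝ E] [NormedAddCommGroup F]
    [NormedSpace ℝ F] (f : C(E, F)) (hf : ContDiff ℝ ∞ f) :
    ContDiff ℝ ∞ (fun u : C(X, E) ↦ f.comp u) := by
  rw [contDiff_infty] at hf ⊢
  exact fun m ↦ ContinuousMap.contDiff_postcomp_nat m f (hf m)

/-- The primitive vanishing at `0` of a continuous function on `[-1, 1]`. -/
noncomputable def ContinuousMap.primitiveCLM (E : Type u) [NormedAddCommGroup E]
    [NormedSpace ℝ E] [CompleteSpace E] :
    C(Icc (-1 : ℝ) 1, E) →L[ℝ] C(Icc (-1 : ℝ) 1, E) :=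
  LinearMap.mkContinuous
    { toFun := fun w ↦ ⟨fun r ↦ ∫ s in (0 : ℝ)..r, w (projIcc (-1) 1 (by norm_num) s),
        (intervalIntegral.continuous_primitive (fun a b ↦
          (w.continuous.comp continuous_projIcc).intervalIntegrable a b) 0).comp
            continuous_subtype_val⟩
      map_add' := fun w w' ↦ by
        ext r
        exact intervalIntegral.integral_add
          ((w.continuous.comp continuous_projIcc).intervalIntegrable _ _)
          ((w'.continuous.comp continuous_projIcc).intervalIntegrable _ _)
      map_smul' := fun c w ↦ by
        ext r
        exact intervalIntegral.integral_smul c _ } 1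
    (fun w ↦ by
      rw [one_mul, ContinuousMap.norm_le _ (norm_nonneg _)]
      intro r
      have := intervalIntegral.norm_integral_le_of_norm_le_const (a := 0) (b := (r : ℝ))
        (f := fun s ↦ w (projIcc (-1) 1 (by norm_num) s)) (C := ‖w‖)
        (fun s _ ↦ w.norm_coe_le_norm _)
      refine this.trans ?_
      have hr : |(r : ℝ) - 0| ≤ 1 := by
        rw [sub_zero, abs_le]; exact r.2
      exact mul_le_of_le_one_right (norm_nonneg _) hr)

theorem ContinuousMap.primitiveCLM_apply {E : Type u} [NormedAddCommGroup E]
    [NormedSpace ℝ E] [CompleteSpace E] (w : C(Icc (-1 : ℝ) 1, E)) (r : Icc (-1 : ℝ) 1) :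
    ContinuousMap.primitiveCLM E w r =
      ∫ s in (0 : ℝ)..r, w (projIcc (-1) 1 (by norm_num) s) := rfl

/-- Smooth dependence of the solutions of `u' = s • f u`, `u 0 = x` on `(s, x)`, near `s = 0`. -/
theorem exists_smooth_local_flow_of_contDiff {E : Type u} [NormedAddCommGroup E]
    [NormedSpace ℝ E] [CompleteSpace E] (f : E → E) (hf : ContDiff ℝ ∞ f) (x₀ : E) :
    ∃ Ψ : ℝ × E → C(Icc (-1 : ℝ) 1, E), ContDiffAt ℝ ∞ Ψ (0, x₀) ∧
      Ψ (0, x₀) = ContinuousMap.const _ x₀ ∧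
      ∀ᶠ p in 𝓝 ((0 : ℝ), x₀), Ψ p ⟨0, by norm_num⟩ = p.2 ∧
        ∀ r ∈ Ioo (-1 : ℝ) 1, HasDerivAt (fun s ↦ Ψ p (projIcc (-1) 1 (by norm_num) s))
          (p.1 • f (Ψ p (projIcc (-1) 1 (by norm_num) r))) r := by
  let fc : C(E, E) := ⟨f, hf.continuous⟩
  -- Zeros of `H` are the solutions of u = x + s ∫₀ f(u). At s = 0 the partial derivative in u is
  -- the identity, so the implicit function theorem in the Banach space of curves solves for u,
  -- smoothly in (s, x).
  let H : (ℝ × E) × C(Icc (-1 : ℝ) 1, E) → C(Icc (-1 : ℝ) 1, E) := fun q ↦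
    q.2 - ContinuousLinearMap.const ℝ (Icc (-1 : ℝ) 1) q.1.2 -
      q.1.1 • ContinuousMap.primitiveCLM E (fc.comp q.2)
  let u₀ : (ℝ × E) × C(Icc (-1 : ℝ) 1, E) := ((0, x₀), ContinuousMap.const _ x₀)
  have hH : ContDiff ℝ ∞ H := by
    have h1 := (ContinuousMap.contDiff_postcomp (X := Icc (-1 : ℝ) 1) fc hf)
    have h2 : ContDiff ℝ ∞ (fun q : (ℝ × E) × C(Icc (-1 : ℝ) 1, E) ↦ fc.comp q.2) :=
      h1.comp contDiff_snd
    exact (contDiff_snd.sub ((ContinuousLinearMap.const ℝ (Icc (-1 : ℝ) 1)).contDiff.comp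
      (contDiff_snd.comp contDiff_fst))).sub
      ((contDiff_fst.comp contDiff_fst).smul ((ContinuousMap.primitiveCLM E).contDiff.comp h2))
  have hHu : H u₀ = 0 := by
    ext r
    simp [H, u₀]
  have hinv : (fderiv ℝ H u₀ ∘L .inr ℝ (ℝ × E) C(Icc (-1 : ℝ) 1, E)) =
      ContinuousLinearMap.id ℝ _ := by
    have h1 : HasFDerivAt (fun w : C(Icc (-1 : ℝ) 1, E) ↦ H ((0, x₀), w))
        (fderiv ℝ H u₀ ∘L .inr ℝ (ℝ × E) C(Icc (-1 : ℝ) 1, E)) u₀.2 := by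
      have := (hH.differentiable (by simp) u₀).hasFDerivAt
      exact this.comp u₀.2 (hasFDerivAt_prodMk_right (0, x₀) u₀.2)
    have h2 : HasFDerivAt (fun w : C(Icc (-1 : ℝ) 1, E) ↦ H ((0, x₀), w))
        (ContinuousLinearMap.id ℝ _) u₀.2 := by
      have : (fun w : C(Icc (-1 : ℝ) 1, E) ↦ H ((0, x₀), w)) =
          fun w ↦ w - ContinuousLinearMap.const ℝ (Icc (-1 : ℝ) 1) x₀ := by
        ext w r; simp [H]
      rw [this]
      exact (hasFDerivAt_id _).sub_const _
    exact h1.unique h2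
  have hinv' : (fderiv ℝ H u₀ ∘L .inr ℝ (ℝ × E) C(Icc (-1 : ℝ) 1, E)).IsInvertible := by
    rw [hinv]; exact ⟨ContinuousLinearEquiv.refl ℝ _, rfl⟩
  have cdf : ContDiffAt ℝ ∞ H u₀ := hH.contDiffAt
  refine ⟨cdf.implicitFunction (by simp) hinv', cdf.contDiffAt_implicitFunction _ hinv',
    cdf.implicitFunction_apply_self _ hinv', ?_⟩
  filter_upwards [cdf.eventually_apply_implicitFunction (by simp) hinv'] with p hp
  set w := cdf.implicitFunction (by simp) hinv' p
  rw [hHu] at hp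
  have hw : ∀ r, w r = p.2 + p.1 • ∫ s in (0 : ℝ)..r, f (w (projIcc (-1) 1 (by norm_num) s)) := by
    intro r
    have := congrArg (fun z : C(Icc (-1 : ℝ) 1, E) ↦ z r) hp
    simp only [H, ContinuousMap.sub_apply, ContinuousMap.smul_apply, ContinuousMap.zero_apply,
      ContinuousMap.primitiveCLM_apply, ContinuousMap.comp_apply] at this
    rw [sub_sub, sub_eq_zero] at this
    exact this
  refine ⟨by rw [hw]; simp, fun r hr ↦ ?_⟩
  have hcont : Continuous (fun s ↦ f (w (projIcc (-1) 1 (by norm_num) s))) :=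
    hf.continuous.comp (w.continuous.comp continuous_projIcc)
  have h1 : HasDerivAt (fun r : ℝ ↦ p.2 + p.1 •
      ∫ s in (0 : ℝ)..r, f (w (projIcc (-1) 1 (by norm_num) s)))
      (p.1 • f (w (projIcc (-1) 1 (by norm_num) r))) r :=
    ((intervalIntegral.integral_hasDerivAt_right (hcont.intervalIntegrable _ _)
      hcont.aestronglyMeasurable.stronglyMeasurableAtFilter hcont.continuousAt).const_smul
      p.1).const_add p.2
  refine h1.congr_of_eventuallyEq ?_
  filter_upwards [Ioo_mem_nhds hr.1 hr.2] with s hs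
  rw [hw, projIcc_of_mem _ (Ioo_subset_Icc_self hs)]

/-- Smooth dependence for a vector field which is smooth near a point. -/
theorem exists_smooth_local_flow {E : Type u} [NormedAddCommGroup E]
    [NormedSpace ℝ E] [FiniteDimensional ℝ E] (f : E → E) {U : Set E} (hU : IsOpen U)
    (hf : ContDiffOn ℝ ∞ f U) {x₀ : E} (hx₀ : x₀ ∈ U) :
    ∃ Ψ : ℝ × E → ℝ → E, ContDiffAt ℝ ∞ (fun p : ℝ × E ↦ Ψ (2 * p.1, p.2) (1 / 2)) (0, x₀) ∧
      ∀ᶠ p in 𝓝 ((0 : ℝ), x₀), Ψ p 0 = p.2 ∧ ∀ r ∈ Ioo (-1 : ℝ) 1, Ψ p r ∈ U ∧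
        HasDerivAt (Ψ p) (p.1 • f (Ψ p r)) r := by
  obtain ⟨ε, hε, hεU⟩ := Metric.isOpen_iff.1 hU x₀ hx₀
  -- The cutoff makes the field globally smooth. Solutions close to the constant curve x₀ remain in
  -- the ball of radius ε/3, where `b` equals 1, and so solve the original equation.
  let b : ContDiffBump x₀ := ⟨ε / 3, ε / 2, by positivity, by linarith⟩
  have hbf : ContDiff ℝ ∞ (fun x ↦ b x • f x) := by
    rw [contDiff_iff_contDiffAt]
    intro x
    by_cases hx : x ∈ U
    · exact b.contDiff.contDiffAt.smul (hf.contDiffAt (hU.mem_nhds hx))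
    · have : x ∉ tsupport b := by
        rw [b.tsupport_eq]
        intro h
        apply hx (hεU _)
        rw [Metric.mem_closedBall] at h
        rw [Metric.mem_ball]
        change dist x x₀ ≤ ε / 2 at h
        linarith
      refine (contDiffAt_const (c := (0 : E))).congr_of_eventuallyEq ?_
      filter_upwards [notMem_tsupport_iff_eventuallyEq.1 this] with y hy
      simp [hy]
  obtain ⟨Ψ, hΨ, hΨ0, hev⟩ := exists_smooth_local_flow_of_contDiff _ hbf x₀
  refine ⟨fun p r ↦ Ψ p (projIcc (-1) 1 (by norm_num) r), ?_, ?_⟩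
  -- Parameter 2s at r = 1/2 is the flow at time s; r = 1 would be an end point of the open interval
  -- on which the equation is known.
  · have h1 : ContDiffAt ℝ ∞ (fun p : ℝ × E ↦ Ψ (2 * p.1, p.2)) (0, x₀) := by
      refine ContDiffAt.comp (0, x₀) (g := Ψ) (f := fun p : ℝ × E ↦ (2 * p.1, p.2)) ?_ ?_
      · simpa using hΨ
      · fun_prop
    exact ((ContinuousMap.evalCLM ℝ (M := E)
      (projIcc (-1) 1 (by norm_num) (1 / 2 : ℝ))).contDiff.contDiffAt).comp _ h1
  · have hcl : ∀ᶠ p in 𝓝 ((0 : ℝ), x₀), Ψ p ∈ Metric.ball (Ψ (0, x₀)) (ε / 3) :=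
      hΨ.continuousAt.eventually (Metric.ball_mem_nhds _ (by positivity))
    filter_upwards [hev, hcl] with p hp hpb
    refine ⟨?_, fun r hr ↦ ?_⟩
    · rw [← hp.1, projIcc_of_mem _ (by norm_num : (0 : ℝ) ∈ Icc (-1 : ℝ) 1)]
    · have hmem : Ψ p (projIcc (-1) 1 (by norm_num) r) ∈ Metric.ball x₀ (ε / 3) := by
        have h1 := (ContinuousMap.dist_apply_le_dist (f := Ψ p) (g := Ψ (0, x₀))
          (projIcc (-1) 1 (by norm_num) r)).trans_lt hpb
        rwa [hΨ0] at h1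
      refine ⟨hεU (Metric.ball_subset_ball (by linarith) hmem), ?_⟩
      have h2 := hp.2 r hr
      have h3 : b (Ψ p (projIcc (-1) 1 (by norm_num) r)) = 1 :=
        b.one_of_mem_closedBall (Metric.ball_subset_closedBall hmem)
      rwa [h3, one_smul] at h2

end SmoothDependence

noncomputable section

/-! ### Metrics and vector fields in a chart -/

section ChartRepresentation

variable {d : ℕ} {M : Type u} [TopologicalSpace M]
  [ChartedSpace (EuclideanSpace ℝ (Fin d)) M] [IsManifold (𝓡 d) ∞ M]

theorem isLocalDiffeomorphAt_extChartAt_symm (m : M) {y : EuclideanSpace ℝ (Fin d)}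
    (hy : y ∈ (extChartAt (𝓡 d) m).target) :
    IsLocalDiffeomorphAt 𝓘(ℝ, EuclideanSpace ℝ (Fin d)) (𝓡 d) ∞ (extChartAt (𝓡 d) m).symm y :=
  ⟨{ toPartialEquiv := (extChartAt (𝓡 d) m).symm
     open_source := isOpen_extChartAt_target m
     open_target := isOpen_extChartAt_source m
     contMDiffOn_toFun := contMDiffOn_extChartAt_symm m
     contMDiffOn_invFun := by
       have := contMDiffOn_extChartAt (I := 𝓡 d) (n := ∞) (x := m)
       rwa [← extChartAt_source (𝓡 d)] at this }, hy, fun _ _ ↦ rfl⟩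

theorem isLocalDiffeomorphAt_extChartAt (m : M) {x : M}
    (hx : x ∈ (extChartAt (𝓡 d) m).source) :
    IsLocalDiffeomorphAt (𝓡 d) 𝓘(ℝ, EuclideanSpace ℝ (Fin d)) ∞ (extChartAt (𝓡 d) m) x :=
  ⟨{ toPartialEquiv := extChartAt (𝓡 d) m
     open_source := isOpen_extChartAt_source m
     open_target := isOpen_extChartAt_target m
     contMDiffOn_toFun := by
       have := contMDiffOn_extChartAt (I := 𝓡 d) (n := ∞) (x := m)
       rwa [← extChartAt_source (𝓡 d)] at this
     contMDiffOn_invFun := contMDiffOn_extChartAt_symm m }, hx, fun _ _ ↦ rfl⟩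

theorem IsLocalDiffeomorphAt.isInvertible_mfderiv
    {E : Type*} [NormedAddCommGroup E] [NormedSpace ℝ E] {H : Type*} [TopologicalSpace H]
    {I : ModelWithCorners ℝ E H} {P : Type*} [TopologicalSpace P] [ChartedSpace H P]
    {E' : Type*} [NormedAddCommGroup E'] [NormedSpace ℝ E'] {H' : Type*} [TopologicalSpace H']
    {I' : ModelWithCorners ℝ E' H'} {P' : Type*} [TopologicalSpace P'] [ChartedSpace H' P']
    {f : P → P'} {x : P} (hf : IsLocalDiffeomorphAt I I' ∞ f x) :
    (mfderiv I I' f x).IsInvertible :=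
  ⟨hf.mfderivToContinuousLinearEquiv (by simp), hf.mfderivToContinuousLinearEquiv_coe (by simp)⟩

/-- The derivative of the inverse of the preferred chart at `m`. -/
def chartSymmDeriv (d : ℕ) {M : Type u} [TopologicalSpace M]
    [ChartedSpace (EuclideanSpace ℝ (Fin d)) M] (m : M) (y : EuclideanSpace ℝ (Fin d)) :
    EuclideanSpace ℝ (Fin d) →L[ℝ] EuclideanSpace ℝ (Fin d) :=
  mfderiv 𝓘(ℝ, EuclideanSpace ℝ (Fin d)) (𝓡 d) (extChartAt (𝓡 d) m).symm y

/-- The vector field `K` in the preferred chart at `m`. -/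
def chartField (K : Π x : M, TangentSpace (𝓡 d) x) (m : M) (y : EuclideanSpace ℝ (Fin d)) :
    EuclideanSpace ℝ (Fin d) :=
  VectorField.mpullback 𝓘(ℝ, EuclideanSpace ℝ (Fin d)) (𝓡 d) (extChartAt (𝓡 d) m).symm K y

/-- The metric `g` in the preferred chart at `m`. -/
def LorentzMetric.chartMetric (g : LorentzMetric d M) (m : M) (y : EuclideanSpace ℝ (Fin d)) :
    EuclideanSpace ℝ (Fin d) →L[ℝ] EuclideanSpace ℝ (Fin d) →L[ℝ] ℝ :=
  ContinuousLinearMap.bilinearComp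
    (g.val ((extChartAt (𝓡 d) m).symm y) :
      EuclideanSpace ℝ (Fin d) →L[ℝ] EuclideanSpace ℝ (Fin d) →L[ℝ] ℝ)
    (chartSymmDeriv d m y) (chartSymmDeriv d m y)

theorem LorentzMetric.chartMetric_apply (g : LorentzMetric d M) (m : M)
    (y v w : EuclideanSpace ℝ (Fin d)) :
    g.chartMetric m y v w = g.val ((extChartAt (𝓡 d) m).symm y)
      (mfderiv 𝓘(ℝ, EuclideanSpace ℝ (Fin d)) (𝓡 d) (extChartAt (𝓡 d) m).symm y v)
      (mfderiv 𝓘(ℝ, EuclideanSpace ℝ (Fin d)) (𝓡 d) (extChartAt (𝓡 d) m).symm y w) := rfl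

theorem mfderiv_symm_chartField (K : Π x : M, TangentSpace (𝓡 d) x) (m : M)
    {y : EuclideanSpace ℝ (Fin d)} (hy : y ∈ (extChartAt (𝓡 d) m).target) :
    mfderiv 𝓘(ℝ, EuclideanSpace ℝ (Fin d)) (𝓡 d) (extChartAt (𝓡 d) m).symm y (chartField K m y) =
      K ((extChartAt (𝓡 d) m).symm y) :=
  (isLocalDiffeomorphAt_extChartAt_symm m hy).isInvertible_mfderiv.self_apply_inverse _

theorem contDiffOn_chartField {K : Π x : M, TangentSpace (𝓡 d) x} {m : M}
    (hK : ContMDiff (𝓡 d) (𝓡 d).tangent ∞ (fun x ↦ (⟨x, K x⟩ : TangentBundle (𝓡 d) M))) :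
    ContDiffOn ℝ ∞ (chartField K m) (extChartAt (𝓡 d) m).target := by
  intro y hy
  have h1 := ContMDiffAt.mpullback_vectorField_preimage (V := K)
    (hK.contMDiffAt (x := (extChartAt (𝓡 d) m).symm y))
    (isLocalDiffeomorphAt_extChartAt_symm m hy).contMDiffAt
    (isLocalDiffeomorphAt_extChartAt_symm m hy).isInvertible_mfderiv (by simp)
  rw [contMDiffAt_vectorSpace_iff_contDiffAt] at h1
  exact h1.contDiffWithinAt

/-- The pull-back of a metric under a smooth map, evaluated on smooth vector fields, is smooth. -/
theorem LorentzMetric.contMDiffAt_pullback (g : LorentzMetric d M)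
    {E : Type*} [NormedAddCommGroup E] [NormedSpace ℝ E] {H : Type*} [TopologicalSpace H]
    {I : ModelWithCorners ℝ E H} {P : Type*} [TopologicalSpace P] [ChartedSpace H P]
    {f : P → M} {p : P} {X Y : Π x : P, TangentSpace (𝓡 d) (f x)}
    (hX : ContMDiffAt I (𝓡 d).tangent ∞ (fun x ↦ (⟨f x, X x⟩ : TangentBundle (𝓡 d) M)) p)
    (hY : ContMDiffAt I (𝓡 d).tangent ∞ (fun x ↦ (⟨f x, Y x⟩ : TangentBundle (𝓡 d) M)) p) :
    ContMDiffAt I 𝓘(ℝ, ℝ) ∞ (fun x ↦ g.val (f x) (X x) (Y x)) p := by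
  have hf : ContMDiffAt I (𝓡 d) ∞ f p := (contMDiffAt_totalSpace.1 hX).1
  have h := ContMDiffAt.clm_bundle_apply₂ (F₁ := EuclideanSpace ℝ (Fin d))
    (F₂ := EuclideanSpace ℝ (Fin d)) (F₃ := ℝ) (E₃ := fun _ : M ↦ ℝ) (b := f)
    (ψ := fun x ↦ g.val (f x)) (v := X) (w := Y)
    ((g.contMDiff.contMDiffAt (x := f p)).comp p hf) hX hY
  exact (contMDiffAt_totalSpace.1 h).2

theorem ContMDiffAt.mfderiv_vectorField
    {E : Type*} [NormedAddCommGroup E] [NormedSpace ℝ E] {H : Type*} [TopologicalSpace H]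
    {I : ModelWithCorners ℝ E H} {P : Type*} [TopologicalSpace P] [ChartedSpace H P]
    [IsManifold I ∞ P] {f : P → M} {p : P} {X : Π x : P, TangentSpace I x}
    (hf : ContMDiffAt I (𝓡 d) ∞ f p)
    (hX : ContMDiffAt I I.tangent ∞ (fun x ↦ (⟨x, X x⟩ : TangentBundle I P)) p) :
    ContMDiffAt I (𝓡 d).tangent ∞
      (fun x ↦ (⟨f x, mfderiv I (𝓡 d) f x (X x)⟩ : TangentBundle (𝓡 d) M)) p := by
  have h1 := ContMDiffAt.clm_apply_of_inCoordinates
    (F₁ := E) (E₁ := (TangentSpace I : P → Type _)) (F₂ := EuclideanSpace ℝ (Fin d))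
    (E₂ := (TangentSpace (𝓡 d) : M → Type _)) (b₁ := id) (b₂ := f)
    (ϕ := fun x ↦ mfderiv I (𝓡 d) f x) (v := X) (n := ∞) (m₀ := p)
    (hf.mfderiv_const (by simp)) hX hf
  exact h1

theorem LorentzMetric.contDiffOn_chartMetric (g : LorentzMetric d M) (m : M) :
    ContDiffOn ℝ ∞ (g.chartMetric m) (extChartAt (𝓡 d) m).target := by
  rw [contDiffOn_clm_apply]
  intro v
  rw [contDiffOn_clm_apply]
  intro w y hy
  have hc : ∀ v : EuclideanSpace ℝ (Fin d), ContMDiffAt 𝓘(ℝ, EuclideanSpace ℝ (Fin d))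
      𝓘(ℝ, EuclideanSpace ℝ (Fin d)).tangent ∞
      (fun x ↦ (⟨x, v⟩ : TangentBundle 𝓘(ℝ, EuclideanSpace ℝ (Fin d))
        (EuclideanSpace ℝ (Fin d)))) y := by
    exact fun v ↦ (contMDiffAt_vectorSpace_iff_contDiffAt
      (V := fun _ : EuclideanSpace ℝ (Fin d) ↦ v)).2 contDiffAt_const
  have hs := (isLocalDiffeomorphAt_extChartAt_symm m hy).contMDiffAt
  exact (g.contMDiffAt_pullback (hs.mfderiv_vectorField (hc v))
    (hs.mfderiv_vectorField (hc w))).contDiffAt.contDiffWithinAt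

end ChartRepresentation

/-! ### Brackets and the Killing equation in a chart -/

section LocalStatic

variable {d : ℕ} {M : Type u} [TopologicalSpace M]
  [ChartedSpace (EuclideanSpace ℝ (Fin d)) M] [IsManifold (𝓡 d) ∞ M]

/-- The vector field on the domain of the preferred chart at `m` represented by `X`. -/
def chartPush (X : EuclideanSpace ℝ (Fin d) → EuclideanSpace ℝ (Fin d)) (m : M) :
    Π x : M, TangentSpace (𝓡 d) x :=
  VectorField.mpullback (𝓡 d) 𝓘(ℝ, EuclideanSpace ℝ (Fin d)) (extChartAt (𝓡 d) m) X

theorem contMDiffOn_chartPush {X : EuclideanSpace ℝ (Fin d) → EuclideanSpace ℝ (Fin d)} {m : M}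
    (hX : ContDiffOn ℝ ∞ X (extChartAt (𝓡 d) m).target) :
    ContMDiffOn (𝓡 d) (𝓡 d).tangent ∞
      (fun x ↦ (⟨x, chartPush X m x⟩ : TangentBundle (𝓡 d) M)) (extChartAt (𝓡 d) m).source := by
  intro x hx
  have hX' : ContMDiffAt 𝓘(ℝ, EuclideanSpace ℝ (Fin d))
      𝓘(ℝ, EuclideanSpace ℝ (Fin d)).tangent ∞
      (fun x ↦ (⟨x, X x⟩ : TangentBundle 𝓘(ℝ, EuclideanSpace ℝ (Fin d))
        (EuclideanSpace ℝ (Fin d)))) (extChartAt (𝓡 d) m x) :=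
    (contMDiffAt_vectorSpace_iff_contDiffAt (V := X)).2
      (hX.contDiffAt ((isOpen_extChartAt_target m).mem_nhds
        ((extChartAt (𝓡 d) m).map_source hx)))
  exact (ContMDiffAt.mpullback_vectorField_preimage hX'
    (isLocalDiffeomorphAt_extChartAt m hx).contMDiffAt
    (isLocalDiffeomorphAt_extChartAt m hx).isInvertible_mfderiv (by simp)).contMDiffWithinAt

theorem mfderiv_extChartAt_mfderiv_symm (m : M) {y : EuclideanSpace ℝ (Fin d)}
    (hy : y ∈ (extChartAt (𝓡 d) m).target) (v : EuclideanSpace ℝ (Fin d)) :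
    mfderiv (𝓡 d) 𝓘(ℝ, EuclideanSpace ℝ (Fin d)) (extChartAt (𝓡 d) m)
      ((extChartAt (𝓡 d) m).symm y)
      (mfderiv 𝓘(ℝ, EuclideanSpace ℝ (Fin d)) (𝓡 d) (extChartAt (𝓡 d) m).symm y v) = v := by
  have h := mfderiv_extChartAt_comp_mfderivWithin_extChartAt_symm (I := 𝓡 d) hy
  rw [ModelWithCorners.range_eq_univ, mfderivWithin_univ] at h
  exact congrArg (fun L ↦ L v) h

theorem mfderiv_symm_mfderiv_extChartAt (m : M) {x : M}
    (hx : x ∈ (extChartAt (𝓡 d) m).source) (v : TangentSpace (𝓡 d) x) :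
    mfderiv 𝓘(ℝ, EuclideanSpace ℝ (Fin d)) (𝓡 d) (extChartAt (𝓡 d) m).symm
      (extChartAt (𝓡 d) m x)
      (mfderiv (𝓡 d) 𝓘(ℝ, EuclideanSpace ℝ (Fin d)) (extChartAt (𝓡 d) m) x v) = v := by
  have h := mfderivWithin_extChartAt_symm_comp_mfderiv_extChartAt' (I := 𝓡 d) hx
  rw [ModelWithCorners.range_eq_univ, mfderivWithin_univ] at h
  exact congrArg (fun L ↦ L v) h

theorem chartPush_symm (X : EuclideanSpace ℝ (Fin d) → EuclideanSpace ℝ (Fin d)) (m : M)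
    {y : EuclideanSpace ℝ (Fin d)} (hy : y ∈ (extChartAt (𝓡 d) m).target) :
    chartPush X m ((extChartAt (𝓡 d) m).symm y) =
      mfderiv 𝓘(ℝ, EuclideanSpace ℝ (Fin d)) (𝓡 d) (extChartAt (𝓡 d) m).symm y (X y) := by
  have hinv := (isLocalDiffeomorphAt_extChartAt m
    ((extChartAt (𝓡 d) m).map_target hy)).isInvertible_mfderiv
  have h := mfderiv_extChartAt_mfderiv_symm m hy (X y)
  have h' : X (extChartAt (𝓡 d) m ((extChartAt (𝓡 d) m).symm y)) =
      mfderiv (𝓡 d) 𝓘(ℝ, EuclideanSpace ℝ (Fin d)) (extChartAt (𝓡 d) m)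
      ((extChartAt (𝓡 d) m).symm y)
      (mfderiv 𝓘(ℝ, EuclideanSpace ℝ (Fin d)) (𝓡 d) (extChartAt (𝓡 d) m).symm y (X y)) := by
    rw [(extChartAt (𝓡 d) m).right_inv hy]
    exact h.symm
  exact (congrArg (mfderiv (𝓡 d) 𝓘(ℝ, EuclideanSpace ℝ (Fin d)) (extChartAt (𝓡 d) m)
    ((extChartAt (𝓡 d) m).symm y)).inverse h').trans (hinv.inverse_apply_self _)

theorem chartField_chartPush (X : EuclideanSpace ℝ (Fin d) → EuclideanSpace ℝ (Fin d)) (m : M)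
    {y : EuclideanSpace ℝ (Fin d)} (hy : y ∈ (extChartAt (𝓡 d) m).target) :
    chartField (chartPush X m) m y = X y := by
  rw [chartField, VectorField.mpullback_apply, chartPush_symm X m hy]
  exact (isLocalDiffeomorphAt_extChartAt_symm m hy).isInvertible_mfderiv.inverse_apply_self _

theorem mlieBracket_eq_lieBracket {E : Type*} [NormedAddCommGroup E] [NormedSpace ℝ E]
    (V W : Π x : E, TangentSpace 𝓘(ℝ, E) x) :
    VectorField.mlieBracket 𝓘(ℝ, E) V W = VectorField.lieBracket ℝ V W := by
  rw [← VectorField.mlieBracketWithin_univ, VectorField.mlieBracketWithin_eq_lieBracketWithin]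
  exact VectorField.lieBracketWithin_univ

theorem mlieBracket_symm_apply {V W : Π x : M, TangentSpace (𝓡 d) x} {m : M}
    {y : EuclideanSpace ℝ (Fin d)} (hy : y ∈ (extChartAt (𝓡 d) m).target)
    (hV : ContMDiffAt (𝓡 d) (𝓡 d).tangent ∞ (fun x ↦ (⟨x, V x⟩ : TangentBundle (𝓡 d) M))
      ((extChartAt (𝓡 d) m).symm y))
    (hW : ContMDiffAt (𝓡 d) (𝓡 d).tangent ∞ (fun x ↦ (⟨x, W x⟩ : TangentBundle (𝓡 d) M))
      ((extChartAt (𝓡 d) m).symm y)) :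
    VectorField.mlieBracket (𝓡 d) V W ((extChartAt (𝓡 d) m).symm y) =
      mfderiv 𝓘(ℝ, EuclideanSpace ℝ (Fin d)) (𝓡 d) (extChartAt (𝓡 d) m).symm y
        (VectorField.lieBracket ℝ (chartField V m) (chartField W m) y) := by
  have hs := isLocalDiffeomorphAt_extChartAt_symm m hy
  have : IsManifold (𝓡 d) (minSmoothness ℝ 3) M := IsManifold.of_le (n := ∞)
    (by rw [minSmoothness_of_isRCLikeNormedField]; exact WithTop.coe_le_coe.2 (le_top : (3 : ℕ∞) ≤ ⊤))
  have h := VectorField.mpullback_mlieBracket (n := ∞) (hV.mdifferentiableAt (by simp))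
    (hW.mdifferentiableAt (by simp)) hs.contMDiffAt
    (by rw [minSmoothness_of_isRCLikeNormedField]; exact WithTop.coe_le_coe.2 (le_top : (2 : ℕ∞) ≤ ⊤))
  rw [mlieBracket_eq_lieBracket] at h
  rw [← hs.isInvertible_mfderiv.self_apply_inverse
    (VectorField.mlieBracket (𝓡 d) V W ((extChartAt (𝓡 d) m).symm y))]
  exact congrArg _ h

theorem LorentzMetric.contMDiffOn_val_chartPush (g : LorentzMetric d M) {m : M}
    {X Y : EuclideanSpace ℝ (Fin d) → EuclideanSpace ℝ (Fin d)}
    (hX : ContDiffOn ℝ ∞ X (extChartAt (𝓡 d) m).target)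
    (hY : ContDiffOn ℝ ∞ Y (extChartAt (𝓡 d) m).target) {x : M}
    (hx : x ∈ (extChartAt (𝓡 d) m).source) :
    ContMDiffAt (𝓡 d) 𝓘(ℝ, ℝ) ∞ (fun x ↦ g.val x (chartPush X m x) (chartPush Y m x)) x :=
  g.contMDiffAt_pullback (f := id)
    ((contMDiffOn_chartPush hX).contMDiffAt ((isOpen_extChartAt_source m).mem_nhds hx))
    ((contMDiffOn_chartPush hY).contMDiffAt ((isOpen_extChartAt_source m).mem_nhds hx))

/-- The Killing identity is tested on the fields with constant coefficients v and w in the chart: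
their brackets with k are -Dk(v) and -Dk(w). -/
theorem LorentzMetric.IsKilling.fderiv_chartMetric {g : LorentzMetric d M}
    {K : Π x : M, TangentSpace (𝓡 d) x} (hg : g.IsKilling K)
    (hK : ContMDiff (𝓡 d) (𝓡 d).tangent ∞ (fun x ↦ (⟨x, K x⟩ : TangentBundle (𝓡 d) M))) {m : M}
    {y : EuclideanSpace ℝ (Fin d)} (hy : y ∈ (extChartAt (𝓡 d) m).target)
    (v w : EuclideanSpace ℝ (Fin d)) :
    fderiv ℝ (g.chartMetric m) y (chartField K m y) v w =
      -(g.chartMetric m y (fderiv ℝ (chartField K m) y v) w +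
        g.chartMetric m y v (fderiv ℝ (chartField K m) y w)) := by
  have hopen := isOpen_extChartAt_target (I := 𝓡 d) m
  have hx := (extChartAt (𝓡 d) m).map_target hy
  have hsrc := (isOpen_extChartAt_source (I := 𝓡 d) m).mem_nhds hx
  have hc : ∀ v : EuclideanSpace ℝ (Fin d), ContDiffOn ℝ ∞ (fun _ ↦ v)
      (extChartAt (𝓡 d) m).target := fun v ↦ contDiffOn_const
  have key := hg _ (isOpen_extChartAt_source m) (chartPush (fun _ ↦ v) m)
    (chartPush (fun _ ↦ w) m) (contMDiffOn_chartPush (hc v)) (contMDiffOn_chartPush (hc w))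
    _ hx
  have hbr : ∀ v : EuclideanSpace ℝ (Fin d),
      VectorField.mlieBracket (𝓡 d) K (chartPush (fun _ ↦ v) m) ((extChartAt (𝓡 d) m).symm y) =
      mfderiv 𝓘(ℝ, EuclideanSpace ℝ (Fin d)) (𝓡 d) (extChartAt (𝓡 d) m).symm y
        (-(fderiv ℝ (chartField K m) y v)) := by
    intro v
    rw [mlieBracket_symm_apply hy hK.contMDiffAt ((contMDiffOn_chartPush (hc v)).contMDiffAt hsrc)]
    have hev : chartField (chartPush (fun _ ↦ v) m) m =ᶠ[𝓝 y] fun _ ↦ v := by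
      filter_upwards [hopen.mem_nhds hy] with z hz using chartField_chartPush _ m hz
    have hl : VectorField.lieBracket ℝ (chartField K m) (chartField (chartPush (fun _ ↦ v) m) m) y =
        -(fderiv ℝ (chartField K m) y v) := by
      rw [Filter.EventuallyEq.lieBracket_vectorField_eq (EventuallyEq.refl _ _) hev,
        VectorField.lieBracket]
      simp
    exact congrArg _ hl
  rw [hbr, hbr, chartPush_symm _ m hy, chartPush_symm _ m hy, ← mfderiv_symm_chartField K m hy]
    at key
  have hs := isLocalDiffeomorphAt_extChartAt_symm m hy
  have hcomp : mfderiv 𝓘(ℝ, EuclideanSpace ℝ (Fin d)) 𝓘(ℝ, ℝ)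
      ((fun x ↦ g.val x (chartPush (fun _ ↦ v) m x) (chartPush (fun _ ↦ w) m x)) ∘
        (extChartAt (𝓡 d) m).symm) y = _ :=
    mfderiv_comp y ((g.contMDiffOn_val_chartPush (hc v) (hc w) hx).mdifferentiableAt (by simp))
      (hs.mdifferentiableAt (by simp))
  have hev : ((fun x ↦ g.val x (chartPush (fun _ ↦ v) m x) (chartPush (fun _ ↦ w) m x)) ∘
        (extChartAt (𝓡 d) m).symm) =ᶠ[𝓝 y] fun z ↦ g.chartMetric m z v w := by
    filter_upwards [hopen.mem_nhds hy] with z hz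
    rw [g.chartMetric_apply, Function.comp_apply, chartPush_symm _ m hz, chartPush_symm _ m hz]
  rw [hev.mfderiv_eq, mfderiv_eq_fderiv] at hcomp
  have hG : DifferentiableAt ℝ (g.chartMetric m) y :=
    ((g.contDiffOn_chartMetric m).contDiffAt (hopen.mem_nhds hy)).differentiableAt (by simp)
  have hfd : fderiv ℝ (fun z ↦ g.chartMetric m z v w) y (chartField K m y) =
      fderiv ℝ (g.chartMetric m) y (chartField K m y) v w := by
    have := ((hG.hasFDerivAt.clm_apply (hasFDerivAt_const v y)).clm_apply
      (hasFDerivAt_const w y)).fderiv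
    rw [this]
    simp
  rw [← hfd, hcomp]
  have hneg : g.chartMetric m y (-(fderiv ℝ (chartField K m) y v)) w +
      g.chartMetric m y v (-(fderiv ℝ (chartField K m) y w)) =
      -(g.chartMetric m y (fderiv ℝ (chartField K m) y v) w +
        g.chartMetric m y v (fderiv ℝ (chartField K m) y w)) := by
    rw [map_neg, map_neg, neg_apply, ← neg_add]
  exact Eq.trans key hneg

/-- The chart representation of the `1`-form `g(K, ·) / g(K, K)`. -/
def LorentzMetric.chartForm (g : LorentzMetric d M) (K : Π x : M, TangentSpace (𝓡 d) x) (m : M)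
    (y : EuclideanSpace ℝ (Fin d)) : EuclideanSpace ℝ (Fin d) →L[ℝ] ℝ :=
  (g.chartMetric m y (chartField K m y) (chartField K m y))⁻¹ •
    g.chartMetric m y (chartField K m y)

end LocalStatic

/-! ### Closedness of g(K, ·) / g(K, K) -/

section Closed

variable {E : Type*} [NormedAddCommGroup E] [NormedSpace ℝ E]

/-- An irrotational Killing field `k` of the metric `G`: the form `G(k, ·) / G(k, k)` is closed. -/
theorem fderiv_symm_of_killing_of_irrotational {U : Set E} (hU : IsOpen U)
    {G : E → E →L[ℝ] E →L[ℝ] ℝ} {k : E → E} (hG : ContDiffOn ℝ ∞ G U) (hk : ContDiffOn ℝ ∞ k U)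
    (hsymm : ∀ z ∈ U, ∀ v w, G z v w = G z w v) (hne : ∀ z ∈ U, G z (k z) (k z) ≠ 0) {y : E}
    (hy : y ∈ U)
    (hkill : ∀ v w, fderiv ℝ G y (k y) v w = -(G y (fderiv ℝ k y v) w + G y v (fderiv ℝ k y w)))
    (hirr : ∀ X Y : E → E, ContDiffOn ℝ ∞ X U → ContDiffOn ℝ ∞ Y U →
      (∀ z ∈ U, G z (X z) (k z) = 0) → (∀ z ∈ U, G z (Y z) (k z) = 0) →
      G y (VectorField.lieBracket ℝ X Y y) (k y) = 0) (v w : E) :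
    fderiv ℝ (fun z ↦ (G z (k z) (k z))⁻¹ • G z (k z)) y v w =
      fderiv ℝ (fun z ↦ (G z (k z) (k z))⁻¹ • G z (k z)) y w v := by
  set θ : E → E →L[ℝ] ℝ := fun z ↦ (G z (k z) (k z))⁻¹ • G z (k z) with hθdef
  have hθ : ContDiffOn ℝ ∞ θ U :=
    (((hG.clm_apply hk).clm_apply hk).inv hne).smul (hG.clm_apply hk)
  have hUy := hU.mem_nhds hy
  have hG' := ((hG.contDiffAt hUy).differentiableAt (by simp)).hasFDerivAt
  have hk' := ((hk.contDiffAt hUy).differentiableAt (by simp)).hasFDerivAt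
  have hθ' := ((hθ.contDiffAt hUy).differentiableAt (by simp)).hasFDerivAt
  set G' := fderiv ℝ G y
  set k' := fderiv ℝ k y
  set θ' := fderiv ℝ θ y
  have hθk : ∀ z ∈ U, ∀ v, G z (k z) v = G z (k z) (k z) * θ z v := by
    intro z hz v
    simp only [hθdef, smul_apply, smul_eq_mul]
    rw [mul_inv_cancel_left₀ (hne z hz)]
  set q := G y (k y) (k y) with hq
  have hq0 : q ≠ 0 := hne y hy
  -- This is L_k θ = 0: the identity G(k, v) = G(k, k) θ(v) is differentiated along k, and the
  -- Killing equation cancels the derivatives of G.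
  have hLie : ∀ v, θ' (k y) v = -θ y (k' v) := by
    intro v
    have hb := (hG'.clm_apply hk').clm_apply (hasFDerivAt_const v y)
    have hq' := ((hG'.clm_apply hk').clm_apply hk').mul (hθ'.clm_apply (hasFDerivAt_const v y))
    have hev : (fun z ↦ G z (k z) v) =ᶠ[𝓝 y] fun z ↦ G z (k z) (k z) * θ z v := by
      filter_upwards [hUy] with z hz using hθk z hz v
    have := congrArg (fun L : E →L[ℝ] ℝ ↦ L (k y)) ((hb.congr_of_eventuallyEq hev.symm).unique hq')
    simp only [add_apply, smul_apply, ContinuousLinearMap.flip_apply,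
      ContinuousLinearMap.comp_apply, zero_apply, map_zero, smul_eq_mul, hkill, zero_add] at this
    have h1 := hθk y hy (k' v)
    rw [hsymm y hy (k' (k y)) (k y)] at this
    rw [h1] at this
    have h2 : q * (θ' (k y) v + θ y (k' v)) = 0 := by linarith
    have h3 := (mul_eq_zero.1 h2).resolve_left hq0
    linarith
  -- v - θ(v) k is the orthogonal projection of the constant field v to k^⊥; involutivity is tested
  -- on two such fields.
  have hX : ∀ v, ContDiffOn ℝ ∞ (fun z ↦ v - θ z v • k z) U := fun v ↦
    contDiffOn_const.sub ((hθ.clm_apply contDiffOn_const).smul hk)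
  have hX0 : ∀ v, ∀ z ∈ U, G z (v - θ z v • k z) (k z) = 0 := by
    intro v z hz
    rw [map_sub, map_smul, sub_apply, smul_apply, smul_eq_mul, hsymm z hz v, hθk z hz v]
    ring
  have hX' : ∀ v u, fderiv ℝ (fun z ↦ v - θ z v • k z) y u = -(θ' u v • k y + θ y v • k' u) := by
    intro v u
    have h := ((hθ'.clm_apply (hasFDerivAt_const v y)).smul hk').const_sub v
    have h' : HasFDerivAt (fun z ↦ v - θ z v • k z) _ y := h
    rw [h'.fderiv]
    simp [add_comm]
  have hbr := hirr _ _ (hX v) (hX w) (hX0 v) (hX0 w)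
  rw [VectorField.lieBracket, hX', hX', hsymm y hy, hθk y hy] at hbr
  have hbr' := (mul_eq_zero.1 hbr).resolve_left hq0
  have hθk1 : θ y (k y) = 1 := mul_left_cancel₀ hq0 (by rw [← hθk y hy, mul_one])
  simp only [map_sub, map_neg, map_add, map_smul, sub_apply, smul_apply, smul_eq_mul,
    hθk1, mul_one] at hbr'
  have e1 := hLie v
  have e2 := hLie w
  have e3 := hLie (k y)
  -- Once L_k θ = 0 removes the derivatives of k, all terms of θ([X_v, X_w]) = 0 cancel except
  -- θ'(w)(v) - θ'(v)(w).
  rw [show θ y (k' v) = -θ' (k y) v by linarith, show θ y (k' w) = -θ' (k y) w by linarith,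
    show θ y (k' (k y)) = -θ' (k y) (k y) by linarith] at hbr'
  linear_combination (-1 : ℝ) * hbr'

end Closed

/-! ### Local primitives of the closed form -/

section LocalPrimitive

variable {d : ℕ} {M : Type u} [TopologicalSpace M]
  [ChartedSpace (EuclideanSpace ℝ (Fin d)) M] [IsManifold (𝓡 d) ∞ M]

theorem LorentzMetric.IsStaticField.chartForm_symm {g : LorentzMetric d M}
    {K : Π x : M, TangentSpace (𝓡 d) x} (hK : g.IsStaticField K) {m : M}
    {y : EuclideanSpace ℝ (Fin d)} (hy : y ∈ (extChartAt (𝓡 d) m).target)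
    (v w : EuclideanSpace ℝ (Fin d)) :
    fderiv ℝ (g.chartForm K m) y v w = fderiv ℝ (g.chartForm K m) y w v := by
  have hopen := isOpen_extChartAt_target (I := 𝓡 d) m
  refine fderiv_symm_of_killing_of_irrotational hopen (g.contDiffOn_chartMetric m)
    (contDiffOn_chartField hK.smooth) (fun z _ v w ↦ g.symm _ _ _) (fun z hz ↦ ?_) hy
    (hK.killing.fderiv_chartMetric hK.smooth hy) (fun X Y hX hY hXk hYk ↦ ?_) v w
  · rw [g.chartMetric_apply, mfderiv_symm_chartField K m hz]
    exact (hK.timelike _).ne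
  · have hx := (extChartAt (𝓡 d) m).map_target hy
    have hsrc := (isOpen_extChartAt_source (I := 𝓡 d) m).mem_nhds hx
    have hz : ∀ Z : EuclideanSpace ℝ (Fin d) → EuclideanSpace ℝ (Fin d),
        (∀ z ∈ (extChartAt (𝓡 d) m).target, g.chartMetric m z (Z z) (chartField K m z) = 0) →
        ∀ x ∈ (extChartAt (𝓡 d) m).source, g.val x (chartPush Z m x) (K x) = 0 := by
      intro Z hZ x hx
      have ht := (extChartAt (𝓡 d) m).map_source hx
      have h := hZ _ ht
      rw [g.chartMetric_apply, mfderiv_symm_chartField K m ht, ← chartPush_symm Z m ht,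
        (extChartAt (𝓡 d) m).left_inv hx] at h
      exact h
    have h := hK.irrotational _ (isOpen_extChartAt_source m) _ _ (contMDiffOn_chartPush hX)
      (contMDiffOn_chartPush hY) (hz X hXk) (hz Y hYk) _ hx
    rw [mlieBracket_symm_apply hy ((contMDiffOn_chartPush hX).contMDiffAt hsrc)
      ((contMDiffOn_chartPush hY).contMDiffAt hsrc)] at h
    have hev : ∀ Z : EuclideanSpace ℝ (Fin d) → EuclideanSpace ℝ (Fin d),
        chartField (chartPush Z m) m =ᶠ[𝓝 y] Z := fun Z ↦ by
      filter_upwards [hopen.mem_nhds hy] with z hz using chartField_chartPush _ m hz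
    have hl : VectorField.lieBracket ℝ (chartField (chartPush X m) m)
        (chartField (chartPush Y m) m) y = VectorField.lieBracket ℝ X Y y :=
      Filter.EventuallyEq.lieBracket_vectorField_eq (hev X) (hev Y)
    rw [← mfderiv_symm_chartField K m hy] at h
    rw [← hl]
    exact h

/-- The differential of a real-valued function on a manifold. -/
def realDeriv (f : M → ℝ) (x : M) : TangentSpace (𝓡 d) x →L[ℝ] ℝ :=
  mfderiv (𝓡 d) 𝓘(ℝ, ℝ) f x

theorem realDeriv_eq (f : M → ℝ) (x : M) : realDeriv f x = mfderiv (𝓡 d) 𝓘(ℝ, ℝ) f x := rfl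

theorem LorentzMetric.chartMetric_mfderiv (g : LorentzMetric d M) {m x : M}
    (hx : x ∈ (extChartAt (𝓡 d) m).source) (v w : TangentSpace (𝓡 d) x) :
    g.chartMetric m (extChartAt (𝓡 d) m x)
      (mfderiv (𝓡 d) 𝓘(ℝ, EuclideanSpace ℝ (Fin d)) (extChartAt (𝓡 d) m) x v)
      (mfderiv (𝓡 d) 𝓘(ℝ, EuclideanSpace ℝ (Fin d)) (extChartAt (𝓡 d) m) x w) = g.val x v w := by
  have key : ∀ (x' : M) (a b : EuclideanSpace ℝ (Fin d)), x' = x → a = v → b = w →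
      g.val x' a b = g.val x v w := by
    rintro _ _ _ rfl rfl rfl
    rfl
  exact key _ _ _ ((extChartAt (𝓡 d) m).left_inv hx) (mfderiv_symm_mfderiv_extChartAt m hx v)
    (mfderiv_symm_mfderiv_extChartAt m hx w)

theorem chartField_extChartAt (K : Π x : M, TangentSpace (𝓡 d) x) {m x : M}
    (hx : x ∈ (extChartAt (𝓡 d) m).source) :
    chartField K m (extChartAt (𝓡 d) m x) =
      mfderiv (𝓡 d) 𝓘(ℝ, EuclideanSpace ℝ (Fin d)) (extChartAt (𝓡 d) m) x (K x) := by
  have ht := (extChartAt (𝓡 d) m).map_source hx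
  have key : ∀ x' : M, x' = x → (mfderiv (𝓡 d) 𝓘(ℝ, EuclideanSpace ℝ (Fin d))
      (extChartAt (𝓡 d) m) x' (K x') : EuclideanSpace ℝ (Fin d)) =
      mfderiv (𝓡 d) 𝓘(ℝ, EuclideanSpace ℝ (Fin d)) (extChartAt (𝓡 d) m) x (K x) := by
    rintro _ rfl
    rfl
  have h := mfderiv_extChartAt_mfderiv_symm m ht (chartField K m (extChartAt (𝓡 d) m x))
  rw [mfderiv_symm_chartField K m ht] at h
  exact h.symm.trans (key _ ((extChartAt (𝓡 d) m).left_inv hx))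

/-- The `1`-form `g(K, ·) / g(K, K)` of a static vector field has local primitives. -/
theorem LorentzMetric.IsStaticField.exists_local_primitive {g : LorentzMetric d M}
    {K : Π x : M, TangentSpace (𝓡 d) x} (hK : g.IsStaticField K) (m : M) :
    ∃ (U : Set M) (f : M → ℝ), IsOpen U ∧ m ∈ U ∧ ∀ x ∈ U,
      ContMDiffAt (𝓡 d) 𝓘(ℝ, ℝ) ∞ f x ∧ ∀ v : TangentSpace (𝓡 d) x,
        g.val x (K x) (K x) * realDeriv f x v = g.val x (K x) v := by
  have hopen := isOpen_extChartAt_target (I := 𝓡 d) m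
  obtain ⟨ε, hε, hball⟩ := Metric.isOpen_iff.1 hopen _ (mem_extChartAt_target (I := 𝓡 d) m)
  set B := Metric.ball (extChartAt (𝓡 d) m m) ε
  have hne : ∀ z ∈ (extChartAt (𝓡 d) m).target,
      g.chartMetric m z (chartField K m z) (chartField K m z) ≠ 0 := by
    intro z hz
    rw [g.chartMetric_apply, mfderiv_symm_chartField K m hz]
    exact (hK.timelike _).ne
  have hk := contDiffOn_chartField (m := m) hK.smooth
  have hG := g.contDiffOn_chartMetric m
  have hω : ContDiffOn ℝ ∞ (g.chartForm K m) (extChartAt (𝓡 d) m).target :=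
    (((hG.clm_apply hk).clm_apply hk).inv hne).smul (hG.clm_apply hk)
  obtain ⟨f, hf⟩ := (convex_ball _ ε).exists_forall_hasFDerivAt_of_fderiv_symmetric
    Metric.isOpen_ball ((hω.mono hball).differentiableOn (by simp))
    (fun a ha x y ↦ hK.chartForm_symm (hball ha) x y)
  have hfs : ContDiffOn ℝ ∞ f B := by
    rw [contDiffOn_infty_iff_fderiv_of_isOpen Metric.isOpen_ball]
    refine ⟨fun a ha ↦ (hf a ha).differentiableAt.differentiableWithinAt, ?_⟩
    exact (hω.mono hball).congr fun a ha ↦ (hf a ha).fderiv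
  refine ⟨(extChartAt (𝓡 d) m).source ∩ extChartAt (𝓡 d) m ⁻¹' B, f ∘ extChartAt (𝓡 d) m,
    (continuousOn_extChartAt m).isOpen_inter_preimage (isOpen_extChartAt_source m)
      Metric.isOpen_ball, ⟨mem_extChartAt_source m, Metric.mem_ball_self hε⟩, fun x hx ↦ ?_⟩
  have hψ := (isLocalDiffeomorphAt_extChartAt m hx.1)
  have hfx : ContMDiffAt 𝓘(ℝ, EuclideanSpace ℝ (Fin d)) 𝓘(ℝ, ℝ) ∞ f (extChartAt (𝓡 d) m x) :=
    (hfs.contDiffAt (Metric.isOpen_ball.mem_nhds hx.2)).contMDiffAt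
  refine ⟨hfx.comp x hψ.contMDiffAt, fun v ↦ ?_⟩
  have hfd : realDeriv (f ∘ extChartAt (𝓡 d) m) x v =
      g.chartForm K m (extChartAt (𝓡 d) m x)
        (mfderiv (𝓡 d) 𝓘(ℝ, EuclideanSpace ℝ (Fin d)) (extChartAt (𝓡 d) m) x v) := by
    rw [realDeriv_eq, mfderiv_comp x (hfx.mdifferentiableAt (by simp))
      (hψ.mdifferentiableAt (by simp)), mfderiv_eq_fderiv, (hf _ hx.2).fderiv]
    rfl
  have ht := (extChartAt (𝓡 d) m).map_source hx.1
  have h1 : ∀ v : EuclideanSpace ℝ (Fin d), g.chartMetric m (extChartAt (𝓡 d) m x)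
      (chartField K m (extChartAt (𝓡 d) m x)) (chartField K m (extChartAt (𝓡 d) m x)) *
      g.chartForm K m (extChartAt (𝓡 d) m x) v =
      g.chartMetric m (extChartAt (𝓡 d) m x) (chartField K m (extChartAt (𝓡 d) m x)) v := by
    intro v
    rw [LorentzMetric.chartForm, smul_apply, smul_eq_mul, mul_inv_cancel_left₀ (hne _ ht)]
  rw [hfd, ← g.chartMetric_mfderiv hx.1 (K x) (K x), ← g.chartMetric_mfderiv hx.1 (K x) v,
    ← chartField_extChartAt K hx.1]
  exact h1 _

end LocalPrimitive

/-! ### The global smooth flow on a compact manifold -/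

section Flow

variable {d : ℕ} {M : Type u} [TopologicalSpace M]
  [ChartedSpace (EuclideanSpace ℝ (Fin d)) M] [IsManifold (𝓡 d) ∞ M]

/-- Scaling the field by s, instead of shrinking the time interval, keeps one interval (-1, 1) for
all parameters; the flow at time s is read off at parameter 2s and time 1/2. -/
theorem exists_smooth_family_isMIntegralCurveOn {K : Π x : M, TangentSpace (𝓡 d) x}
    (hK : ContMDiff (𝓡 d) (𝓡 d).tangent ∞ (fun x ↦ (⟨x, K x⟩ : TangentBundle (𝓡 d) M))) (m : M) :
    ∃ Γ : ℝ × M → ℝ → M,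
      ContMDiffAt (𝓘(ℝ, ℝ).prod (𝓡 d)) (𝓡 d) ∞ (fun p ↦ Γ (2 * p.1, p.2) (1 / 2)) (0, m) ∧
      ∀ᶠ p in 𝓝 ((0 : ℝ), m), Γ p 0 = p.2 ∧
        IsMIntegralCurveOn (Γ p) (p.1 • K) (Ioo (-1) 1) := by
  have hopen := isOpen_extChartAt_target (I := 𝓡 d) m
  have ht0 := mem_extChartAt_target (I := 𝓡 d) m
  obtain ⟨Ψ, hΨ, hev⟩ := exists_smooth_local_flow (chartField K m) hopen
    (contDiffOn_chartField hK) ht0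
  have hcont : ContinuousAt (fun p : ℝ × M ↦ (p.1, extChartAt (𝓡 d) m p.2)) (0, m) :=
    continuousAt_fst.prodMk (ContinuousAt.comp (x := ((0 : ℝ), m)) (g := extChartAt (𝓡 d) m)
      (f := Prod.snd) (continuousAt_extChartAt (I := 𝓡 d) m) continuousAt_snd)
  have hev' := hcont.eventually hev
  have hsrc : ∀ᶠ p in 𝓝 ((0 : ℝ), m), p.2 ∈ (extChartAt (𝓡 d) m).source :=
    continuousAt_snd.eventually (extChartAt_source_mem_nhds (I := 𝓡 d) m)
  refine ⟨fun p r ↦ (extChartAt (𝓡 d) m).symm (Ψ (p.1, extChartAt (𝓡 d) m p.2) r), ?_, ?_⟩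
  · have hval : Ψ (2 * 0, extChartAt (𝓡 d) m m) (1 / 2) ∈ (extChartAt (𝓡 d) m).target := by
      have := (hev.self_of_nhds.2 (1 / 2) (by norm_num)).1
      simpa using this
    have h1 : ContMDiffAt (𝓘(ℝ, ℝ).prod (𝓡 d)) (𝓘(ℝ, ℝ × EuclideanSpace ℝ (Fin d))) ∞
        (fun p : ℝ × M ↦ (p.1, extChartAt (𝓡 d) m p.2)) (0, m) :=
      contMDiffAt_fst.prodMk_space
        ((contMDiffAt_extChartAt (I := 𝓡 d) (n := ∞) (x := m)).comp (0, m) contMDiffAt_snd)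
    have h2 : ContMDiffAt (𝓘(ℝ, ℝ).prod (𝓡 d)) 𝓘(ℝ, EuclideanSpace ℝ (Fin d)) ∞
        (fun p : ℝ × M ↦ Ψ (2 * p.1, extChartAt (𝓡 d) m p.2) (1 / 2)) (0, m) :=
      hΨ.contMDiffAt.comp (0, m) h1
    exact (isLocalDiffeomorphAt_extChartAt_symm m hval).contMDiffAt.comp (0, m) h2
  · filter_upwards [hev', hsrc] with p hp hps
    refine ⟨by rw [hp.1, (extChartAt (𝓡 d) m).left_inv hps], fun r hr ↦ ?_⟩
    obtain ⟨hmem, hder⟩ := hp.2 r hr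
    have hs := ((isLocalDiffeomorphAt_extChartAt_symm m hmem).mdifferentiableAt
      (by simp)).hasMFDerivAt
    have hcomp := hs.comp r hder.hasFDerivAt.hasMFDerivAt
    refine (HasMFDerivAt.hasMFDerivWithinAt ?_)
    refine hcomp.congr_mfderiv ?_
    have hk := mfderiv_symm_chartField K m hmem
    ext
    refine (congrArg (mfderiv 𝓘(ℝ, EuclideanSpace ℝ (Fin d)) (𝓡 d) (extChartAt (𝓡 d) m).symm _)
      (one_smul ℝ _)).trans ?_
    refine (map_smul (mfderiv 𝓘(ℝ, EuclideanSpace ℝ (Fin d)) (𝓡 d)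
      (extChartAt (𝓡 d) m).symm _) p.1 (chartField K m _)).trans ?_
    refine (congrArg (p.1 • ·) hk).trans ?_
    exact (one_smul ℝ _).symm

/-- A smooth global flow of the vector field `K`. -/
structure IsSmoothFlow (K : Π x : M, TangentSpace (𝓡 d) x) (φ : ℝ → M → M) : Prop where
  contMDiff : ContMDiff (𝓘(ℝ, ℝ).prod (𝓡 d)) (𝓡 d) ∞ (fun p : ℝ × M ↦ φ p.1 p.2)
  zero : ∀ x, φ 0 x = x
  add : ∀ s t x, φ (s + t) x = φ s (φ t x)
  isMIntegralCurve : ∀ x, IsMIntegralCurve (fun t ↦ φ t x) K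

variable [T2Space M]

/-- For each (s, x), r ↦ φ (2sr) x and the local solution of the smooth family are integral curves
of 2sK from x, so uniqueness identifies them at r = 1/2. -/
theorem contMDiffAt_flow_zero {K : Π x : M, TangentSpace (𝓡 d) x}
    (hK : ContMDiff (𝓡 d) (𝓡 d).tangent ∞ (fun x ↦ (⟨x, K x⟩ : TangentBundle (𝓡 d) M)))
    {φ : ℝ → M → M} (h0 : ∀ x, φ 0 x = x) (hφ : ∀ x, IsMIntegralCurve (fun t ↦ φ t x) K) (m : M) :
    ContMDiffAt (𝓘(ℝ, ℝ).prod (𝓡 d)) (𝓡 d) ∞ (fun p : ℝ × M ↦ φ p.1 p.2) (0, m) := by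
  obtain ⟨Γ, hΓs, hΓ⟩ := exists_smooth_family_isMIntegralCurveOn hK m
  refine hΓs.congr_of_eventuallyEq ?_
  have hcont : ContinuousAt (fun p : ℝ × M ↦ (2 * p.1, p.2)) (0, m) := by fun_prop
  have hΓ' : ∀ᶠ p in 𝓝 ((2 : ℝ) * 0, m), Γ p 0 = p.2 ∧
        IsMIntegralCurveOn (Γ p) (p.1 • K) (Ioo (-1) 1) := by simpa using hΓ
  filter_upwards [hcont.eventually hΓ'] with p hp
  have hK' : ContMDiff (𝓡 d) (𝓡 d).tangent 1
      (fun x ↦ (⟨x, ((2 * p.1) • K) x⟩ : TangentBundle (𝓡 d) M)) := by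
    have := ContMDiff.const_smul_section (a := 2 * p.1) (hK.of_le (by simp : (1 : WithTop ℕ∞) ≤ ∞))
    exact this
  have h2 : IsMIntegralCurveOn ((fun t ↦ φ t p.2) ∘ (· * (2 * p.1))) ((2 * p.1) • K)
      (Ioo (-1) 1) :=
    ((hφ p.2).isMIntegralCurveOn univ).comp_mul (2 * p.1) |>.mono (fun _ _ ↦ mem_univ _)
  have h3 := isMIntegralCurveOn_Ioo_eqOn_of_contMDiff_boundaryless (t₀ := 0) (by norm_num) hK' h2
    hp.2 (by rw [hp.1]; simp [h0]) (by norm_num : (1 / 2 : ℝ) ∈ Ioo (-1 : ℝ) 1)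
  rw [← h3]
  simp only [Function.comp_apply]
  congr 1
  ring

variable [CompactSpace M]

theorem exists_isMIntegralCurve_of_compactSpace {K : Π x : M, TangentSpace (𝓡 d) x}
    (hK : ContMDiff (𝓡 d) (𝓡 d).tangent ∞ (fun x ↦ (⟨x, K x⟩ : TangentBundle (𝓡 d) M))) (x : M) :
    ∃ γ : ℝ → M, γ 0 = x ∧ IsMIntegralCurve γ K := by
  have hloc : ∀ m : M, ∃ ε > 0, ∀ᶠ x in 𝓝 m, ∃ γ : ℝ → M, γ 0 = x ∧
      IsMIntegralCurveOn γ K (Ioo (-ε) ε) := by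
    intro m
    obtain ⟨Γ, -, hΓ⟩ := exists_smooth_family_isMIntegralCurveOn hK m
    rw [nhds_prod_eq] at hΓ
    obtain ⟨ps, hs, pt, ht, h⟩ := eventually_prod_iff.1 hΓ
    obtain ⟨ε, hε, hball⟩ := Metric.eventually_nhds_iff.1 hs
    have hps : ps (ε / 2) := hball (by
      rw [Real.dist_eq, sub_zero, abs_of_pos (by positivity)]; linarith)
    have hε2 : (ε / 2) ≠ 0 := by positivity
    refine ⟨ε / 2, by positivity, ht.mono fun x hx ↦ ?_⟩
    obtain ⟨h0, hc⟩ := h hps hx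
    refine ⟨Γ (ε / 2, x) ∘ (· * (ε / 2)⁻¹), by simpa using h0, ?_⟩
    have := hc.comp_mul (ε / 2)⁻¹
    simp only [smul_smul, inv_mul_cancel₀ hε2, one_smul] at this
    refine this.mono fun t ht ↦ ?_
    change t * (ε / 2)⁻¹ ∈ Ioo (-1) 1
    rw [← div_eq_mul_inv]
    exact ⟨by rw [lt_div_iff₀ (by positivity)]; linarith [ht.1],
      by rw [div_lt_iff₀ (by positivity)]; linarith [ht.2]⟩
  choose ε hε h using hloc
  obtain ⟨t, ht⟩ := CompactSpace.elim_nhds_subcover _ (fun m ↦ h m)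
  have hne : t.Nonempty := by
    by_contra hcon
    rw [Finset.not_nonempty_iff_eq_empty] at hcon
    have : x ∈ (⊤ : Set M) := trivial
    rw [← ht, hcon] at this
    simp at this
  obtain ⟨m₀, hm₀, hmin⟩ := t.exists_min_image ε hne
  -- A lifespan bounded below independently of the starting point forces completeness; the bound is
  -- the least ε of a finite subcover.
  refine exists_isMIntegralCurve_of_isMIntegralCurveOn (hK.of_le (by simp)) (hε m₀) (fun x ↦ ?_) x
  have : x ∈ (⊤ : Set M) := trivial
  rw [← ht] at this
  simp only [mem_iUnion] at this
  obtain ⟨m, hm, γ, h0, hγ⟩ := this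
  exact ⟨γ, h0, hγ.mono (Ioo_subset_Ioo (neg_le_neg (hmin m hm)) (hmin m hm))⟩

theorem exists_isSmoothFlow_of_compactSpace {K : Π x : M, TangentSpace (𝓡 d) x}
    (hK : ContMDiff (𝓡 d) (𝓡 d).tangent ∞ (fun x ↦ (⟨x, K x⟩ : TangentBundle (𝓡 d) M))) :
    ∃ φ : ℝ → M → M, IsSmoothFlow K φ := by
  choose γ hγ0 hγ using exists_isMIntegralCurve_of_compactSpace hK
  let φ : ℝ → M → M := fun t x ↦ γ x t
  have hadd : ∀ s t x, φ (s + t) x = φ s (φ t x) := by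
    intro s t x
    have := isMIntegralCurve_Ioo_eq_of_contMDiff_boundaryless (t₀ := 0)
      (hK.of_le (by simp : (1 : WithTop ℕ∞) ≤ ∞)) ((hγ x).comp_add t) (hγ (γ x t))
      (by simp [hγ0])
    exact congrFun this s
  refine ⟨φ, ?_, hγ0, hadd, hγ⟩
  -- The order k is fixed first: being C^k at a point extends to a neighbourhood only for finite k.
  rw [contMDiff_infty]
  intro k
  have h0 : ∀ m : M, ∀ᶠ p in 𝓝 ((0 : ℝ), m),
      ContMDiffAt (𝓘(ℝ, ℝ).prod (𝓡 d)) (𝓡 d) k (fun p : ℝ × M ↦ φ p.1 p.2) p := by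
    intro m
    have hM : IsManifold (𝓡 d) k M := .of_le (n := ∞) (mod_cast le_top)
    exact (contMDiffAt_iff_contMDiffAt_nhds (by simp)).1
      ((contMDiffAt_flow_zero hK hγ0 hγ m).of_le (mod_cast le_top))
  have hunif : ∀ᶠ s in 𝓝 (0 : ℝ), ∀ x : M,
      ContMDiffAt (𝓘(ℝ, ℝ).prod (𝓡 d)) (𝓡 d) k (fun p : ℝ × M ↦ φ p.1 p.2) (s, x) := by
    have := isCompact_univ.eventually_forall_of_forall_eventually (x₀ := (0 : ℝ))
      (P := fun s x ↦ ContMDiffAt (𝓘(ℝ, ℝ).prod (𝓡 d)) (𝓡 d) k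
        (fun p : ℝ × M ↦ φ p.1 p.2) (s, x)) (K := (univ : Set M)) (fun m _ ↦ by
          exact h0 m)
    simpa using this
  obtain ⟨ε, hε, hs⟩ := Metric.eventually_nhds_iff.1 hunif
  -- Smoothness for |s| < ε, uniform in x by compactness, spreads to all times by doubling, since
  -- φ_s = φ_{s/2} ∘ φ_{s/2}.
  have hind : ∀ j : ℕ, ∀ s : ℝ, |s| < 2 ^ j * ε → ∀ x : M,
      ContMDiffAt (𝓘(ℝ, ℝ).prod (𝓡 d)) (𝓡 d) k (fun p : ℝ × M ↦ φ p.1 p.2) (s, x) := by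
    intro j
    induction j with
    | zero =>
      intro s hsε x
      exact hs (by simpa using hsε) x
    | succ j ih =>
      intro s hsε x
      have hhalf : |s / 2| < 2 ^ j * ε := by
        rw [abs_div, abs_two, div_lt_iff₀ (by norm_num)]
        rw [pow_succ] at hsε
        linarith
      have heq : (fun p : ℝ × M ↦ φ p.1 p.2) = fun p ↦ φ (p.1 / 2) (φ (p.1 / 2) p.2) := by
        funext p
        rw [← hadd, add_halves]
      rw [heq]
      have hd : ContMDiffAt (𝓘(ℝ, ℝ).prod (𝓡 d)) 𝓘(ℝ, ℝ) k (fun p : ℝ × M ↦ p.1 / 2) (s, x) :=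
        (contDiff_id.div_const 2).contMDiff.contMDiffAt.comp (s, x) contMDiffAt_fst
      have h1 : ContMDiffAt (𝓘(ℝ, ℝ).prod (𝓡 d)) (𝓡 d) k
          (fun p : ℝ × M ↦ φ (p.1 / 2) p.2) (s, x) :=
        ContMDiffAt.comp (s, x) (g := fun p : ℝ × M ↦ φ p.1 p.2)
          (f := fun p : ℝ × M ↦ (p.1 / 2, p.2)) (ih _ hhalf x) (hd.prodMk contMDiffAt_snd)
      exact ContMDiffAt.comp (s, x) (g := fun p : ℝ × M ↦ φ p.1 p.2)
          (f := fun p : ℝ × M ↦ (p.1 / 2, φ (p.1 / 2) p.2)) (ih _ hhalf _) (hd.prodMk h1)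
  intro p
  obtain ⟨j, hj⟩ := pow_unbounded_of_one_lt (|p.1| / ε) (one_lt_two : (1 : ℝ) < 2)
  exact hind j p.1 (by rwa [div_lt_iff₀ hε] at hj) p.2

end Flow

/-! ### The flow of a Killing field acts by isometries -/

section FlowDerivative

variable {E : Type*} [NormedAddCommGroup E] [NormedSpace ℝ E]

set_option synthInstance.maxHeartbeats 200000 in
-- By symmetry of the second derivative, the time derivative at 0 of the spatial differential of the
-- flow is Dk. The product rule then yields exactly the three terms which the Killing equation `hkG`
-- makes cancel.
theorem hasDerivAt_metric_flow {φ : ℝ × E → E} {G : E → E →L[ℝ] E →L[ℝ] ℝ} {k : E → E} {y : E}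
    (hφ : ContDiffAt ℝ 2 φ (0, y)) (hG : DifferentiableAt ℝ G y)
    (h0 : ∀ᶠ z in 𝓝 y, φ (0, z) = z)
    (hk : ∀ᶠ z in 𝓝 y, HasDerivAt (fun s ↦ φ (s, z)) (k z) 0)
    (hkG : ∀ v w, fderiv ℝ G y (k y) v w =
      -(G y (fderiv ℝ k y v) w + G y v (fderiv ℝ k y w))) (v w : E) :
    HasDerivAt (fun s ↦ G (φ (s, y)) (fderiv ℝ φ (s, y) (0, v)) (fderiv ℝ φ (s, y) (0, w))) 0 0 := by
  have hd : ∀ᶠ p in 𝓝 ((0 : ℝ), y), DifferentiableAt ℝ φ p :=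
    (hφ.eventually (by simp)).mono fun p hp ↦ hp.differentiableAt (by simp)
  have hdz : ∀ᶠ z in 𝓝 y, DifferentiableAt ℝ φ (0, z) :=
    (Continuous.prodMk_right (0 : ℝ)).continuousAt.eventually hd
  have hfd : DifferentiableAt ℝ (fderiv ℝ φ) (0, y) :=
    (hφ.fderiv_right (m := 1) (by norm_num)).differentiableAt (by simp)
  have hincl : ∀ z : E, HasDerivAt (fun s : ℝ ↦ (s, z)) (1, 0) 0 := fun z ↦
    (hasDerivAt_id 0).prodMk (hasDerivAt_const 0 z)
  have hincr : ∀ z : E, HasFDerivAt (fun z : E ↦ ((0 : ℝ), z))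
      (ContinuousLinearMap.inr ℝ ℝ E) z := fun z ↦ hasFDerivAt_prodMk_right 0 z
  have hk' : ∀ᶠ z in 𝓝 y, fderiv ℝ φ (0, z) (1, 0) = k z := by
    filter_upwards [hdz, hk] with z hz hkz
    exact (hz.hasFDerivAt.comp_hasDerivAt 0 (hincl z)).unique hkz
  have hfst : ∀ u, fderiv ℝ φ (0, y) (0, u) = u := by
    intro u
    have h1 := (hd.self_of_nhds.hasFDerivAt.comp y (hincr y)).congr_of_eventuallyEq
      (f := fun z ↦ φ (0, z)) (Eventually.of_forall fun _ ↦ rfl)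
    have h2 : HasFDerivAt (fun z ↦ φ (0, z)) (ContinuousLinearMap.id ℝ E) y :=
      (hasFDerivAt_id y).congr_of_eventuallyEq h0
    simpa using DFunLike.congr_fun (h1.unique h2) u
  have hDk : ∀ u, fderiv ℝ (fderiv ℝ φ) (0, y) (1, 0) (0, u) = fderiv ℝ k y u := by
    intro u
    rw [(hφ.isSymmSndFDerivAt (by simp)) (1, 0) (0, u)]
    have h1 : HasFDerivAt (fun z ↦ fderiv ℝ φ (0, z) (1, 0))
        ((ContinuousLinearMap.apply ℝ E ((1 : ℝ), (0 : E))).comp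
          ((fderiv ℝ (fderiv ℝ φ) (0, y)).comp (ContinuousLinearMap.inr ℝ ℝ E))) y :=
      (ContinuousLinearMap.apply ℝ E ((1 : ℝ), (0 : E))).hasFDerivAt.comp y
        (hfd.hasFDerivAt.comp y (hincr y))
    rw [(h1.congr_of_eventuallyEq (hk'.mono fun _ h ↦ h.symm)).fderiv]
    simp
  have hc : ∀ u, HasDerivAt (fun s ↦ fderiv ℝ φ (s, y) (0, u)) (fderiv ℝ k y u) 0 := by
    intro u
    have h1 : HasDerivAt (fun s : ℝ ↦ fderiv ℝ φ (s, y))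
        (fderiv ℝ (fderiv ℝ φ) (0, y) (1, 0)) 0 :=
      hfd.hasFDerivAt.comp_hasDerivAt (0 : ℝ) (hincl y)
    have h2 := (ContinuousLinearMap.apply ℝ E ((0 : ℝ), u)).hasFDerivAt.comp_hasDerivAt (0 : ℝ) h1
    rw [ContinuousLinearMap.apply_apply, hDk] at h2
    exact h2
  have hφ0 : φ (0, y) = y := h0.self_of_nhds
  have hGd : HasDerivAt (fun s ↦ G (φ (s, y))) (fderiv ℝ G y (k y)) 0 :=
    HasFDerivAt.comp_hasDerivAt_of_eq (E := E →L[ℝ] E →L[ℝ] ℝ) (l := G) (l' := fderiv ℝ G y)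
      (0 : ℝ) hG.hasFDerivAt hk.self_of_nhds hφ0.symm
  have := (hGd.clm_apply (hc v)).clm_apply (hc w)
  simp only [hφ0, hfst, add_apply, hkG] at this
  refine this.congr_deriv ?_
  rw [add_assoc, neg_add_cancel]

end FlowDerivative

section Isometry

variable {d : ℕ} {M : Type u} [TopologicalSpace M]
  [ChartedSpace (EuclideanSpace ℝ (Fin d)) M]
  {K : Π x : M, TangentSpace (𝓡 d) x} {φ : ℝ → M → M}

theorem IsSmoothFlow.contMDiff_apply (hφ : IsSmoothFlow K φ) (t : ℝ) :
    ContMDiff (𝓡 d) (𝓡 d) ∞ (φ t) :=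
  hφ.contMDiff.comp (contMDiff_const.prodMk contMDiff_id)

theorem IsSmoothFlow.mdifferentiable (hφ : IsSmoothFlow K φ) (t : ℝ) :
    MDifferentiable (𝓡 d) (𝓡 d) (φ t) :=
  (hφ.contMDiff_apply t).mdifferentiable (by simp)

theorem IsSmoothFlow.mfderiv_zero (hφ : IsSmoothFlow K φ) (x : M) (v : TangentSpace (𝓡 d) x) :
    mfderiv (𝓡 d) (𝓡 d) (φ 0) x v = (v : EuclideanSpace ℝ (Fin d)) := by
  have : φ 0 = id := funext hφ.zero
  rw [this, mfderiv_id]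
  rfl

theorem IsSmoothFlow.mfderiv_add (hφ : IsSmoothFlow K φ) (s t : ℝ) (x : M)
    (v : TangentSpace (𝓡 d) x) :
    (mfderiv (𝓡 d) (𝓡 d) (φ (s + t)) x v : EuclideanSpace ℝ (Fin d)) =
      mfderiv (𝓡 d) (𝓡 d) (φ s) (φ t x) (mfderiv (𝓡 d) (𝓡 d) (φ t) x v) := by
  have : φ (s + t) = φ s ∘ φ t := funext fun x ↦ hφ.add s t x
  rw [this, mfderiv_comp x (hφ.mdifferentiable s _) (hφ.mdifferentiable t _)]
  rfl

theorem IsSmoothFlow.mfderiv_field (hφ : IsSmoothFlow K φ) (s : ℝ) (x : M) :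
    mfderiv (𝓡 d) (𝓡 d) (φ s) x (K x) = K (φ s x) := by
  have h1 := (hφ.mdifferentiable s (φ 0 x)).hasMFDerivAt.comp 0 (hφ.isMIntegralCurve x 0)
  have h2 := hφ.isMIntegralCurve (φ s x) 0
  have heq : (φ s ∘ fun t ↦ φ t x) = fun t ↦ φ t (φ s x) := by
    funext t
    rw [Function.comp_apply, ← hφ.add, ← hφ.add, add_comm]
  rw [heq] at h1
  have h3 : (mfderiv (𝓡 d) (𝓡 d) (φ s) (φ 0 x) ((1 : ℝ) • K (φ 0 x)) :
      EuclideanSpace ℝ (Fin d)) = (1 : ℝ) • K (φ 0 (φ s x)) :=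
    DFunLike.congr_fun (hasMFDerivAt_unique h1 h2) (1 : ℝ)
  have key : ∀ (a b : M), a = x → b = φ s x →
    (mfderiv (𝓡 d) (𝓡 d) (φ s) a ((1 : ℝ) • K a) : EuclideanSpace ℝ (Fin d)) = (1 : ℝ) • K b →
      mfderiv (𝓡 d) (𝓡 d) (φ s) x (K x) = K (φ s x) := by
    rintro _ _ rfl rfl h
    rwa [one_smul, one_smul] at h
  exact key _ _ (hφ.zero x) (hφ.zero _) h3

variable [IsManifold (𝓡 d) ∞ M]

/-- Transport along a propositional equality of base points, the vectors being compared in the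
common model space. -/
theorem LorentzMetric.val_congr (g : LorentzMetric d M) {x y : M} (h : x = y)
    {v w : TangentSpace (𝓡 d) x} {v' w' : TangentSpace (𝓡 d) y}
    (hv : (v : EuclideanSpace ℝ (Fin d)) = v') (hw : (w : EuclideanSpace ℝ (Fin d)) = w') :
    g.val x v w = g.val y v' w' := by
  subst h
  cases hv
  cases hw
  rfl

theorem LorentzMetric.IsKilling.hasDerivAt_val_flow {g : LorentzMetric d M} (hg : g.IsKilling K)
    (hK : ContMDiff (𝓡 d) (𝓡 d).tangent ∞ (fun x ↦ (⟨x, K x⟩ : TangentBundle (𝓡 d) M)))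
    (hφ : IsSmoothFlow K φ) (x : M) (v w : TangentSpace (𝓡 d) x) :
    HasDerivAt (fun s ↦ g.val (φ s x) (mfderiv (𝓡 d) (𝓡 d) (φ s) x v)
      (mfderiv (𝓡 d) (𝓡 d) (φ s) x w)) 0 0 := by
  have hx := mem_extChartAt_source (I := 𝓡 d) x
  have hy := mem_extChartAt_target (I := 𝓡 d) x
  have hyn := (isOpen_extChartAt_target (I := 𝓡 d) x).mem_nhds hy
  have hleft := (extChartAt (𝓡 d) x).left_inv hx
  set y := extChartAt (𝓡 d) x x with hydef
  let Φ : ℝ × EuclideanSpace ℝ (Fin d) → EuclideanSpace ℝ (Fin d) :=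
    fun p ↦ extChartAt (𝓡 d) x (φ p.1 ((extChartAt (𝓡 d) x).symm p.2))
  have hcont : Continuous (fun s ↦ φ s x) :=
    hφ.contMDiff.continuous.comp (Continuous.prodMk_left x)
  have hsrc : ∀ᶠ s in 𝓝 (0 : ℝ), φ s x ∈ (extChartAt (𝓡 d) x).source := by
    refine hcont.continuousAt.eventually (p := (· ∈ (extChartAt (𝓡 d) x).source)) ?_
    simp only [hφ.zero]
    exact extChartAt_source_mem_nhds (I := 𝓡 d) x
  have hΦ : ∀ s, φ s x ∈ (extChartAt (𝓡 d) x).source → ContDiffAt ℝ ∞ Φ (s, y) := by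
    intro s hs
    rw [← contMDiffAt_iff_contDiffAt]
    have h1 : ContMDiffAt 𝓘(ℝ, ℝ × EuclideanSpace ℝ (Fin d)) (𝓡 d) ∞
        (fun p : ℝ × EuclideanSpace ℝ (Fin d) ↦ (extChartAt (𝓡 d) x).symm p.2) (s, y) :=
      ContMDiffAt.comp (s, y) (isLocalDiffeomorphAt_extChartAt_symm x hy).contMDiffAt
        contDiffAt_snd.contMDiffAt
    have h2 : ContMDiffAt 𝓘(ℝ, ℝ × EuclideanSpace ℝ (Fin d)) (𝓡 d) ∞
        (fun p : ℝ × EuclideanSpace ℝ (Fin d) ↦ φ p.1 ((extChartAt (𝓡 d) x).symm p.2)) (s, y) :=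
      ContMDiffAt.comp (s, y) (g := fun p : ℝ × M ↦ φ p.1 p.2) hφ.contMDiff.contMDiffAt
        (contDiffAt_fst.contMDiffAt.prodMk h1)
    have hs' : φ s ((extChartAt (𝓡 d) x).symm y) ∈ (extChartAt (𝓡 d) x).source := by
      rwa [hleft]
    exact ContMDiffAt.comp (s, y) (isLocalDiffeomorphAt_extChartAt x hs').contMDiffAt h2
  have hh0 : ∀ᶠ z in 𝓝 y, Φ (0, z) = z := by
    filter_upwards [hyn] with z hz
    simp only [Φ, hφ.zero]
    exact (extChartAt (𝓡 d) x).right_inv hz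
  have hhk : ∀ᶠ z in 𝓝 y, HasDerivAt (fun s ↦ Φ (s, z)) (chartField K x z) 0 := by
    filter_upwards [hyn] with z hz
    have hm := (extChartAt (𝓡 d) x).map_target hz
    set m := (extChartAt (𝓡 d) x).symm z with hmdef
    have hm' : φ 0 m ∈ (extChartAt (𝓡 d) x).source := by rwa [hφ.zero]
    have h1 := ((isLocalDiffeomorphAt_extChartAt x hm').mdifferentiableAt (by simp)).hasMFDerivAt
    have h2 : HasDerivAt (fun s ↦ Φ (s, z)) _ 0 := HasFDerivAt.hasDerivAt (F :=
      EuclideanSpace ℝ (Fin d)) (h1.comp 0 (hφ.isMIntegralCurve m 0)).hasFDerivAt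
    refine h2.congr_deriv ?_
    have key : ∀ m', m' = m → (mfderiv (𝓡 d) 𝓘(ℝ, EuclideanSpace ℝ (Fin d))
        (extChartAt (𝓡 d) x) m' (K m') : EuclideanSpace ℝ (Fin d)) = chartField K x z := by
      rintro _ rfl
      rw [← (chartField_extChartAt K hm), hmdef, (extChartAt (𝓡 d) x).right_inv hz]
    refine Eq.trans ?_ (key _ (hφ.zero m))
    exact congrArg (mfderiv (𝓡 d) 𝓘(ℝ, EuclideanSpace ℝ (Fin d))
        (extChartAt (𝓡 d) x) (φ 0 m)) (one_smul ℝ (K (φ 0 m)))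
  have hderiv := hasDerivAt_metric_flow ((hΦ 0 (by rwa [hφ.zero])).of_le
      (WithTop.coe_le_coe.2 (le_top : (2 : ℕ∞) ≤ ⊤)))
    (((g.contDiffOn_chartMetric x).contDiffAt hyn).differentiableAt (by simp)) hh0 hhk
    (fun v w ↦ hg.fderiv_chartMetric hK hy v w)
    (mfderiv (𝓡 d) 𝓘(ℝ, EuclideanSpace ℝ (Fin d)) (extChartAt (𝓡 d) x) x v)
    (mfderiv (𝓡 d) 𝓘(ℝ, EuclideanSpace ℝ (Fin d)) (extChartAt (𝓡 d) x) x w)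
  refine hderiv.congr_of_eventuallyEq ?_
  filter_upwards [hsrc] with s hs
  have hD : ∀ v : TangentSpace (𝓡 d) x, (mfderiv (𝓡 d) 𝓘(ℝ, EuclideanSpace ℝ (Fin d))
      (extChartAt (𝓡 d) x) (φ s x) (mfderiv (𝓡 d) (𝓡 d) (φ s) x v) : EuclideanSpace ℝ (Fin d)) =
      fderiv ℝ Φ (s, y) (0, (mfderiv (𝓡 d) 𝓘(ℝ, EuclideanSpace ℝ (Fin d))
        (extChartAt (𝓡 d) x) x v : EuclideanSpace ℝ (Fin d))) := by
    intro v
    have h1 : HasMFDerivAt (𝓡 d) 𝓘(ℝ, EuclideanSpace ℝ (Fin d))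
        (fun z ↦ Φ (s, extChartAt (𝓡 d) x z)) x
        ((fderiv ℝ Φ (s, y)).comp ((ContinuousLinearMap.inr ℝ ℝ _).comp
          (mfderiv (𝓡 d) 𝓘(ℝ, EuclideanSpace ℝ (Fin d)) (extChartAt (𝓡 d) x) x))) := by
      have hf : HasFDerivAt (fun z ↦ Φ (s, z))
          ((fderiv ℝ Φ (s, y)).comp (ContinuousLinearMap.inr ℝ ℝ _)) y :=
        ((hΦ s hs).differentiableAt (by simp)).hasFDerivAt.comp y (hasFDerivAt_prodMk_right s y)
      exact hf.hasMFDerivAt.comp x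
        ((isLocalDiffeomorphAt_extChartAt x hx).mdifferentiableAt (by simp)).hasMFDerivAt
    have h2 := ((isLocalDiffeomorphAt_extChartAt x hs).mdifferentiableAt
      (by simp)).hasMFDerivAt.comp x (hφ.mdifferentiable s x).hasMFDerivAt
    have h3 := h1.congr_of_eventuallyEq (f₁ := extChartAt (𝓡 d) x ∘ φ s) (by
      filter_upwards [extChartAt_source_mem_nhds (I := 𝓡 d) x] with z hz
      simp only [Φ, Function.comp_apply]
      rw [(extChartAt (𝓡 d) x).left_inv hz])
    exact DFunLike.congr_fun (hasMFDerivAt_unique h2 h3) v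
  have hΦs : Φ (s, y) = extChartAt (𝓡 d) x (φ s x) := by simp only [Φ]; rw [hleft]
  rw [hΦs, ← hD, ← hD, g.chartMetric_mfderiv hs]

/-- The group law turns the derivative at time t into the one at time 0 from the point φ_t x, which
vanishes; so the function is constant in time. -/
theorem LorentzMetric.IsKilling.val_flow {g : LorentzMetric d M} (hg : g.IsKilling K)
    (hK : ContMDiff (𝓡 d) (𝓡 d).tangent ∞ (fun x ↦ (⟨x, K x⟩ : TangentBundle (𝓡 d) M)))
    (hφ : IsSmoothFlow K φ) (s : ℝ) (x : M) (v w : TangentSpace (𝓡 d) x) :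
    g.val (φ s x) (mfderiv (𝓡 d) (𝓡 d) (φ s) x v) (mfderiv (𝓡 d) (𝓡 d) (φ s) x w) =
      g.val x v w := by
  have hd : ∀ t, HasDerivAt (fun s ↦ g.val (φ s x) (mfderiv (𝓡 d) (𝓡 d) (φ s) x v)
      (mfderiv (𝓡 d) (𝓡 d) (φ s) x w)) 0 t := by
    intro t
    have h := hg.hasDerivAt_val_flow hK hφ (φ t x) (mfderiv (𝓡 d) (𝓡 d) (φ t) x v)
      (mfderiv (𝓡 d) (𝓡 d) (φ t) x w)
    have h' := HasDerivAt.comp_sub_const t t (by rw [sub_self]; exact h)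
    refine h'.congr_of_eventuallyEq (Eventually.of_forall fun s ↦ ?_)
    have hst : s - t + t = s := by ring
    refine g.val_congr ?_ ?_ ?_
    · rw [← hφ.add, hst]
    · rw [← hφ.mfderiv_add, hst]
    · rw [← hφ.mfderiv_add, hst]
  have := is_const_of_deriv_eq_zero (fun t ↦ (hd t).differentiableAt) (fun t ↦ (hd t).deriv) s 0
  exact this.trans (g.val_congr (hφ.zero x) (hφ.mfderiv_zero x v) (hφ.mfderiv_zero x w))

end Isometry

/-! ### Concatenation of timelike curves -/

section Chronology

variable {d : ℕ} {M : Type u} [TopologicalSpace M]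
  [ChartedSpace (EuclideanSpace ℝ (Fin d)) M] [IsManifold (𝓡 d) ∞ M]

/-- There is a smooth future-directed timelike curve from `p` to `q`. -/
def LorentzMetric.SmoothlyPrecedes (g : LorentzMetric d M) (T : Π x : M, TangentSpace (𝓡 d) x)
    (p q : M) : Prop :=
  ∃ (γ : ℝ → M) (a b : ℝ), a < b ∧ γ a = p ∧ γ b = q ∧ ∀ t ∈ Icc a b,
    ContMDiffAt 𝓘(ℝ, ℝ) (𝓡 d) ∞ γ t ∧
      g.FutureTimelike T (γ t) (mfderiv 𝓘(ℝ, ℝ) (𝓡 d) γ t (1 : ℝ))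

variable {g : LorentzMetric d M} {T : Π x : M, TangentSpace (𝓡 d) x}

theorem LorentzMetric.FutureTimelike.congr {x y : M} (h : x = y)
    {v : TangentSpace (𝓡 d) x} {w : TangentSpace (𝓡 d) y}
    (hv : (v : EuclideanSpace ℝ (Fin d)) = w) (hx : g.FutureTimelike T x v) :
    g.FutureTimelike T y w := by
  subst h
  cases hv
  exact hx

theorem LorentzMetric.SmoothlyPrecedes.exists_start {p q : M} (h : g.SmoothlyPrecedes T p q)
    (c : ℝ) : ∃ (γ : ℝ → M) (b : ℝ), c < b ∧ γ c = p ∧ γ b = q ∧ ∀ t ∈ Icc c b,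
      ContMDiffAt 𝓘(ℝ, ℝ) (𝓡 d) ∞ γ t ∧
        g.FutureTimelike T (γ t) (mfderiv 𝓘(ℝ, ℝ) (𝓡 d) γ t (1 : ℝ)) := by
  obtain ⟨γ, a, b, hab, ha, hb, hγ⟩ := h
  refine ⟨fun t ↦ γ (t + (a - c)), b - (a - c), by linarith, by simpa using ha, by simpa using hb,
    fun t ht ↦ ?_⟩
  obtain ⟨h1, h2⟩ := hγ (t + (a - c)) ⟨by linarith [ht.1], by linarith [ht.2]⟩
  have hs : HasMFDerivAt 𝓘(ℝ, ℝ) 𝓘(ℝ, ℝ) (fun t : ℝ ↦ t + (a - c)) t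
      (ContinuousLinearMap.id ℝ ℝ) :=
    ((hasFDerivAt_id t).add_const (a - c)).hasMFDerivAt
  refine ⟨ContMDiffAt.comp t h1 (contDiff_id.add contDiff_const).contMDiff.contMDiffAt, ?_⟩
  have h3 := ((h1.mdifferentiableAt (by simp)).hasMFDerivAt.comp t hs).mfderiv
  exact h2.congr rfl (DFunLike.congr_fun h3 (1 : ℝ)).symm

theorem LorentzMetric.chronologicalFuture_of_smoothlyPrecedes_aux {γ : ℝ → M} {a b : ℝ}
    (hab : a < b) (hγ : ∀ t ∈ Icc a b, ContMDiffAt 𝓘(ℝ, ℝ) (𝓡 d) ∞ γ t ∧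
        g.FutureTimelike T (γ t) (mfderiv 𝓘(ℝ, ℝ) (𝓡 d) γ t (1 : ℝ))) :
    ContMDiffOn 𝓘(ℝ, ℝ) (𝓡 d) ∞ γ (Icc a b) ∧ ∀ t ∈ Icc a b,
      g.FutureTimelike T (γ t) (mfderivWithin 𝓘(ℝ, ℝ) (𝓡 d) γ (Icc a b) t (1 : ℝ)) := by
  refine ⟨fun t ht ↦ (hγ t ht).1.contMDiffWithinAt, fun t ht ↦ ?_⟩
  have hu : UniqueMDiffWithinAt 𝓘(ℝ, ℝ) (Icc a b) t :=
    (uniqueDiffOn_Icc hab t ht).uniqueMDiffWithinAt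
  have hd : MDifferentiableAt 𝓘(ℝ, ℝ) (𝓡 d) γ t := (hγ t ht).1.mdifferentiableAt (by simp)
  rw [mfderivWithin_eq_mfderiv hu hd]
  exact (hγ t ht).2

theorem LorentzMetric.SmoothlyPrecedes.mem_chronologicalFuture {p q : M}
    (h : g.SmoothlyPrecedes T p q) : q ∈ g.chronologicalFuture T p := by
  obtain ⟨γ, a, b, hab, ha, hb, hγ⟩ := h
  refine ⟨γ, a, b, hab, ha, hb, ordConnected_Icc,
    fun t ht ↦ (hγ t ht).1.continuousAt.continuousWithinAt, ∅, by simp, ?_⟩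
  intro s hs e he hse _
  exact chronologicalFuture_of_smoothlyPrecedes_aux hse
    fun t ht ↦ hγ t ⟨hs.1.trans ht.1, ht.2.trans he.2⟩

theorem LorentzMetric.SmoothlyPrecedes.mem_chronologicalFuture_of_mem {p q r : M}
    (hq : q ∈ g.chronologicalFuture T p) (h : g.SmoothlyPrecedes T q r) :
    r ∈ g.chronologicalFuture T p := by
  obtain ⟨γ₁, a, b, hab, ha, hb, hγ₁⟩ := hq
  obtain ⟨γ₂, c, hbc, hb₂, hc, hγ₂⟩ := h.exists_start b
  obtain ⟨B, hB, hpieces⟩ := hγ₁.pieces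
  let γ : ℝ → M := fun t ↦ if t ≤ b then γ₁ t else γ₂ t
  have hl : ∀ t ≤ b, γ t = γ₁ t := fun t ht ↦ if_pos ht
  have hr : ∀ t, b ≤ t → γ t = γ₂ t := by
    intro t ht
    rcases ht.eq_or_lt with rfl | ht
    · rw [hl b le_rfl, hb, hb₂]
    · exact if_neg ht.not_ge
  have hcongr : ∀ {γ' : ℝ → M} {s e : ℝ}, EqOn γ γ' (Icc s e) →
      (ContMDiffOn 𝓘(ℝ, ℝ) (𝓡 d) ∞ γ' (Icc s e) ∧ ∀ t ∈ Icc s e,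
        g.FutureTimelike T (γ' t) (mfderivWithin 𝓘(ℝ, ℝ) (𝓡 d) γ' (Icc s e) t (1 : ℝ))) →
      ContMDiffOn 𝓘(ℝ, ℝ) (𝓡 d) ∞ γ (Icc s e) ∧ ∀ t ∈ Icc s e,
        g.FutureTimelike T (γ t) (mfderivWithin 𝓘(ℝ, ℝ) (𝓡 d) γ (Icc s e) t (1 : ℝ)) := by
    intro γ' s e heq h
    refine ⟨h.1.congr heq, fun t ht ↦ (h.2 t ht).congr (heq ht).symm ?_⟩
    have h' : (mfderivWithin 𝓘(ℝ, ℝ) (𝓡 d) γ (Icc s e) t : ℝ →L[ℝ] EuclideanSpace ℝ (Fin d)) =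
      mfderivWithin 𝓘(ℝ, ℝ) (𝓡 d) γ' (Icc s e) t := mfderivWithin_congr heq (heq ht)
    exact (DFunLike.congr_fun h' (1 : ℝ)).symm
  -- The junction b becomes a break point. The old break points are cut down to [a, b], the only
  -- range where `B` is known to be finite.
  refine ⟨γ, a, c, hab.trans hbc, (hl a hab.le).trans ha, (hr c hbc.le).trans hc,
    ordConnected_Icc, ?_, (B ∩ Icc a b) ∪ {b}, fun s _ e _ ↦ ?_, fun s hs e he hse hdisj ↦ ?_⟩
  · rw [← Icc_union_Icc_eq_Icc hab.le hbc.le]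
    refine ContinuousOn.union_of_isClosed ?_ ?_ isClosed_Icc isClosed_Icc
    · exact hγ₁.continuousOn.congr fun t ht ↦ hl t ht.2
    · exact ContinuousOn.congr
        (fun t ht ↦ (hγ₂ t ht).1.continuousAt.continuousWithinAt) fun t ht ↦ hr t ht.1
  · exact ((hB a (left_mem_Icc.2 hab.le) b (right_mem_Icc.2 hab.le)).union
      (finite_singleton b)).subset inter_subset_left
  · rcases le_or_gt e b with heb | heb
    · refine hcongr (γ' := γ₁) (fun t ht ↦ hl t (ht.2.trans heb)) (hpieces s ⟨hs.1, hse.le.trans heb⟩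
        e ⟨hs.1.trans hse.le, heb⟩ hse ?_)
      rw [Set.disjoint_left] at hdisj ⊢
      exact fun t ht ht' ↦ hdisj
        (Or.inl ⟨ht, hs.1.trans ht'.1.le, ht'.2.le.trans heb⟩) ht'
    · have hsb : b ≤ s := by
        by_contra! hcon
        exact Set.disjoint_left.1 hdisj (Or.inr rfl) ⟨hcon, heb⟩
      exact hcongr (γ' := γ₂) (fun t ht ↦ hr t (hsb.trans ht.1))
        (chronologicalFuture_of_smoothlyPrecedes_aux hse
          fun t ht ↦ hγ₂ t ⟨hsb.trans ht.1, ht.2.trans he.2⟩)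

/-- Chains of smooth timelike curves are convenient to build; only here do they become a single
piecewise smooth curve. -/
theorem LorentzMetric.mem_chronologicalFuture_of_transGen {p q : M}
    (h : Relation.TransGen (g.SmoothlyPrecedes T) p q) : q ∈ g.chronologicalFuture T p := by
  induction h with
  | single h => exact h.mem_chronologicalFuture
  | tail _ h ih => exact h.mem_chronologicalFuture_of_mem ih

end Chronology

/-! ### Total viciousness -/

section TotallyVicious

variable {d : ℕ} {M : Type u} [TopologicalSpace M]
  [ChartedSpace (EuclideanSpace ℝ (Fin d)) M] [IsManifold (𝓡 d) ∞ M]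
  {g : LorentzMetric d M} {K : Π x : M, TangentSpace (𝓡 d) x} {φ : ℝ → M → M}

/-- The flow preserves both g and K, hence the time cone and its orientation. -/
theorem LorentzMetric.SmoothlyPrecedes.flow (hK : g.IsStaticField K) (hφ : IsSmoothFlow K φ)
    {p q : M} (h : g.SmoothlyPrecedes K p q) (s : ℝ) :
    g.SmoothlyPrecedes K (φ s p) (φ s q) := by
  obtain ⟨γ, a, b, hab, ha, hb, hγ⟩ := h
  refine ⟨φ s ∘ γ, a, b, hab, congrArg _ ha, congrArg _ hb, fun t ht ↦ ?_⟩
  obtain ⟨h1, h2⟩ := hγ t ht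
  refine ⟨(hφ.contMDiff_apply s).contMDiffAt.comp t h1, ?_⟩
  rw [mfderiv_comp t (hφ.mdifferentiable s _) (h1.mdifferentiableAt (by simp))]
  refine ⟨(hK.killing.val_flow hK.smooth hφ s (γ t) _ _).trans_lt h2.1, ?_⟩
  refine lt_of_eq_of_lt ?_ h2.2
  refine Eq.trans ?_ (hK.killing.val_flow hK.smooth hφ s (γ t) _ _)
  exact g.val_congr rfl rfl (hφ.mfderiv_field s (γ t)).symm

theorem LorentzMetric.IsStaticField.smoothlyPrecedes_flow (hK : g.IsStaticField K)
    (hφ : IsSmoothFlow K φ) (x : M) {s t : ℝ} (hst : s < t) :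
    g.SmoothlyPrecedes K (φ s x) (φ t x) := by
  refine ⟨fun t ↦ φ t x, s, t, hst, rfl, rfl, fun r _ ↦ ⟨?_, ?_⟩⟩
  · exact (hφ.contMDiff.comp (contMDiff_id.prodMk contMDiff_const)).contMDiffAt
  · have h := (hφ.isMIntegralCurve x r).mfderiv
    have h1 : (mfderiv 𝓘(ℝ, ℝ) (𝓡 d) (fun t ↦ φ t x) r (1 : ℝ) : EuclideanSpace ℝ (Fin d)) =
        K (φ r x) := (DFunLike.congr_fun h (1 : ℝ)).trans (one_smul ℝ (K (φ r x)))
    exact FutureTimelike.congr rfl h1.symm ⟨hK.timelike _, hK.timelike _⟩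

/-- In a chart at q the displacement from r to φ_δ r', divided by δ, is close to K(q) when δ is
small and r, r' are much closer to q than δ. The timelike future cone is open, so the straight
segment between them is a future-directed timelike curve. -/
theorem LorentzMetric.IsStaticField.eventually_smoothlyPrecedes (hK : g.IsStaticField K)
    (hφ : IsSmoothFlow K φ) (q : M) :
    ∃ δ : ℝ, ∃ V ∈ 𝓝 q, ∀ r ∈ V, ∀ r' ∈ V, g.SmoothlyPrecedes K r (φ δ r') := by
  have hopen := isOpen_extChartAt_target (I := 𝓡 d) q
  have hy := mem_extChartAt_target (I := 𝓡 d) q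
  have hqs := mem_extChartAt_source (I := 𝓡 d) q
  have hright : ∀ x ∈ (extChartAt (𝓡 d) q).source,
    (extChartAt (𝓡 d) q).symm (extChartAt (𝓡 d) q x) = x := fun x hx ↦
      (extChartAt (𝓡 d) q).left_inv hx
  set y := extChartAt (𝓡 d) q q with hydef
  set k := chartField K q with hkdef
  set G := g.chartMetric q with hGdef
  have hkc : ContinuousAt k y := ((contDiffOn_chartField hK.smooth).continuousOn).continuousAt
    (hopen.mem_nhds hy)
  have hGc : ContinuousAt G y := ((g.contDiffOn_chartMetric q).continuousOn).continuousAt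
    (hopen.mem_nhds hy)
  have htime : ∀ z ∈ (extChartAt (𝓡 d) q).target, G z (k z) (k z) < 0 := by
    intro z hz
    rw [hGdef, g.chartMetric_apply, hkdef, mfderiv_symm_chartField K q hz]
    exact hK.timelike _
  have hG2 : ContinuousAt (fun p : EuclideanSpace ℝ (Fin d) × EuclideanSpace ℝ (Fin d) ↦
      G p.1) (y, k y) := ContinuousAt.comp (g := G) (f := Prod.fst) hGc continuousAt_fst
  have hk2 : ContinuousAt (fun p : EuclideanSpace ℝ (Fin d) × EuclideanSpace ℝ (Fin d) ↦
      k p.1) (y, k y) := ContinuousAt.comp (g := k) (f := Prod.fst) hkc continuousAt_fst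
  have hcone : ∀ᶠ p in 𝓝 (y, k y), p.1 ∈ (extChartAt (𝓡 d) q).target ∧
      G p.1 p.2 p.2 < 0 ∧ G p.1 p.2 (k p.1) < 0 := by
    refine (continuousAt_fst.eventually (hopen.mem_nhds hy)).and (.and ?_ ?_)
    · exact ((hG2.clm_apply continuousAt_snd).clm_apply continuousAt_snd).eventually
        (gt_mem_nhds (htime y hy))
    · exact ((hG2.clm_apply continuousAt_snd).clm_apply hk2).eventually
        (gt_mem_nhds (htime y hy))
  obtain ⟨ε, hε, hball⟩ := Metric.eventually_nhds_iff.1 hcone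
  let c : ℝ → EuclideanSpace ℝ (Fin d) := fun s ↦ extChartAt (𝓡 d) q (φ s q)
  have hflow : Continuous (fun s ↦ φ s q) :=
    hφ.contMDiff.continuous.comp (Continuous.prodMk_left q)
  have hc0 : c 0 = y := by simp only [c, hφ.zero]; rfl
  have hc : HasDerivAt c (k y) 0 := by
    have hm' : φ 0 q ∈ (extChartAt (𝓡 d) q).source := by rwa [hφ.zero]
    have h1 := ((isLocalDiffeomorphAt_extChartAt q hm').mdifferentiableAt (by simp)).hasMFDerivAt
    have h2 : HasDerivAt c _ 0 := HasFDerivAt.hasDerivAt (F := EuclideanSpace ℝ (Fin d))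
      (h1.comp 0 (hφ.isMIntegralCurve q 0)).hasFDerivAt
    refine h2.congr_deriv ?_
    have key : ∀ m', m' = q → (mfderiv (𝓡 d) 𝓘(ℝ, EuclideanSpace ℝ (Fin d))
        (extChartAt (𝓡 d) q) m' (K m') : EuclideanSpace ℝ (Fin d)) = k y := by
      rintro _ rfl
      exact (chartField_extChartAt K hqs).symm
    refine Eq.trans ?_ (key _ (hφ.zero q))
    exact congrArg (mfderiv (𝓡 d) 𝓘(ℝ, EuclideanSpace ℝ (Fin d))
        (extChartAt (𝓡 d) q) (φ 0 q)) (one_smul ℝ (K (φ 0 q)))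
  have hslope : ∀ᶠ s in 𝓝[>] (0 : ℝ), dist (s⁻¹ • (c s - c 0)) (k y) < ε := by
    have := hc.tendsto_slope_zero_right
    simp only [zero_add] at this
    exact this.eventually (Metric.ball_mem_nhds _ hε)
  have hclose : ∀ᶠ s in 𝓝[>] (0 : ℝ), dist (c s) y < ε := by
    have := hc.continuousAt.tendsto
    rw [hc0] at this
    exact (this.eventually (Metric.ball_mem_nhds _ hε)).filter_mono nhdsWithin_le_nhds
  have hsrc : ∀ᶠ s in 𝓝[>] (0 : ℝ), φ s q ∈ (extChartAt (𝓡 d) q).source := by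
    refine (hflow.continuousAt.eventually (p := (· ∈ (extChartAt (𝓡 d) q).source))
      ?_).filter_mono nhdsWithin_le_nhds
    simp only [hφ.zero]
    exact extChartAt_source_mem_nhds (I := 𝓡 d) q
  -- δ is fixed for the orbit of q itself; only then is V chosen, by continuity, small in comparison
  -- with δ.
  obtain ⟨δ, hδ1, hδ2, hδ3, hδ⟩ := (hslope.and (hclose.and (hsrc.and
    self_mem_nhdsWithin))).exists
  have hδ : (0 : ℝ) < δ := hδ
  have hψδ : ContinuousAt (fun r' ↦ extChartAt (𝓡 d) q (φ δ r')) q :=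
    ContinuousAt.comp (g := extChartAt (𝓡 d) q) (f := φ δ)
      (continuousAt_extChartAt' hδ3) (hφ.contMDiff_apply δ).continuous.continuousAt
  have hψ : ContinuousAt (extChartAt (𝓡 d) q) q := continuousAt_extChartAt q
  have hev : ∀ᶠ p in 𝓝 q ×ˢ 𝓝 q, (p.1 ∈ (extChartAt (𝓡 d) q).source ∧
      dist (extChartAt (𝓡 d) q p.1) y < ε) ∧ (φ δ p.2 ∈ (extChartAt (𝓡 d) q).source ∧
      dist (extChartAt (𝓡 d) q (φ δ p.2)) y < ε) ∧
      dist (δ⁻¹ • (extChartAt (𝓡 d) q (φ δ p.2) - extChartAt (𝓡 d) q p.1)) (k y) < ε := by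
    refine .and ?_ (.and ?_ ?_)
    · exact .and (tendsto_fst.eventually (extChartAt_source_mem_nhds (I := 𝓡 d) q))
        (tendsto_fst.eventually (hψ.eventually (Metric.ball_mem_nhds _ hε)))
    · refine .and (tendsto_snd.eventually
        (p := fun z ↦ φ δ z ∈ (extChartAt (𝓡 d) q).source) ?_) (tendsto_snd.eventually
        (p := fun z ↦ dist (extChartAt (𝓡 d) q (φ δ z)) y < ε) ?_)
      · exact (hφ.contMDiff_apply δ).continuous.continuousAt.eventually
          ((isOpen_extChartAt_source (I := 𝓡 d) q).mem_nhds hδ3)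
      · exact hψδ.eventually (Metric.isOpen_ball.mem_nhds hδ2)
    · have h1 : Tendsto (fun p : M × M ↦ δ⁻¹ • (extChartAt (𝓡 d) q (φ δ p.2) -
          extChartAt (𝓡 d) q p.1)) (𝓝 q ×ˢ 𝓝 q) (𝓝 (δ⁻¹ • (c δ - c 0))) := by
        refine ((hψδ.tendsto.comp tendsto_snd).sub ?_).const_smul δ⁻¹
        rw [hc0]
        exact hψ.tendsto.comp tendsto_fst
      exact h1.eventually (Metric.isOpen_ball.mem_nhds hδ1)
  obtain ⟨V, hV, hVp⟩ := eventually_prod_self_iff'.1 hev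
  refine ⟨δ, V, hV, fun r hr r' hr' ↦ ?_⟩
  obtain ⟨⟨hs, hd⟩, ⟨hs', hd'⟩, hv⟩ := hVp r hr r' hr'
  set a := extChartAt (𝓡 d) q r with hadef
  set b := extChartAt (𝓡 d) q (φ δ r') with hbdef
  set w := δ⁻¹ • (b - a) with hwdef
  refine ⟨fun t ↦ (extChartAt (𝓡 d) q).symm (a + t • w), 0, δ, hδ, by
      simp only [zero_smul, add_zero]; exact hright r hs,
    ?_, fun t ht ↦ ?_⟩
  · simp only [hwdef, smul_smul, mul_inv_cancel₀ hδ.ne', one_smul, add_sub_cancel]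
    exact hright _ hs'
  · have hmem : dist (a + t • w) y < ε := by
      have hconv := (convex_ball y ε).add_smul_mem (x := a) (y := b - a) hd
        (by rw [add_sub_cancel]; exact hd') (t := t / δ)
        ⟨div_nonneg ht.1 hδ.le, (div_le_one hδ).2 ht.2⟩
      rw [hwdef, smul_smul, ← div_eq_mul_inv]
      exact hconv
    obtain ⟨ht1, ht2, ht3⟩ := hball (y := (a + t • w, w)) (by
      rw [Prod.dist_eq]; exact max_lt hmem hv)
    have hline : HasDerivAt (fun t : ℝ ↦ a + t • w) w t := by
      simpa using ((hasDerivAt_id t).smul_const w).const_add a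
    have hloc := isLocalDiffeomorphAt_extChartAt_symm q ht1
    refine ⟨ContMDiffAt.comp t hloc.contMDiffAt
      (contDiff_const.add (contDiff_id.smul contDiff_const)).contMDiff.contMDiffAt, ?_⟩
    have h1 := ((hloc.mdifferentiableAt (by simp)).hasMFDerivAt.comp t
      hline.hasFDerivAt.hasMFDerivAt).mfderiv
    have h2 : (mfderiv 𝓘(ℝ, ℝ) (𝓡 d) (fun t : ℝ ↦ (extChartAt (𝓡 d) q).symm (a + t • w)) t
        (1 : ℝ) : EuclideanSpace ℝ (Fin d)) = mfderiv 𝓘(ℝ, EuclideanSpace ℝ (Fin d)) (𝓡 d)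
          (extChartAt (𝓡 d) q).symm (a + t • w) w :=
      (DFunLike.congr_fun h1 (1 : ℝ)).trans (congrArg (mfderiv 𝓘(ℝ, EuclideanSpace ℝ (Fin d)) (𝓡 d)
          (extChartAt (𝓡 d) q).symm (a + t • w)) (one_smul ℝ w))
    refine FutureTimelike.congr rfl h2.symm ⟨ht2, lt_of_eq_of_lt ?_ ht3⟩
    exact g.val_congr rfl rfl (mfderiv_symm_chartField K q ht1).symm

theorem LorentzMetric.IsStaticField.transGen_smoothlyPrecedes [CompactSpace M] [ConnectedSpace M]
    (hK : g.IsStaticField K) (hφ : IsSmoothFlow K φ) (p q : M) :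
    Relation.TransGen (g.SmoothlyPrecedes K) p q := by
  choose δ V hV hδ using hK.eventually_smoothlyPrecedes hφ
  let A : Set M := {q | ∃ s, Relation.TransGen (g.SmoothlyPrecedes K) p (φ s q)}
  -- The roles of q' and r in V q are interchangeable, so this gives both the openness and the
  -- closedness of `A`.
  have hstep : ∀ q q', q' ∈ V q → ∀ s, Relation.TransGen (g.SmoothlyPrecedes K) p (φ s q') →
      ∀ r ∈ V q, Relation.TransGen (g.SmoothlyPrecedes K) p (φ (s + δ q) r) := by
    intro q q' hq' s hs r hr
    rw [hφ.add]
    exact hs.tail ((hδ q q' hq' r hr).flow hK hφ s)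
  have hAo : IsOpen A := isOpen_iff_mem_nhds.2 fun q ⟨s, hs⟩ ↦ mem_of_superset (hV q)
    fun r hr ↦ ⟨_, hstep q q (mem_of_mem_nhds (hV q)) s hs r hr⟩
  have hAc : IsClosed A := by
    refine ⟨isOpen_iff_mem_nhds.2 fun q hq ↦ mem_of_superset (hV q) fun r hr ⟨s, hs⟩ ↦ hq ?_⟩
    exact ⟨_, hstep q r hr s hs q (mem_of_mem_nhds (hV q))⟩
  have hAne : A.Nonempty :=
    ⟨p, _, .single (hδ p p (mem_of_mem_nhds (hV p)) p (mem_of_mem_nhds (hV p)))⟩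
  have hA : A = univ := IsClopen.eq_univ ⟨hAc, hAo⟩ hAne
  have hs : ∀ q, ∃ s, Relation.TransGen (g.SmoothlyPrecedes K) p (φ s q) := fun q ↦
    (hA ▸ mem_univ q : q ∈ A)
  choose s hs using hs
  obtain ⟨t, ht⟩ := CompactSpace.elim_nhds_subcover V hV
  obtain ⟨S, hS⟩ := (t.image fun q ↦ s q + δ q).exists_le
  -- S dominates the finitely many times s q + δ q of the subcover; the extra 1 leaves a positive
  -- time for a last step along the flow line of r.
  have hall : ∀ r, Relation.TransGen (g.SmoothlyPrecedes K) p (φ (S + 1) r) := by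
    intro r
    have hr : r ∈ (⊤ : Set M) := trivial
    rw [← ht] at hr
    simp only [mem_iUnion] at hr
    obtain ⟨q, hq, hrq⟩ := hr
    refine (hstep q q (mem_of_mem_nhds (hV q)) _ (hs q) r hrq).tail
      (hK.smoothlyPrecedes_flow hφ r ?_)
    have := hS _ (Finset.mem_image_of_mem _ hq)
    linarith
  have := hall (φ (-(S + 1)) q)
  rwa [← hφ.add, add_neg_cancel, hφ.zero] at this

theorem LorentzMetric.IsStaticField.totally_vicious [T2Space M] [CompactSpace M] [ConnectedSpace M]
    (hK : g.IsStaticField K) (p : M) :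
    g.chronologicalFuture K p = univ ∧ g.chronologicalPast K p = univ := by
  obtain ⟨φ, hφ⟩ := exists_isSmoothFlow_of_compactSpace hK.smooth
  exact ⟨eq_univ_of_forall fun q ↦
      mem_chronologicalFuture_of_transGen (hK.transGen_smoothlyPrecedes hφ p q),
    eq_univ_of_forall fun q ↦
      mem_chronologicalFuture_of_transGen (hK.transGen_smoothlyPrecedes hφ q p)⟩

end TotallyVicious

/-! ### Gluing local primitives over a simply connected space -/

section LocallyConstantCocycle

/-- The real numbers with the discrete topology. -/
def DiscreteReal : Type := ℝ

instance : TopologicalSpace DiscreteReal := ⊥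

instance : DiscreteTopology DiscreteReal := ⟨rfl⟩

/-- The differences f j - f i form a locally constant cocycle. It glues the sets U i × ℝ, with ℝ
discrete, to a covering of N, which has a continuous section because N is simply connected and
locally path connected; the section corrects the f i by local constants so that they agree. -/
theorem exists_sub_eventually_const {N ι : Type*} [TopologicalSpace N] [SimplyConnectedSpace N]
    [LocallyPathConnectedSpace N] {U : ι → Set N} (hU : ∀ i, IsOpen (U i)) {idx : N → ι}
    (hidx : ∀ x, x ∈ U (idx x)) {f : ι → N → ℝ}
    (hf : ∀ i j, ∀ x ∈ U i, x ∈ U j → ∀ᶠ y in 𝓝 x, f j y - f i y = f j x - f i x) :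
    ∃ τ : N → ℝ, ∀ i, ∀ x ∈ U i, ∀ᶠ y in 𝓝 x, τ y - f i y = τ x - f i x := by
  let Z : FiberBundleCore ι N DiscreteReal :=
    { baseSet := U
      isOpen_baseSet := hU
      indexAt := idx
      mem_baseSet_at := hidx
      coordChange := fun i j x (r : ℝ) ↦ (r + (f j x - f i x) : ℝ)
      coordChange_self := fun i x _ (r : ℝ) ↦ by
        change (r + (f i x - f i x) : ℝ) = r
        ring
      continuousOn_coordChange := fun i j ↦ by
        rintro ⟨x, r⟩ ⟨⟨hi, hj⟩, -⟩
        refine ContinuousAt.continuousWithinAt ?_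
        refine (tendsto_pure.2 ?_).mono_right (congrFun (nhds_discrete DiscreteReal) _).ge
        rw [nhds_prod_eq, nhds_discrete DiscreteReal]
        refine eventually_prod_iff.2 ⟨_, hf i j x hi hj, (· = r), rfl, fun {y} hy {r'} hr ↦ ?_⟩
        rw [hr]
        exact congrArg (HAdd.hAdd (α := ℝ) r) hy
      coordChange_comp := fun i j k x _ (r : ℝ) ↦ by
        change (r + (f j x - f i x) + (f k x - f j x) : ℝ) = (r + (f k x - f i x) : ℝ)
        ring }
  have hcov : IsCoveringMap (π DiscreteReal Z.Fiber) := FiberBundle.isCoveringMap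
  obtain ⟨x₀⟩ : Nonempty N := inferInstance
  obtain ⟨s, ⟨-, hs⟩, -⟩ := hcov.existsUnique_continuousMap_lifts (ContinuousMap.id N) x₀
    (⟨x₀, (0 : ℝ)⟩ : Z.TotalSpace) rfl
  have hs1 : ∀ x, (s x).1 = x := fun x ↦ congrFun hs x
  let r : ι → N → ℝ := fun i x ↦ (Z.localTriv i (s x)).2
  let c : N → ℝ := fun x ↦ (s x).2
  have hr : ∀ i x, r i x = c x + (f i x - f (idx x) x) := by
    intro i x
    change c x + (f i (s x).1 - f (idx (s x).1) (s x).1) = _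
    rw [hs1 x]
  -- r i is the coordinate of the section over U i, locally constant there. By `hr` the difference f
  -- i - r i does not depend on i, so it equals τ near every point of U i.
  refine ⟨fun x ↦ f (idx x) x - r (idx x) x, fun i x hx ↦ ?_⟩
  have hmem : s x ∈ (Z.localTriv i).source := by
    rw [Z.mem_localTriv_source, ← Z.baseSet_at, hs1]
    exact hx
  have hcont : ContinuousAt (fun y ↦ (Z.localTriv i (s y)).2) x :=
    continuous_snd.continuousAt.comp (ContinuousAt.comp (g := Z.localTriv i)
      ((Z.localTriv i).continuousAt hmem) s.continuous.continuousAt)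
  have hev := tendsto_pure.1 (hcont.tendsto.mono_right (congrFun (nhds_discrete DiscreteReal) _).le)
  filter_upwards [hev] with y hy
  have hy' : r i y = r i x := hy
  rw [hr, hr] at hy'
  rw [hr, hr]
  linarith

end LocallyConstantCocycle

/-! ### Local diffeomorphisms and functions with equal differentials -/

section LocalDiffeomorph

theorem IsLocalDiffeomorphAt.contMDiffAt_of_comp
    {E : Type*} [NormedAddCommGroup E] [NormedSpace ℝ E] {H : Type*} [TopologicalSpace H]
    {I : ModelWithCorners ℝ E H} {P : Type*} [TopologicalSpace P] [ChartedSpace H P]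
    {E' : Type*} [NormedAddCommGroup E'] [NormedSpace ℝ E'] {H' : Type*} [TopologicalSpace H']
    {I' : ModelWithCorners ℝ E' H'} {P' : Type*} [TopologicalSpace P'] [ChartedSpace H' P']
    {E'' : Type*} [NormedAddCommGroup E''] [NormedSpace ℝ E''] {H'' : Type*} [TopologicalSpace H'']
    {I'' : ModelWithCorners ℝ E'' H''} {P'' : Type*} [TopologicalSpace P''] [ChartedSpace H'' P'']
    {f : P → P'} {h : P'' → P} {x : P''} (hf : IsLocalDiffeomorphAt I I' ∞ f (h x))
    (hh : ContinuousAt h x) (hfh : ContMDiffAt I'' I' ∞ (fun y ↦ f (h y)) x) :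
    ContMDiffAt I'' I ∞ h x := by
  have h1 : ContMDiffAt I'' I ∞ (fun y ↦ hf.localInverse (f (h y))) x :=
    ContMDiffAt.comp x hf.localInverse_contMDiffAt hfh
  refine h1.congr_of_eventuallyEq ?_
  filter_upwards [hh.eventually hf.localInverse_eventuallyEq_left] with y hy
  exact hy.symm

end LocalDiffeomorph

section LocallyConstant

variable {d : ℕ} {M : Type u} [TopologicalSpace M]
  [ChartedSpace (EuclideanSpace ℝ (Fin d)) M]

theorem realDeriv_comp {N : Type v} [TopologicalSpace N] [ChartedSpace (EuclideanSpace ℝ (Fin d)) N]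
    {f : M → ℝ} {h : N → M} {x : N} (hf : MDifferentiableAt (𝓡 d) 𝓘(ℝ, ℝ) f (h x))
    (hh : MDifferentiableAt (𝓡 d) (𝓡 d) h x) (v : TangentSpace (𝓡 d) x) :
    realDeriv (fun y ↦ f (h y)) x v = realDeriv f (h x) (mfderiv (𝓡 d) (𝓡 d) h x v) :=
  DFunLike.congr_fun (mfderiv_comp x hf hh) v

theorem hasDerivAt_comp_realDeriv {f : M → ℝ} {γ : ℝ → M} {t : ℝ}
    {v : TangentSpace (𝓡 d) (γ t)} (hf : MDifferentiableAt (𝓡 d) 𝓘(ℝ, ℝ) f (γ t))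
    (hγ : HasMFDerivAt 𝓘(ℝ, ℝ) (𝓡 d) γ t
      ((1 : ℝ →L[ℝ] ℝ).smulRight (v : EuclideanSpace ℝ (Fin d)))) :
    HasDerivAt (fun s ↦ f (γ s)) (realDeriv f (γ t) v) t := by
  have h1 : HasDerivAt (fun s ↦ f (γ s)) _ t :=
    HasFDerivAt.hasDerivAt (F := ℝ) (hf.hasMFDerivAt.comp t hγ).hasFDerivAt
  refine h1.congr_deriv ?_
  exact congrArg (realDeriv f (γ t)) (one_smul ℝ v)

variable [IsManifold (𝓡 d) ∞ M]

theorem eventually_sub_eq_of_realDeriv_eq {U : Set M} (hU : IsOpen U) {f f' : M → ℝ}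
    (hf : ∀ x ∈ U, MDifferentiableAt (𝓡 d) 𝓘(ℝ, ℝ) f x)
    (hf' : ∀ x ∈ U, MDifferentiableAt (𝓡 d) 𝓘(ℝ, ℝ) f' x)
    (h : ∀ x ∈ U, ∀ v : TangentSpace (𝓡 d) x, realDeriv f' x v = realDeriv f x v) {m : M}
    (hm : m ∈ U) : ∀ᶠ x in 𝓝 m, f' x - f x = f' m - f m := by
  have hopen := isOpen_extChartAt_target (I := 𝓡 d) m
  have hy := mem_extChartAt_target (I := 𝓡 d) m
  have hleft := extChartAt_to_inv (I := 𝓡 d) m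
  set y := extChartAt (𝓡 d) m m
  have hcont : ContinuousAt (extChartAt (𝓡 d) m).symm y := continuousAt_extChartAt_symm m
  have hn : {z | z ∈ (extChartAt (𝓡 d) m).target ∧ (extChartAt (𝓡 d) m).symm z ∈ U} ∈ 𝓝 y := by
    refine inter_mem (hopen.mem_nhds hy) (hcont.preimage_mem_nhds (hU.mem_nhds ?_))
    rwa [hleft]
  obtain ⟨ε, hε, hball⟩ := Metric.mem_nhds_iff.1 hn
  let F : EuclideanSpace ℝ (Fin d) → ℝ := fun z ↦
    f' ((extChartAt (𝓡 d) m).symm z) - f ((extChartAt (𝓡 d) m).symm z)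
  have hF : ∀ z ∈ Metric.ball y ε, HasFDerivAt F (0 : EuclideanSpace ℝ (Fin d) →L[ℝ] ℝ) z := by
    intro z hz
    obtain ⟨hz1, hz2⟩ := hball hz
    have hs := ((isLocalDiffeomorphAt_extChartAt_symm m hz1).mdifferentiableAt
      (by simp)).hasMFDerivAt
    have h1 := ((hf' _ hz2).hasMFDerivAt.comp z hs).hasFDerivAt
    have h2 := ((hf _ hz2).hasMFDerivAt.comp z hs).hasFDerivAt
    refine (HasFDerivAt.sub h1 h2).congr_fderiv ?_
    ext v
    exact sub_eq_zero.2 (h _ hz2 _)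
  have hconst : ∀ z ∈ Metric.ball y ε, F z = F y := fun z hz ↦
    (convex_ball y ε).is_const_of_fderivWithin_eq_zero (𝕜 := ℝ)
      (fun w hw ↦ (hF w hw).differentiableAt.differentiableWithinAt)
      (fun w hw ↦ by
        rw [fderivWithin_of_isOpen Metric.isOpen_ball hw, (hF w hw).fderiv]) hz
      (Metric.mem_ball_self hε)
  filter_upwards [extChartAt_source_mem_nhds (I := 𝓡 d) m,
    (continuousAt_extChartAt (I := 𝓡 d) m).eventually (Metric.ball_mem_nhds y hε)] with x hx hxb
  have := hconst _ hxb
  simp only [F] at this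
  rwa [(extChartAt (𝓡 d) m).left_inv hx, hleft] at this

end LocallyConstant

/-! ### The field, the primitive and the flow on the universal covering -/

section Covering

variable {d : ℕ} {M : Type u} [TopologicalSpace M]
  [ChartedSpace (EuclideanSpace ℝ (Fin d)) M] [IsManifold (𝓡 d) ∞ M]
  {N : Type v} [TopologicalSpace N] [ChartedSpace (EuclideanSpace ℝ (Fin d)) N]
  [IsManifold (𝓡 d) ∞ N]
  {g : LorentzMetric d M} {K : Π x : M, TangentSpace (𝓡 d) x} {φ : ℝ → M → M}
  {gN : LorentzMetric d N} {proj : N → M}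

theorem LorentzMetric.IsUniversalLorentzianCovering.isInvertible_mfderiv
    (h : g.IsUniversalLorentzianCovering gN proj) (x : N) :
    (mfderiv (𝓡 d) (𝓡 d) proj x).IsInvertible :=
  (h.isLocalDiffeomorph x).isInvertible_mfderiv

theorem LorentzMetric.IsUniversalLorentzianCovering.mdifferentiableAt
    (h : g.IsUniversalLorentzianCovering gN proj) (x : N) :
    MDifferentiableAt (𝓡 d) (𝓡 d) proj x :=
  (h.isLocalDiffeomorph x).mdifferentiableAt (by simp)

theorem LorentzMetric.IsUniversalLorentzianCovering.mfderiv_mpullback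
    (h : g.IsUniversalLorentzianCovering gN proj) (K : Π x : M, TangentSpace (𝓡 d) x) (x : N) :
    mfderiv (𝓡 d) (𝓡 d) proj x (VectorField.mpullback (𝓡 d) (𝓡 d) proj K x) = K (proj x) :=
  (h.isInvertible_mfderiv x).self_apply_inverse _

theorem LorentzMetric.IsUniversalLorentzianCovering.contMDiff_mpullback
    (h : g.IsUniversalLorentzianCovering gN proj)
    (hK : ContMDiff (𝓡 d) (𝓡 d).tangent ∞ (fun x ↦ (⟨x, K x⟩ : TangentBundle (𝓡 d) M))) :
    ContMDiff (𝓡 d) (𝓡 d).tangent ∞ (fun x ↦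
      (⟨x, VectorField.mpullback (𝓡 d) (𝓡 d) proj K x⟩ : TangentBundle (𝓡 d) N)) :=
  ContMDiff.mpullback_vectorField hK h.isLocalDiffeomorph.contMDiff h.isInvertible_mfderiv
    (by simp)

theorem LorentzMetric.IsUniversalLorentzianCovering.timelike_mpullback
    (h : g.IsUniversalLorentzianCovering gN proj) (hK : g.IsStaticField K) (x : N) :
    gN.val x (VectorField.mpullback (𝓡 d) (𝓡 d) proj K x)
      (VectorField.mpullback (𝓡 d) (𝓡 d) proj K x) < 0 := by
  rw [h.isometry, h.mfderiv_mpullback]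
  exact hK.timelike _

/-- Local primitives on M have equal differentials on overlaps, as g(K, K) ≠ 0 can be cancelled; so
their pull-backs differ by local constants and glue on N. -/
theorem LorentzMetric.IsUniversalLorentzianCovering.exists_primitive
    (h : g.IsUniversalLorentzianCovering gN proj) (hK : g.IsStaticField K) :
    ∃ τ : N → ℝ, ContMDiff (𝓡 d) 𝓘(ℝ, ℝ) ∞ τ ∧ ∀ (x : N) (v : TangentSpace (𝓡 d) x),
      gN.val x (VectorField.mpullback (𝓡 d) (𝓡 d) proj K x)
        (VectorField.mpullback (𝓡 d) (𝓡 d) proj K x) * realDeriv τ x v =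
      gN.val x (VectorField.mpullback (𝓡 d) (𝓡 d) proj K x) v := by
  choose U f hU hmU hf using hK.exists_local_primitive
  have := h.simplyConnected
  have : LocallyPathConnectedSpace N :=
    ChartedSpace.locallyPathConnectedSpace (EuclideanSpace ℝ (Fin d)) N
  have hfm : ∀ i, ∀ x ∈ U i, MDifferentiableAt (𝓡 d) 𝓘(ℝ, ℝ) (f i) x := fun i x hx ↦
    (hf i x hx).1.mdifferentiableAt (by simp)
  obtain ⟨τ, hτ⟩ := exists_sub_eventually_const (U := fun i ↦ proj ⁻¹' U i)
    (fun i ↦ (hU i).preimage h.isLocalDiffeomorph.contMDiff.continuous)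
    (idx := proj) (fun x ↦ hmU (proj x)) (f := fun i x ↦ f i (proj x)) (by
      intro i j x hi hj
      refine h.isLocalDiffeomorph.contMDiff.continuous.continuousAt.eventually
        (p := fun y ↦ f j y - f i y = f j (proj x) - f i (proj x))
        (eventually_sub_eq_of_realDeriv_eq ((hU i).inter (hU j))
        (fun y hy ↦ hfm i y hy.1) (fun y hy ↦ hfm j y hy.2) ?_ ⟨hi, hj⟩)
      intro y hy v
      refine mul_left_cancel₀ (hK.timelike y).ne ?_
      rw [(hf j y hy.2).2, (hf i y hy.1).2])
  have hloc : ∀ x, τ =ᶠ[𝓝 x] fun y ↦ f (proj x) (proj y) + (τ x - f (proj x) (proj x)) := by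
    intro x
    filter_upwards [hτ (proj x) x (hmU _)] with y hy
    linarith
  refine ⟨τ, fun x ↦ ?_, fun x v ↦ ?_⟩
  · refine ContMDiffAt.congr_of_eventuallyEq ?_ (hloc x)
    exact (ContMDiffAt.comp x (hf _ _ (hmU (proj x))).1
      (h.isLocalDiffeomorph x).contMDiffAt).add contMDiffAt_const
  · have h1 : realDeriv τ x v = realDeriv (fun y ↦ f (proj x) (proj y)) x v := by
      have h2 := (hfm _ _ (hmU (proj x))).comp x (h.mdifferentiableAt x)
      have h3 : HasMFDerivAt (𝓡 d) 𝓘(ℝ, ℝ)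
          (fun y ↦ f (proj x) (proj y) + (τ x - f (proj x) (proj x))) x _ :=
        h2.hasMFDerivAt.add (hasMFDerivAt_const (τ x - f (proj x) (proj x)) x)
      have h4 := (h3.congr_of_eventuallyEq (hloc x)).mfderiv
      refine (DFunLike.congr_fun h4 v).trans (add_zero _)
    rw [h1, realDeriv_comp (hfm _ _ (hmU (proj x))) (h.mdifferentiableAt x), h.isometry,
      h.isometry, h.mfderiv_mpullback]
    exact (hf _ _ (hmU (proj x))).2 _

theorem LorentzMetric.IsUniversalLorentzianCovering.exists_lift_flow
    (h : g.IsUniversalLorentzianCovering gN proj) (hφ : IsSmoothFlow K φ) :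
    ∃ φN : ℝ → N → N, IsSmoothFlow (VectorField.mpullback (𝓡 d) (𝓡 d) proj K) φN ∧
      ∀ t x, proj (φN t x) = φ t (proj x) := by
  have hpc : Continuous proj := h.isLocalDiffeomorph.contMDiff.continuous
  have := h.simplyConnected
  -- The homotopy (s, (t, x)) ↦ φ_{st}(proj x) begins at `proj ∘ Prod.snd`, lifted by `Prod.snd`.
  -- Its lift at s = 1 is the flow on N, and uniqueness of lifts gives the group law.
  let H : C(unitInterval × (ℝ × N), M) :=
    ⟨fun p ↦ φ (p.1 * p.2.1) (proj p.2.2), hφ.contMDiff.continuous.comp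
      (f := fun p : unitInterval × (ℝ × N) ↦ ((p.1 : ℝ) * p.2.1, proj p.2.2)) (by fun_prop)⟩
  have H0 : ∀ a, H (0, a) = proj ((⟨Prod.snd, continuous_snd⟩ : C(ℝ × N, N)) a) := by
    rintro ⟨t, x⟩
    simp [H, hφ.zero]
  let L := h.isCoveringMap.liftHomotopy H ⟨Prod.snd, continuous_snd⟩ H0
  let φN : ℝ → N → N := fun t x ↦ L (1, (t, x))
  have hL : ∀ (s : unitInterval) (t : ℝ) (x : N), proj (L (s, (t, x))) = φ (s * t) (proj x) :=
    fun s t x ↦ congrFun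
      (h.isCoveringMap.liftHomotopy_lifts H ⟨Prod.snd, continuous_snd⟩ H0) (s, (t, x))
  have hlift : ∀ t x, proj (φN t x) = φ t (proj x) := fun t x ↦
    (hL 1 t x).trans (by rw [Set.Icc.coe_one, one_mul])
  have hcont : Continuous (fun p : ℝ × N ↦ φN p.1 p.2) :=
    L.continuous.comp (Continuous.prodMk_right 1)
  have hzero : ∀ x, φN 0 x = x := by
    intro x
    have := congrFun (h.isCoveringMap.eq_of_comp_eq (A := unitInterval)
      (g₁ := fun s ↦ L (s, (0, x))) (g₂ := fun _ ↦ x)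
      (L.continuous.comp (Continuous.prodMk_left _)) continuous_const (by
        funext s
        exact (hL s 0 x).trans (by rw [mul_zero, hφ.zero]; rfl)) 0
      (h.isCoveringMap.liftHomotopy_zero H ⟨Prod.snd, continuous_snd⟩ H0 (0, x))) 1
    exact this
  have hadd : ∀ s t x, φN (s + t) x = φN s (φN t x) := by
    intro s t x
    refine congrFun (h.isCoveringMap.eq_of_comp_eq (A := ℝ)
      (g₁ := fun s ↦ φN (s + t) x) (g₂ := fun s ↦ φN s (φN t x)) ?_ ?_ ?_ 0 ?_) s
    · exact hcont.comp (f := fun s : ℝ ↦ (s + t, x)) (by fun_prop)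
    · exact hcont.comp (f := fun s : ℝ ↦ (s, φN t x)) (by fun_prop)
    · funext s
      simp only [Function.comp_apply, hlift, hφ.add]
    · simp only [zero_add, hzero]
  have hsm : ContMDiff (𝓘(ℝ, ℝ).prod (𝓡 d)) (𝓡 d) ∞ (fun p : ℝ × N ↦ φN p.1 p.2) := by
    intro p
    refine (h.isLocalDiffeomorph (φN p.1 p.2)).contMDiffAt_of_comp
      (h := fun p : ℝ × N ↦ φN p.1 p.2) hcont.continuousAt ?_
    simp only [hlift]
    exact (hφ.contMDiff.comp (contMDiff_fst.prodMk
      (h.isLocalDiffeomorph.contMDiff.comp contMDiff_snd))).contMDiffAt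
  refine ⟨φN, ⟨hsm, hzero, hadd, fun x t ↦ ?_⟩, hlift⟩
  have hd : MDifferentiableAt 𝓘(ℝ, ℝ) (𝓡 d) (fun t ↦ φN t x) t :=
    ((hsm.comp (contMDiff_id.prodMk contMDiff_const)).contMDiffAt (x := t)).mdifferentiableAt
      (by simp)
  refine hd.hasMFDerivAt.congr_mfderiv ?_
  have h1 := (h.mdifferentiableAt (φN t x)).hasMFDerivAt.comp t hd.hasMFDerivAt
  have heq : proj ∘ (fun t ↦ φN t x) = fun t ↦ φ t (proj x) := funext fun t ↦ hlift t x
  rw [heq] at h1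
  have h2 := hasMFDerivAt_unique h1 (hφ.isMIntegralCurve (proj x) t)
  have h3 : (mfderiv (𝓡 d) (𝓡 d) proj (φN t x) (mfderiv 𝓘(ℝ, ℝ) (𝓡 d) (fun t ↦ φN t x) t (1 : ℝ)) :
      EuclideanSpace ℝ (Fin d)) = K (φ t (proj x)) :=
    (DFunLike.congr_fun h2 (1 : ℝ)).trans (one_smul ℝ (K (φ t (proj x))))
  have h4 : (K (φ t (proj x)) : EuclideanSpace ℝ (Fin d)) = K (proj (φN t x)) := by
    rw [hlift]
  have h5 : mfderiv (𝓡 d) (𝓡 d) proj (φN t x)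
      (mfderiv 𝓘(ℝ, ℝ) (𝓡 d) (fun t ↦ φN t x) t (1 : ℝ)) =
      mfderiv (𝓡 d) (𝓡 d) proj (φN t x)
        (VectorField.mpullback (𝓡 d) (𝓡 d) proj K (φN t x)) :=
    h3.trans (h4.trans (h.mfderiv_mpullback K (φN t x)).symm)
  -- The lifted velocity projects to K, as the pulled-back field does, and the differential of
  -- `proj` is injective.
  have h6 := (h.isInvertible_mfderiv (φN t x)).injective h5
  ext
  exact h6.trans (one_smul ℝ (VectorField.mpullback (𝓡 d) (𝓡 d) proj K (φN t x))).symm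

theorem LorentzMetric.IsUniversalLorentzianCovering.val_lift_flow
    (h : g.IsUniversalLorentzianCovering gN proj) (hK : g.IsStaticField K)
    (hφ : IsSmoothFlow K φ) {φN : ℝ → N → N}
    (hφN : IsSmoothFlow (VectorField.mpullback (𝓡 d) (𝓡 d) proj K) φN)
    (hlift : ∀ t x, proj (φN t x) = φ t (proj x)) (s : ℝ) (x : N) (v w : TangentSpace (𝓡 d) x) :
    gN.val (φN s x) (mfderiv (𝓡 d) (𝓡 d) (φN s) x v) (mfderiv (𝓡 d) (𝓡 d) (φN s) x w) =
      gN.val x v w := by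
  have hd : ∀ v : TangentSpace (𝓡 d) x,
      (mfderiv (𝓡 d) (𝓡 d) proj (φN s x) (mfderiv (𝓡 d) (𝓡 d) (φN s) x v) :
        EuclideanSpace ℝ (Fin d)) =
      mfderiv (𝓡 d) (𝓡 d) (φ s) (proj x) (mfderiv (𝓡 d) (𝓡 d) proj x v) := by
    intro v
    have h1 := (h.mdifferentiableAt (φN s x)).hasMFDerivAt.comp x
      (hφN.mdifferentiable s x).hasMFDerivAt
    have h2 := (hφ.mdifferentiable s (proj x)).hasMFDerivAt.comp x
      (h.mdifferentiableAt x).hasMFDerivAt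
    have heq : proj ∘ φN s = φ s ∘ proj := funext fun x ↦ hlift s x
    rw [heq] at h1
    exact DFunLike.congr_fun (hasMFDerivAt_unique h1 h2) v
  rw [h.isometry, h.isometry]
  exact (g.val_congr (hlift s x) (hd v) (hd w)).trans
    (hK.killing.val_flow hK.smooth hφ s (proj x) _ _)

end Covering

/-! ### Submersions to the line and their zero sets -/

section Straightening

/-- The splitting v = l(v) k + (v - l(v) k) complements l by coordinates on its kernel, which has
dimension n. -/
theorem exists_continuousLinearEquiv_fst_eq {n : ℕ} (l : EuclideanSpace ℝ (Fin (n + 1)) →L[ℝ] ℝ)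
    {k : EuclideanSpace ℝ (Fin (n + 1))} (hk : l k = 1) :
    ∃ A : EuclideanSpace ℝ (Fin (n + 1)) ≃L[ℝ] ℝ × EuclideanSpace ℝ (Fin n),
      ∀ v, (A v).1 = l v := by
  have hker : Module.finrank ℝ (LinearMap.ker l.toLinearMap) =
      Module.finrank ℝ (EuclideanSpace ℝ (Fin n)) := by
    have h1 := LinearMap.finrank_range_add_finrank_ker l.toLinearMap
    have h2 : LinearMap.range l.toLinearMap = ⊤ :=
      LinearMap.range_eq_top.2 fun a ↦ ⟨a • k, by simp [hk]⟩
    rw [h2, finrank_top, Module.finrank_self, finrank_euclideanSpace_fin] at h1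
    rw [finrank_euclideanSpace_fin]
    omega
  let e := LinearEquiv.ofFinrankEq _ _ hker
  have hmem : ∀ v, v - l v • k ∈ LinearMap.ker l.toLinearMap := fun v ↦ by simp [hk]
  let p : EuclideanSpace ℝ (Fin (n + 1)) →ₗ[ℝ] LinearMap.ker l.toLinearMap :=
    LinearMap.codRestrict _ (LinearMap.id - l.toLinearMap.smulRight k) hmem
  have hp : ∀ v, (p v : EuclideanSpace ℝ (Fin (n + 1))) = v - l v • k := fun v ↦ rfl
  let A : EuclideanSpace ℝ (Fin (n + 1)) ≃ₗ[ℝ] ℝ × EuclideanSpace ℝ (Fin n) :=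
    LinearEquiv.ofLinearMap (l.toLinearMap.prod (e.toLinearMap ∘ₗ p))
      (LinearMap.coprod (LinearMap.toSpanSingleton ℝ _ k)
        ((LinearMap.ker l.toLinearMap).subtype ∘ₗ e.symm.toLinearMap))
      (by
        refine LinearMap.ext fun q ↦ ?_
        have hq : l (e.symm q.2 : EuclideanSpace ℝ (Fin (n + 1))) = 0 := (e.symm q.2).2
        have hpq : p (q.1 • k + (e.symm q.2 : EuclideanSpace ℝ (Fin (n + 1)))) = e.symm q.2 := by
          apply Subtype.ext
          rw [hp, map_add, map_smul, hk, hq]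
          simp
        refine Prod.ext ?_ ?_
        · simp [hk, hq]
        · exact (congrArg e hpq).trans (e.apply_symm_apply q.2))
      (by
        refine LinearMap.ext fun v ↦ ?_
        change l v • k + ((e.symm (e (p v)) : LinearMap.ker l.toLinearMap) :
          EuclideanSpace ℝ (Fin (n + 1))) = v
        rw [e.symm_apply_apply, hp]
        exact add_sub_cancel _ _)
  exact ⟨A.toContinuousLinearEquiv, fun v ↦ rfl⟩

/-- A submersion to the line is, in a suitable chart, the first coordinate. -/
theorem exists_contDiff_straightening {n : ℕ} {U : Set (EuclideanSpace ℝ (Fin (n + 1)))}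
    (hU : IsOpen U) {t : EuclideanSpace ℝ (Fin (n + 1)) → ℝ} (ht : ContDiffOn ℝ ∞ t U)
    {y k : EuclideanSpace ℝ (Fin (n + 1))} (hy : y ∈ U) (hk : fderiv ℝ t y k = 1) :
    ∃ Θ : OpenPartialHomeomorph (EuclideanSpace ℝ (Fin (n + 1)))
        (ℝ × EuclideanSpace ℝ (Fin n)),
      y ∈ Θ.source ∧ Θ.source ⊆ U ∧ (∀ z, (Θ z).1 = t z) ∧
      ContDiffOn ℝ ∞ Θ Θ.source ∧ ContDiffOn ℝ ∞ Θ.symm Θ.target := by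
  obtain ⟨A, hA⟩ := exists_continuousLinearEquiv_fst_eq (fderiv ℝ t y) hk
  let f : EuclideanSpace ℝ (Fin (n + 1)) → ℝ × EuclideanSpace ℝ (Fin n) :=
    fun z ↦ (t z, (A z).2)
  have hf : ContDiffOn ℝ ∞ f U :=
    ht.prodMk (contDiff_snd.comp A.contDiff).contDiffOn
  have hfat : ∀ z ∈ U, ContDiffAt ℝ ∞ f z := fun z hz ↦ hf.contDiffAt (hU.mem_nhds hz)
  have hfA : HasFDerivAt f (A : EuclideanSpace ℝ (Fin (n + 1)) →L[ℝ] _) y := by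
    have h1 := ((ht.contDiffAt (hU.mem_nhds hy)).differentiableAt (by simp)).hasFDerivAt
    have h2 : HasFDerivAt (fun z ↦ (A z).2) ((ContinuousLinearMap.snd ℝ ℝ _).comp
      (A : EuclideanSpace ℝ (Fin (n + 1)) →L[ℝ] _)) y :=
      ((ContinuousLinearMap.snd ℝ ℝ (EuclideanSpace ℝ (Fin n))).comp
        (A : EuclideanSpace ℝ (Fin (n + 1)) →L[ℝ] ℝ × EuclideanSpace ℝ (Fin n))).hasFDerivAt
    refine (h1.prodMk h2).congr_fderiv ?_
    ext v
    · exact (hA v).symm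
    · rfl
  have hinf : (∞ : WithTop ℕ∞) ≠ 0 := by simp
  let Θ := (hfat y hy).toOpenPartialHomeomorph f hfA hinf
  have hΘ : ∀ z, Θ z = f z := fun z ↦ rfl
  have hyΘ : y ∈ Θ.source := (hfat y hy).mem_toOpenPartialHomeomorph_source hfA hinf
  have hcont : ContinuousAt (fderiv ℝ f) y :=
    ((hfat y hy).fderiv_right (m := 0) (by simp)).continuousAt
  -- Invertible maps form an open set, so on a smaller W the differential is invertible at every
  -- point; this makes the inverse smooth on the whole target.
  have hinv : ∀ᶠ z in 𝓝 y, fderiv ℝ f z ∈ range ((↑) :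
      (EuclideanSpace ℝ (Fin (n + 1)) ≃L[ℝ] ℝ × EuclideanSpace ℝ (Fin n)) → _) := by
    refine hcont.eventually (ContinuousLinearEquiv.isOpen.mem_nhds ?_)
    rw [hfA.fderiv]
    exact ⟨A, rfl⟩
  obtain ⟨W, hW, hWo, hyW⟩ := eventually_nhds_iff.1 (hinv.and (hU.mem_nhds hy))
  refine ⟨Θ.restrOpen W hWo, ⟨hyΘ, hyW⟩, fun z hz ↦ (hW z hz.2).2, fun z ↦ rfl, ?_, ?_⟩
  · exact hf.mono fun z hz ↦ (hW z hz.2).2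
  · intro z hz
    have hz' := (Θ.restrOpen W hWo).map_target hz
    obtain ⟨⟨e, he⟩, hzU⟩ := hW _ hz'.2
    refine ((Θ.restrOpen W hWo).contDiffAt_symm (f₀' := e) hz ?_ (hfat _ hzU)).contDiffWithinAt
    rw [he]
    exact ((hfat _ hzU).differentiableAt hinf).hasFDerivAt

variable {n : ℕ} {N : Type v} [TopologicalSpace N]
  [ChartedSpace (EuclideanSpace ℝ (Fin (n + 1))) N] [IsManifold (𝓡 (n + 1)) ∞ N]

theorem ContMDiff.exists_straightening {τ : N → ℝ} (hτ : ContMDiff (𝓡 (n + 1)) 𝓘(ℝ, ℝ) ∞ τ)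
    {x : N} {k : TangentSpace (𝓡 (n + 1)) x} (hk : realDeriv τ x k = 1) :
    ∃ Ψ : OpenPartialHomeomorph N (ℝ × EuclideanSpace ℝ (Fin n)),
      x ∈ Ψ.source ∧ (∀ y ∈ Ψ.source, (Ψ y).1 = τ y) ∧
      ContMDiffOn (𝓡 (n + 1)) 𝓘(ℝ, ℝ × EuclideanSpace ℝ (Fin n)) ∞ Ψ Ψ.source ∧
      ContMDiffOn 𝓘(ℝ, ℝ × EuclideanSpace ℝ (Fin n)) (𝓡 (n + 1)) ∞ Ψ.symm Ψ.target := by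
  have hopen := isOpen_extChartAt_target (I := 𝓡 (n + 1)) x
  have hx := mem_extChartAt_source (I := 𝓡 (n + 1)) x
  have hy := mem_extChartAt_target (I := 𝓡 (n + 1)) x
  let C : PartialDiffeomorph (𝓡 (n + 1)) 𝓘(ℝ, EuclideanSpace ℝ (Fin (n + 1))) N
      (EuclideanSpace ℝ (Fin (n + 1))) ∞ :=
    { toPartialEquiv := extChartAt (𝓡 (n + 1)) x
      open_source := isOpen_extChartAt_source x
      open_target := isOpen_extChartAt_target x
      contMDiffOn_toFun := by
        rw [extChartAt_source]
        exact contMDiffOn_extChartAt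
      contMDiffOn_invFun := contMDiffOn_extChartAt_symm x }
  have ht : ContDiffOn ℝ ∞ (fun z ↦ τ ((extChartAt (𝓡 (n + 1)) x).symm z))
      (extChartAt (𝓡 (n + 1)) x).target := by
    rw [← contMDiffOn_iff_contDiffOn]
    exact hτ.comp_contMDiffOn (contMDiffOn_extChartAt_symm x)
  obtain ⟨Θ, hyΘ, hsub, h1, hΘ, hΘs⟩ := exists_contDiff_straightening hopen ht
    (k := mfderiv (𝓡 (n + 1)) 𝓘(ℝ, EuclideanSpace ℝ (Fin (n + 1)))
      (extChartAt (𝓡 (n + 1)) x) x k) hy (by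
    have hd := ((ht.contDiffAt (hopen.mem_nhds hy)).differentiableAt (by simp)).hasFDerivAt
    have h2 := hd.hasMFDerivAt.comp x
      ((isLocalDiffeomorphAt_extChartAt x hx).mdifferentiableAt (by simp)).hasMFDerivAt
    have h3 := h2.congr_of_eventuallyEq (f₁ := τ) (by
      filter_upwards [extChartAt_source_mem_nhds (I := 𝓡 (n + 1)) x] with z hz
      rw [Function.comp_apply, (extChartAt (𝓡 (n + 1)) x).left_inv hz])
    exact (DFunLike.congr_fun h3.mfderiv k).symm.trans hk)
  refine ⟨C.toOpenPartialHomeomorph.trans Θ, ⟨hx, hyΘ⟩, fun y hy ↦ ?_, ?_, ?_⟩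
  · refine (h1 _).trans (congrArg τ ?_)
    exact (extChartAt (𝓡 (n + 1)) x).left_inv hy.1
  · exact hΘ.contMDiffOn.comp (C.contMDiffOn_toFun.mono fun y hy ↦ hy.1) fun y hy ↦ hy.2
  · exact C.contMDiffOn_invFun.comp (hΘs.contMDiffOn.mono fun y hy ↦ hy.1) fun y hy ↦ hy.2

end Straightening

section LevelSet

variable {n : ℕ} {N : Type v} [TopologicalSpace N]

/-- The chart of the level set `τ = 0` induced by a chart of the ambient space whose first
coordinate is `τ`. -/
def levelSetChart {τ : N → ℝ} (Ψ : OpenPartialHomeomorph N (ℝ × EuclideanSpace ℝ (Fin n)))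
    (hΨ : ∀ y ∈ Ψ.source, (Ψ y).1 = τ y) (x : {x : N // τ x = 0}) :
    OpenPartialHomeomorph {x : N // τ x = 0} (EuclideanSpace ℝ (Fin n)) :=
  have hτ : ∀ z, (0, z) ∈ Ψ.target → τ (Ψ.symm (0, z)) = 0 := fun z hz ↦ by
    rw [← hΨ _ (Ψ.map_target hz), Ψ.right_inv hz]
  have hpair : ∀ s : {x : N // τ x = 0}, s.1 ∈ Ψ.source → (0, (Ψ s).2) = Ψ s := fun s hs ↦
    Prod.ext ((hΨ _ hs).trans s.2).symm rfl
  open Classical in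
  { toFun := fun s ↦ (Ψ s).2
    -- The value x is a default off the target; on the target the condition always holds, by `hτ`.
    invFun := fun z ↦ if h : τ (Ψ.symm (0, z)) = 0 then ⟨Ψ.symm (0, z), h⟩ else x
    source := Subtype.val ⁻¹' Ψ.source
    target := {z | (0, z) ∈ Ψ.target}
    map_source' := fun s hs ↦ by
      change (0, (Ψ s).2) ∈ Ψ.target
      rw [hpair s hs]
      exact Ψ.map_source hs
    map_target' := fun z hz ↦ by
      rw [dif_pos (hτ z hz)]
      exact Ψ.map_target hz
    left_inv' := fun s hs ↦ by
      have h : Ψ.symm (0, (Ψ s).2) = s := by rw [hpair s hs, Ψ.left_inv hs]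
      rw [dif_pos (by rw [h]; exact s.2)]
      exact Subtype.ext h
    right_inv' := fun z hz ↦ by
      rw [dif_pos (hτ z hz)]
      change (Ψ (Ψ.symm (0, z))).2 = z
      rw [Ψ.right_inv hz]
    open_source := Ψ.open_source.preimage continuous_subtype_val
    open_target := Ψ.open_target.preimage (Continuous.prodMk_right 0)
    continuousOn_toFun := continuous_snd.comp_continuousOn
      (Ψ.continuousOn.comp continuous_subtype_val.continuousOn fun _ hs ↦ hs)
    continuousOn_invFun := by
      refine Topology.IsInducing.subtypeVal.continuousOn_iff.2 ?_
      refine (Ψ.symm.continuousOn.comp (Continuous.prodMk_right 0).continuousOn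
        fun _ hz ↦ hz).congr fun z hz ↦ ?_
      rw [Function.comp_apply, dif_pos (hτ z hz)]
      rfl }

theorem levelSetChart_symm {τ : N → ℝ} {Ψ : OpenPartialHomeomorph N (ℝ × EuclideanSpace ℝ (Fin n))}
    (hΨ : ∀ y ∈ Ψ.source, (Ψ y).1 = τ y) (x : {x : N // τ x = 0}) {z : EuclideanSpace ℝ (Fin n)}
    (hz : z ∈ (levelSetChart Ψ hΨ x).target) :
    ((levelSetChart Ψ hΨ x).symm z : N) = Ψ.symm (0, z) := by
  have hτ : τ (Ψ.symm (0, z)) = 0 := by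
    rw [← hΨ _ (Ψ.map_target hz), Ψ.right_inv hz]
  classical
  exact congrArg Subtype.val (dif_pos hτ)

variable [ChartedSpace (EuclideanSpace ℝ (Fin (n + 1))) N] [IsManifold (𝓡 (n + 1)) ∞ N]

/-- Besides the manifold structure, two facts are recorded for later use: the inclusion is an
immersion, so the induced form on the slice is nondegenerate, and maps into the slice are smooth
once they are smooth into N, which gives smoothness of the inverse of the splitting. -/
theorem ContMDiff.exists_levelSet_manifold {τ : N → ℝ}
    (hτ : ContMDiff (𝓡 (n + 1)) 𝓘(ℝ, ℝ) ∞ τ)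
    (hreg : ∀ x, ∃ k : TangentSpace (𝓡 (n + 1)) x, realDeriv τ x k = 1) :
    ∃ (_ : ChartedSpace (EuclideanSpace ℝ (Fin n)) {x : N // τ x = 0})
      (_ : IsManifold (𝓡 n) ∞ {x : N // τ x = 0}),
      ContMDiff (𝓡 n) (𝓡 (n + 1)) ∞ (Subtype.val : {x : N // τ x = 0} → N) ∧
      (∀ x : {x : N // τ x = 0}, Function.Injective
        (mfderiv (𝓡 n) (𝓡 (n + 1)) (Subtype.val : {x : N // τ x = 0} → N) x)) ∧
      ∀ f : N → {x : N // τ x = 0},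
        ContMDiff (𝓡 (n + 1)) (𝓡 (n + 1)) ∞ (fun y ↦ (f y : N)) →
          ContMDiff (𝓡 (n + 1)) (𝓡 n) ∞ f := by
  choose k hk using hreg
  choose Ψ hmem hfst hsm hsms using fun x : N ↦ hτ.exists_straightening (hk x)
  let c : {x : N // τ x = 0} → OpenPartialHomeomorph {x : N // τ x = 0}
      (EuclideanSpace ℝ (Fin n)) := fun x ↦ levelSetChart (Ψ x) (hfst x) x
  let cs : ChartedSpace (EuclideanSpace ℝ (Fin n)) {x : N // τ x = 0} :=
    { atlas := range c
      chartAt := c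
      mem_chart_source := fun x ↦ hmem x
      chart_mem_atlas := fun x ↦ mem_range_self x }
  have hsymm : ∀ (x : {x : N // τ x = 0}) (z : EuclideanSpace ℝ (Fin n)), z ∈ (c x).target →
      ((c x).symm z : N) = (Ψ x).symm (0, z) := fun x z hz ↦ levelSetChart_symm (hfst x) x hz
  have hpair : ContDiff ℝ ∞ (fun z : EuclideanSpace ℝ (Fin n) ↦ ((0 : ℝ), z)) :=
    contDiff_const.prodMk contDiff_id
  have hval : ∀ x : {x : N // τ x = 0}, ContMDiffOn 𝓘(ℝ, EuclideanSpace ℝ (Fin n)) (𝓡 (n + 1)) ∞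
      (fun z ↦ ((c x).symm z : N)) (c x).target := fun x ↦
    ((hsms x).comp hpair.contMDiff.contMDiffOn fun z hz ↦ hz).congr fun z hz ↦ hsymm x z hz
  have hsnd : ∀ x : N, ContMDiffOn (𝓡 (n + 1)) 𝓘(ℝ, EuclideanSpace ℝ (Fin n)) ∞
      (fun y ↦ (Ψ x y).2) (Ψ x).source := fun x ↦
    contDiff_snd.contMDiff.comp_contMDiffOn (hsm x)
  have hman : IsManifold (𝓡 n) ∞ {x : N // τ x = 0} := by
    refine isManifold_of_contDiffOn _ _ _ ?_
    rintro _ _ ⟨x, rfl⟩ ⟨x', rfl⟩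
    have h1 : ContMDiffOn 𝓘(ℝ, EuclideanSpace ℝ (Fin n)) 𝓘(ℝ, EuclideanSpace ℝ (Fin n)) ∞
        (fun z ↦ (Ψ x' ((c x).symm z : N)).2) ((c x).symm ≫ₕ c x').source :=
      (hsnd x').comp ((hval x).mono fun z hz ↦ hz.1) fun z hz ↦ hz.2
    refine (contMDiffOn_iff_contDiffOn.1 h1).mono fun z hz ↦ hz.1
  refine ⟨cs, hman, ?_⟩
  have hcont : ∀ x : {x : N // τ x = 0}, ∀ᶠ s in 𝓝 x, s ∈ (c x).source := fun x ↦
    (c x).open_source.mem_nhds (hmem x)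
  have hι : ContMDiff (𝓡 n) (𝓡 (n + 1)) ∞ (Subtype.val : {x : N // τ x = 0} → N) := by
    intro x
    rw [contMDiffAt_iff_source]
    refine ContMDiffAt.contMDiffWithinAt ?_
    exact (hval x).contMDiffAt ((c x).open_target.mem_nhds ((c x).map_source (hmem x)))
  refine ⟨hι, fun x ↦ ?_, fun f hf y ↦ ?_⟩
  · rw [injective_iff_map_eq_zero]
    intro v hv
    have h1 := ((hsnd x).contMDiffAt ((Ψ x).open_source.mem_nhds (hmem x))).mdifferentiableAt
      (by simp)
    have h2 := (hι x).mdifferentiableAt (by simp)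
    have h3 := DFunLike.congr_fun (h1.hasMFDerivAt.comp x h2.hasMFDerivAt).mfderiv v
    have h4 : mfderiv (𝓡 n) 𝓘(ℝ, EuclideanSpace ℝ (Fin n)) (extChartAt (𝓡 n) x) x v =
        (0 : EuclideanSpace ℝ (Fin n)) := by
      refine Eq.trans h3 ?_
      refine (congrArg (mfderiv (𝓡 (n + 1)) 𝓘(ℝ, EuclideanSpace ℝ (Fin n))
        (fun y ↦ (Ψ x y).2) x) hv).trans (map_zero _)
    exact (isLocalDiffeomorphAt_extChartAt x
      (mem_extChartAt_source (I := 𝓡 n) x)).isInvertible_mfderiv.injective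
      (h4.trans (map_zero (mfderiv (𝓡 n) 𝓘(ℝ, EuclideanSpace ℝ (Fin n))
        (extChartAt (𝓡 n) x) x)).symm)
  · rw [contMDiffAt_iff_target]
    refine ⟨(Topology.IsInducing.subtypeVal.continuous_iff.2 hf.continuous).continuousAt, ?_⟩
    exact ContMDiffAt.comp y (g := fun z ↦ (Ψ (f y) z).2) (f := fun z ↦ (f z : N))
      ((hsnd (f y)).contMDiffAt ((Ψ (f y)).open_source.mem_nhds (hmem (f y)))) hf.contMDiffAt

end LevelSet

/-! ### Positivity on K^⊥ and the induced Riemannian metric -/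

section BilinearForms

theorem contMDiffAt_clm_of_apply {E : Type*} [NormedAddCommGroup E] [NormedSpace ℝ E] {H : Type*}
    [TopologicalSpace H] {I : ModelWithCorners ℝ E H} {P : Type*} [TopologicalSpace P]
    [ChartedSpace H P] {n : ℕ} {G : Type*} [NormedAddCommGroup G] [NormedSpace ℝ G]
    {f : P → EuclideanSpace ℝ (Fin n) →L[ℝ] G} {p : P}
    (h : ∀ v, ContMDiffAt I 𝓘(ℝ, G) ∞ (fun x ↦ f x v) p) :
    ContMDiffAt I 𝓘(ℝ, EuclideanSpace ℝ (Fin n) →L[ℝ] G) ∞ f p := by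
  let T : (Fin n → G) →L[ℝ] (EuclideanSpace ℝ (Fin n) →L[ℝ] G) :=
    ∑ i, (ContinuousLinearMap.smulRightL ℝ (EuclideanSpace ℝ (Fin n)) G
      (EuclideanSpace.proj i)).comp (ContinuousLinearMap.proj i)
  have hT : f = fun x ↦ T fun i ↦ f x (EuclideanSpace.single i 1) := by
    funext x
    ext v
    have hv : v = ∑ i, v i • EuclideanSpace.single i (1 : ℝ) := by
      have := (EuclideanSpace.basisFun (Fin n) ℝ).sum_repr v
      simpa using this.symm
    conv_lhs => rw [hv, map_sum]
    simp [T]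
  rw [hT]
  exact T.contDiff.contMDiff.contMDiffAt.comp p
    (contMDiffAt_pi_space.2 fun i ↦ h (EuclideanSpace.single i 1))

/-- If B(w, w) ≤ 0, then B is nonpositive on the span of k and w. The vector B(v, w) k - B(v, k) w
of that span lies in v^⊥, where B is positive definite, so it must vanish; pairing it with k then
gives a contradiction. -/
theorem pos_of_orthogonal_of_neg {V : Type*} [AddCommGroup V] [Module ℝ V] {B : V →ₗ[ℝ] V →ₗ[ℝ] ℝ}
    (hsymm : ∀ v w, B v w = B w v) {v : V}
    (hpos : ∀ w, B v w = 0 → w ≠ 0 → 0 < B w w) {k w : V} (hk : B k k < 0) (hkw : B k w = 0)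
    (hw : w ≠ 0) : 0 < B w w := by
  by_contra! hcon
  have hb : B v k ≠ 0 := by
    intro hb
    refine absurd (hpos k hb ?_) hk.le.not_gt
    rintro rfl
    simp at hk
  have hu : B v w • k - B v k • w = 0 := by
    by_contra hu
    have h1 := hpos _ (by simp only [map_sub, map_smul, smul_eq_mul]; ring) hu
    simp only [map_sub, map_smul, smul_eq_mul, LinearMap.sub_apply, LinearMap.smul_apply,
      hsymm w k, hkw] at h1
    nlinarith [mul_nonneg (sq_nonneg (B v w)) (neg_nonneg.2 hk.le),
      mul_nonneg (sq_nonneg (B v k)) (neg_nonneg.2 hcon)]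
  have h2 : B k (B v w • k - B v k • w) = 0 := by rw [hu, map_zero]
  simp only [map_sub, map_smul, smul_eq_mul, hkw, mul_zero, sub_zero, mul_eq_zero, hk.ne,
    or_false] at h2
  rw [h2, zero_smul, zero_sub, neg_eq_zero, smul_eq_zero] at hu
  exact hu.elim hb hw

theorem LorentzMetric.pos_of_orthogonal {d : ℕ} {M : Type u} [TopologicalSpace M]
    [ChartedSpace (EuclideanSpace ℝ (Fin d)) M] [IsManifold (𝓡 d) ∞ M] (g : LorentzMetric d M)
    {x : M} {k w : TangentSpace (𝓡 d) x} (hk : g.val x k k < 0) (hkw : g.val x k w = 0)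
    (hw : w ≠ 0) : 0 < g.val x w w := by
  obtain ⟨v, -, hv⟩ := g.signature x
  let B : TangentSpace (𝓡 d) x →ₗ[ℝ] TangentSpace (𝓡 d) x →ₗ[ℝ] ℝ :=
    LinearMap.mk₂ ℝ (fun v w ↦ g.val x v w) (by simp) (by simp) (by simp) (by simp)
  exact pos_of_orthogonal_of_neg (B := B) (g.symm x) hv hk hkw hw

/-- The minimum of B(v, v) on the compact unit sphere gives c‖v‖² ≤ B(v, v) with c > 0. -/
theorem isVonNBounded_of_posDef {n : ℕ}
    (B : EuclideanSpace ℝ (Fin n) →L[ℝ] EuclideanSpace ℝ (Fin n) →L[ℝ] ℝ)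
    (hB : ∀ v, v ≠ 0 → 0 < B v v) :
    Bornology.IsVonNBounded ℝ {v | B v v < 1} := by
  rw [NormedSpace.isVonNBounded_iff]
  obtain ⟨c, hc, hcB⟩ := (isCompact_sphere (0 : EuclideanSpace ℝ (Fin n)) 1).exists_forall_le'
    (f := fun v ↦ B v v) (a := 0) (B.continuous.clm_apply continuous_id).continuousOn (fun v hv ↦ hB v (by
      rintro rfl
      simp at hv))
  refine (Metric.isBounded_closedBall (x := (0 : EuclideanSpace ℝ (Fin n)))
    (r := Real.sqrt (c⁻¹))).subset fun v hv ↦ ?_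
  rw [mem_closedBall_zero_iff]
  by_cases h0 : v = 0
  · simp [h0, Real.sqrt_nonneg]
  have hn : 0 < ‖v‖ := norm_pos_iff.2 h0
  have h1 := hcB (‖v‖⁻¹ • v) (by simp [norm_smul, hn.ne'])
  simp only [map_smul, smul_apply, smul_eq_mul] at h1
  refine Real.le_sqrt_of_sq_le ?_
  rw [le_inv_comm₀ (by positivity) hc]
  have h2 : c * ‖v‖ ^ 2 ≤ B v v := by
    calc c * ‖v‖ ^ 2 ≤ (‖v‖⁻¹ * (‖v‖⁻¹ * B v v)) * ‖v‖ ^ 2 := by gcongr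
      _ = B v v := by field_simp
  have h3 : c * ‖v‖ ^ 2 < 1 := h2.trans_lt hv
  rw [le_inv_comm₀ hc (by positivity), ← one_div, le_div_iff₀ hc]
  linarith

end BilinearForms

section InducedMetric

variable {d n : ℕ} {N : Type u} [TopologicalSpace N]
  [ChartedSpace (EuclideanSpace ℝ (Fin d)) N] [IsManifold (𝓡 d) ∞ N]
  {S : Type v} [TopologicalSpace S] [ChartedSpace (EuclideanSpace ℝ (Fin n)) S]
  [IsManifold (𝓡 n) ∞ S]

/-- The pullback of a Lorentzian metric along a smooth map. -/
def LorentzMetric.pullbackForm (g : LorentzMetric d N) (f : S → N) (x : S) :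
    TangentSpace (𝓡 n) x →L[ℝ] TangentSpace (𝓡 n) x →L[ℝ] ℝ :=
  ContinuousLinearMap.bilinearComp (E := EuclideanSpace ℝ (Fin d))
    (F := EuclideanSpace ℝ (Fin d)) (E' := EuclideanSpace ℝ (Fin n))
    (F' := EuclideanSpace ℝ (Fin n)) (g.val (f x)) (mfderiv (𝓡 n) (𝓡 d) f x)
    (mfderiv (𝓡 n) (𝓡 d) f x)

/-- These fields, constant in a trivialization, are the test vectors for the smoothness of the
pulled-back form. -/
theorem contMDiffAt_trivializationAt_symm (x₀ : S) (v : EuclideanSpace ℝ (Fin n)) :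
    ContMDiffAt (𝓡 n) (𝓡 n).tangent ∞ (fun x ↦ (⟨x, (trivializationAt (EuclideanSpace ℝ (Fin n))
      (TangentSpace (𝓡 n)) x₀).symm x v⟩ : TangentBundle (𝓡 n) S)) x₀ := by
  rw [contMDiffAt_section]
  refine contMDiffAt_const (c := v).congr_of_eventuallyEq ?_
  filter_upwards [(trivializationAt (EuclideanSpace ℝ (Fin n))
      (TangentSpace (𝓡 n)) x₀).open_baseSet.mem_nhds
    (mem_baseSet_trivializationAt (EuclideanSpace ℝ (Fin n)) (TangentSpace (𝓡 n)) x₀)] with x hx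
  rw [Trivialization.apply_mk_symm _ hx]

theorem LorentzMetric.contMDiff_pullbackForm (g : LorentzMetric d N) {f : S → N}
    (hf : ContMDiff (𝓡 n) (𝓡 d) ∞ f) :
    ContMDiff (𝓡 n)
      ((𝓡 n).prod 𝓘(ℝ, EuclideanSpace ℝ (Fin n) →L[ℝ] EuclideanSpace ℝ (Fin n) →L[ℝ] ℝ)) ∞
      (fun x : S ↦ TotalSpace.mk'
        (EuclideanSpace ℝ (Fin n) →L[ℝ] EuclideanSpace ℝ (Fin n) →L[ℝ] ℝ)
        (E := fun x : S ↦ TangentSpace (𝓡 n) x →L[ℝ] TangentSpace (𝓡 n) x →L[ℝ] ℝ)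
        x (g.pullbackForm f x)) := by
  intro x₀
  rw [contMDiffAt_hom_bundle]
  refine ⟨contMDiffAt_id, contMDiffAt_clm_of_apply fun v ↦ contMDiffAt_clm_of_apply fun w ↦ ?_⟩
  have h := g.contMDiffAt_pullback
    (hf.contMDiffAt.mfderiv_vectorField (contMDiffAt_trivializationAt_symm x₀ v))
    (hf.contMDiffAt.mfderiv_vectorField (contMDiffAt_trivializationAt_symm x₀ w))
  refine h.congr_of_eventuallyEq ?_
  filter_upwards [(trivializationAt (EuclideanSpace ℝ (Fin n))
      (TangentSpace (𝓡 n)) x₀).open_baseSet.mem_nhds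
    (mem_baseSet_trivializationAt (EuclideanSpace ℝ (Fin n)) (TangentSpace (𝓡 n)) x₀)] with x hx
  refine (inCoordinates_apply_eq₂ (E₃ := fun _ : S ↦ ℝ) hx hx (mem_univ _)).trans ?_
  simp only [Trivial.fiberBundle_trivializationAt', Trivial.linearMapAt_trivialization,
    LinearMap.id_coe, id_eq]
  rfl

theorem LorentzMetric.exists_induced_metric (g : LorentzMetric d N) {f : S → N}
    (hf : ContMDiff (𝓡 n) (𝓡 d) ∞ f)
    (hpos : ∀ (x : S) (v : TangentSpace (𝓡 n) x), v ≠ 0 →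
      0 < g.val (f x) (mfderiv (𝓡 n) (𝓡 d) f x v) (mfderiv (𝓡 n) (𝓡 d) f x v)) :
    ∃ gS : ContMDiffRiemannianMetric (𝓡 n) ∞ (EuclideanSpace ℝ (Fin n))
      (fun x : S ↦ TangentSpace (𝓡 n) x), ∀ (x : S) (v w : TangentSpace (𝓡 n) x),
      gS.inner x v w = g.val (f x) (mfderiv (𝓡 n) (𝓡 d) f x v) (mfderiv (𝓡 n) (𝓡 d) f x w) :=
  ⟨{ inner := g.pullbackForm f
     symm := fun _ _ _ ↦ g.symm _ _ _
     pos := hpos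
     isVonNBounded := fun x ↦ isVonNBounded_of_posDef (g.pullbackForm f x) (hpos x)
     contMDiff := g.contMDiff_pullbackForm hf }, fun _ _ _ ↦ rfl⟩

end InducedMetric

/-! ### The splitting ℝ × {τ = 0} -/

section StandardStatic

variable {n : ℕ} {N : Type u} [TopologicalSpace N]
  [ChartedSpace (EuclideanSpace ℝ (Fin (n + 1))) N]

theorem IsSmoothFlow.apply_primitive {K : Π x : N, TangentSpace (𝓡 (n + 1)) x} {τ : N → ℝ}
    (hτ : ContMDiff (𝓡 (n + 1)) 𝓘(ℝ, ℝ) ∞ τ) (hτK : ∀ x, realDeriv τ x (K x) = 1)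
    {φ : ℝ → N → N} (hφ : IsSmoothFlow K φ) (t : ℝ) (x : N) : τ (φ t x) = τ x + t := by
  have hd : ∀ t, HasDerivAt (fun t ↦ τ (φ t x) - t) 0 t := by
    intro t
    have h1 := hasDerivAt_comp_realDeriv (γ := fun t ↦ φ t x) (t := t) (v := K (φ t x))
      (hτ.contMDiffAt.mdifferentiableAt (by simp)) (hφ.isMIntegralCurve x t)
    rw [hτK] at h1
    exact (h1.sub (hasDerivAt_id t)).congr_deriv (sub_self 1)
  have := is_const_of_deriv_eq_zero (fun t ↦ (hd t).differentiableAt) (fun t ↦ (hd t).deriv) t 0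
  simp only [hφ.zero] at this
  linarith

variable [T2Space N] [SecondCountableTopology N] [IsManifold (𝓡 (n + 1)) ∞ N]

/-- The differential of (t, x) ↦ φ_t x sends (a, v) to dφ_t (a K + v). As φ_t is an isometry, the
metric may be computed on the slice, where v is orthogonal to K and no mixed terms appear. -/
theorem LorentzMetric.isStandardStatic_of_flow (g : LorentzMetric (n + 1) N)
    {K : Π x : N, TangentSpace (𝓡 (n + 1)) x}
    (hK : ContMDiff (𝓡 (n + 1)) (𝓡 (n + 1)).tangent ∞
      (fun x ↦ (⟨x, K x⟩ : TangentBundle (𝓡 (n + 1)) N)))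
    (htime : ∀ x, g.val x (K x) (K x) < 0) {τ : N → ℝ}
    (hτ : ContMDiff (𝓡 (n + 1)) 𝓘(ℝ, ℝ) ∞ τ)
    (hdτ : ∀ (x : N) (v : TangentSpace (𝓡 (n + 1)) x),
      g.val x (K x) (K x) * realDeriv τ x v = g.val x (K x) v)
    {φ : ℝ → N → N} (hφ : IsSmoothFlow K φ)
    (hiso : ∀ (s : ℝ) (x : N) (v w : TangentSpace (𝓡 (n + 1)) x),
      g.val (φ s x) (mfderiv (𝓡 (n + 1)) (𝓡 (n + 1)) (φ s) x v)
        (mfderiv (𝓡 (n + 1)) (𝓡 (n + 1)) (φ s) x w) = g.val x v w) :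
    g.IsStandardStatic := by
  have hτK : ∀ x, realDeriv τ x (K x) = 1 := fun x ↦
    mul_left_cancel₀ (htime x).ne (by rw [hdτ, mul_one])
  have hflow := hφ.apply_primitive hτ hτK
  obtain ⟨cs, hman, hι, hinj, huniv⟩ := hτ.exists_levelSet_manifold fun x ↦ ⟨K x, hτK x⟩
  have hd : ∀ x : {x : N // τ x = 0}, MDifferentiableAt (𝓡 n) (𝓡 (n + 1))
      (Subtype.val : {x : N // τ x = 0} → N) x := fun x ↦ (hι x).mdifferentiableAt (by simp)
  have hτι : ∀ (x : {x : N // τ x = 0}) (v : TangentSpace (𝓡 n) x),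
      realDeriv τ x (mfderiv (𝓡 n) (𝓡 (n + 1)) Subtype.val x v) = 0 := by
    intro x v
    have h1 := ((hτ (x : N)).mdifferentiableAt (by simp)).hasMFDerivAt.comp x (hd x).hasMFDerivAt
    have h2 : HasMFDerivAt (𝓡 n) 𝓘(ℝ, ℝ) (τ ∘ (Subtype.val : {x : N // τ x = 0} → N)) x
        (0 : EuclideanSpace ℝ (Fin n) →L[ℝ] ℝ) := by
      have : (τ ∘ (Subtype.val : {x : N // τ x = 0} → N)) = fun _ ↦ 0 := funext fun x ↦ x.2
      rw [this]
      exact hasMFDerivAt_const 0 x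
    exact DFunLike.congr_fun (hasMFDerivAt_unique h1 h2) v
  have horth : ∀ (x : {x : N // τ x = 0}) (v : TangentSpace (𝓡 n) x),
      g.val x (K x) (mfderiv (𝓡 n) (𝓡 (n + 1)) Subtype.val x v) = 0 := by
    intro x v
    rw [← hdτ, hτι, mul_zero]
  obtain ⟨gS, hgS⟩ := g.exists_induced_metric hι (fun x v hv ↦
    g.pos_of_orthogonal (htime x) (horth x v) fun h0 ↦
      hv (hinj x (h0.trans (map_zero _).symm)))
  -- Since τ(φ_t x) = τ(x) + t, the time coordinate of y is τ(y), and flowing back by it lands in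
  -- the slice.
  let Φ : Diffeomorph (𝓘(ℝ, ℝ).prod (𝓡 n)) (𝓡 (n + 1)) (ℝ × {x : N // τ x = 0}) N ∞ :=
    { toFun := fun p ↦ φ p.1 p.2
      invFun := fun y ↦ (τ y, ⟨φ (-τ y) y, by rw [hflow]; ring⟩)
      left_inv := fun p ↦ by
        have h1 : τ (φ p.1 p.2) = p.1 := by rw [hflow, p.2.2, zero_add]
        refine Prod.ext h1 (Subtype.ext ?_)
        change φ (-τ (φ p.1 p.2)) (φ p.1 p.2) = p.2
        rw [h1, ← hφ.add, neg_add_cancel, hφ.zero]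
      right_inv := fun y ↦ by
        change φ (τ y) (φ (-τ y) y) = y
        rw [← hφ.add, add_neg_cancel, hφ.zero]
      contMDiff_toFun := hφ.contMDiff.comp (contMDiff_fst.prodMk (hι.comp contMDiff_snd))
      contMDiff_invFun := hτ.prodMk (huniv _ (hφ.contMDiff.comp (hτ.neg.prodMk contMDiff_id))) }
  have hΦ : ∀ (t : ℝ) (x : {x : N // τ x = 0}) (a : ℝ) (v : TangentSpace (𝓡 n) x),
      (mfderiv (𝓘(ℝ, ℝ).prod (𝓡 n)) (𝓡 (n + 1)) Φ (t, x) ((a, v) : ℝ × TangentSpace (𝓡 n) x) :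
        EuclideanSpace ℝ (Fin (n + 1))) =
      mfderiv (𝓡 (n + 1)) (𝓡 (n + 1)) (φ t) x
        (a • K x + mfderiv (𝓡 n) (𝓡 (n + 1)) Subtype.val x v) := by
    intro t x a v
    have h1 := mfderiv_prod_eq_add_apply (I := 𝓘(ℝ, ℝ)) (I' := 𝓡 n) (I'' := 𝓡 (n + 1))
      (v := (show TangentSpace (𝓘(ℝ, ℝ).prod (𝓡 n)) (t, x) from
        ((a, v) : ℝ × TangentSpace (𝓡 n) x)))
      (Φ.contMDiff_toFun.contMDiffAt.mdifferentiableAt (by simp) :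
        MDifferentiableAt (𝓘(ℝ, ℝ).prod (𝓡 n)) (𝓡 (n + 1)) Φ (t, x))
    have h2 : (mfderiv 𝓘(ℝ, ℝ) (𝓡 (n + 1)) (fun s ↦ Φ (s, x)) t a :
        EuclideanSpace ℝ (Fin (n + 1))) = a • K (φ t x) :=
      DFunLike.congr_fun (hφ.isMIntegralCurve x t).mfderiv a
    have h3 : (mfderiv (𝓡 n) (𝓡 (n + 1)) (fun z ↦ Φ (t, z)) x v :
        EuclideanSpace ℝ (Fin (n + 1))) = mfderiv (𝓡 (n + 1)) (𝓡 (n + 1)) (φ t) x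
        (mfderiv (𝓡 n) (𝓡 (n + 1)) Subtype.val x v) :=
      DFunLike.congr_fun (mfderiv_comp x (hφ.mdifferentiable t _) (hd x)) v
    refine h1.trans ((congrArg₂ (· + ·) h2 h3).trans ?_)
    rw [map_add, map_smul, hφ.mfderiv_field]
  refine ⟨{x : N // τ x = 0}, inferInstance, inferInstance,
    TopologicalSpace.Subtype.secondCountableTopology {x | τ x = 0}, cs, hman, gS,
    fun x ↦ -g.val x (K x) (K x), Φ, ?_, fun x ↦ neg_pos.2 (htime x), ?_⟩
  · refine ContMDiff.neg fun x ↦ ?_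
    exact g.contMDiffAt_pullback ((hK.comp hι) x) ((hK.comp hι) x)
  · intro t x a b v w
    refine (g.val_congr rfl (hΦ t x a v) (hΦ t x b w)).trans ((hiso t x _ _).trans ?_)
    rw [hgS]
    simp only [map_add, map_smul, add_apply, smul_apply, smul_eq_mul, horth, g.symm x _ (K x)]
    ring

end StandardStatic

/-! ### Convergence of curves in a compact manifold and in a covering -/

section Convergence

/-- Over an evenly covered neighbourhood of m the sheet is a continuous discrete coordinate, hence
constant on a preconnected set of the filter; the limit lies on that sheet. -/
theorem IsCoveringMap.exists_tendsto_of_tendsto_comp {N M ι : Type*} [TopologicalSpace N]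
    [TopologicalSpace M] [TopologicalSpace ι] {p : N → M} (hp : IsCoveringMap p)
    (hsurj : Function.Surjective p) {l : Filter ι} [l.NeBot]
    (hl : ∀ s ∈ l, ∃ T ∈ l, T ⊆ s ∧ IsPreconnected T) {c : ι → N} (hc : Continuous c) {m : M}
    (hm : Tendsto (fun t ↦ p (c t)) l (𝓝 m)) : ∃ x, Tendsto c l (𝓝 x) := by
  have hne : Nonempty (p ⁻¹' {m}) := by
    obtain ⟨x, hx⟩ := hsurj m
    exact ⟨⟨x, hx⟩⟩
  have hdisc : DiscreteTopology (p ⁻¹' {m}) := (hp m).1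
  let e := (hp m).toTrivialization
  have hme : m ∈ e.baseSet := (hp m).mem_toTrivialization_baseSet
  obtain ⟨T, hT, hTs, hTc⟩ := hl _ (hm.eventually (e.open_baseSet.mem_nhds hme))
  obtain ⟨t₀, ht₀⟩ := Filter.nonempty_of_mem hT
  have hsrc : ∀ t ∈ T, c t ∈ e.source := fun t ht ↦ e.mem_source.2 (hTs ht)
  have hcont : ContinuousOn (fun t ↦ (e (c t)).2) T :=
    continuous_snd.comp_continuousOn (e.toOpenPartialHomeomorph.continuousOn.comp hc.continuousOn hsrc)
  have hconst : ∀ t ∈ T, (e (c t)).2 = (e (c t₀)).2 := fun t ht ↦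
    hTc.constant hcont ht ht₀
  have hev : ∀ᶠ t in l, c t = e.toOpenPartialHomeomorph.symm (p (c t), (e (c t₀)).2) := by
    filter_upwards [hT] with t ht
    rw [← hconst t ht, e.symm_apply_mk_proj (hsrc t ht)]
  refine ⟨e.toOpenPartialHomeomorph.symm (m, (e (c t₀)).2), ?_⟩
  refine Tendsto.congr' (hev.mono fun _ h ↦ h.symm) ?_
  have htgt : (m, (e (c t₀)).2) ∈ e.target := e.mem_target.2 hme
  exact (e.toOpenPartialHomeomorph.continuousAt_symm htgt).tendsto.comp
    (hm.prodMk_nhds tendsto_const_nhds)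

/-- Compactness provides a cluster point. A second one would be separated from it by a smooth F,
which cannot be since F ∘ c has a limit. -/
theorem exists_tendsto_of_forall_contMDiff {d : ℕ} {M : Type u} [TopologicalSpace M] [T2Space M]
    [CompactSpace M] [ChartedSpace (EuclideanSpace ℝ (Fin d)) M] [IsManifold (𝓡 d) ∞ M]
    {ι : Type*} {l : Filter ι} [l.NeBot] {c : ι → M}
    (h : ∀ F : M → ℝ, ContMDiff (𝓡 d) 𝓘(ℝ, ℝ) ∞ F → ∃ y, Tendsto (fun t ↦ F (c t)) l (𝓝 y)) :
    ∃ m, Tendsto c l (𝓝 m) := by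
  obtain ⟨m, hm⟩ := exists_clusterPt_of_compactSpace (map c l)
  refine ⟨m, le_nhds_of_unique_clusterPt fun m' hm' ↦ ?_⟩
  by_contra hne
  obtain ⟨F, hF0, hF1, -⟩ := exists_contMDiffMap_zero_one_of_isClosed (n := ⊤) (𝓡 d)
    (isClosed_singleton (x := m)) (isClosed_singleton (x := m'))
    (by rw [Set.disjoint_singleton]; exact fun h ↦ hne h.symm)
  obtain ⟨y, hy⟩ := h F F.contMDiff
  have hlim : ∀ z, ClusterPt z (map c l) → F z = y := by
    intro z hz
    have h1 : ClusterPt (F z) (map F (map c l)) := hz.map F.contMDiff.continuous.continuousAt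
      tendsto_map
    have h2 : map F (map c l) ≤ 𝓝 y := by rw [map_map]; exact hy
    exact eq_of_nhds_neBot (h1.mono h2)
  have h0 : F m = 0 := hF0 rfl
  have h1 : F m' = 1 := hF1 rfl
  rw [hlim m hm] at h0
  rw [hlim m' hm', h0] at h1
  exact zero_ne_one h1

theorem exists_tendsto_of_abs_sub_le {ι : Type*} {l : Filter ι} [l.NeBot] {f τ : ι → ℝ} {C L : ℝ}
    (hτ : Tendsto τ l (𝓝 L)) (h : ∀ a b, |f a - f b| ≤ C * |τ a - τ b|) :
    ∃ y, Tendsto f l (𝓝 y) := by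
  refine cauchy_map_iff_exists_tendsto.1 (cauchy_map_iff.2 ⟨inferInstance, ?_⟩)
  have h1 := (cauchy_map_iff.1 hτ.cauchy_map).2
  rw [tendsto_uniformity_iff_dist_tendsto_zero] at h1 ⊢
  have h2 := h1.const_mul C
  rw [mul_zero] at h2
  exact squeeze_zero (fun _ ↦ dist_nonneg) (fun p ↦ h p.1 p.2) h2

end Convergence

/-! ### Uniform bounds on the causal cone -/

section Cone

variable {d : ℕ} {M : Type u} [TopologicalSpace M]
  [ChartedSpace (EuclideanSpace ℝ (Fin d)) M] [IsManifold (𝓡 d) ∞ M]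
  {g : LorentzMetric d M} {K : Π x : M, TangentSpace (𝓡 d) x}

/-- Both sides are homogeneous of degree one in u, so unit causal vectors suffice. These form a
compact set, on which |G(k, u)| has a lower bound c > 0 and the left side an upper bound C. -/
theorem exists_bound_on_cone {E : Type*} [NormedAddCommGroup E] [NormedSpace ℝ E]
    [FiniteDimensional ℝ E] {s : Set E} (hs : IsCompact s) {G : E → E →L[ℝ] E →L[ℝ] ℝ} {k : E → E}
    {D : E → E →L[ℝ] ℝ} (hG : ContinuousOn G s) (hk : ContinuousOn k s) (hD : ContinuousOn D s)
    (hne : ∀ z ∈ s, ∀ u, u ≠ 0 → G z u u ≤ 0 → G z (k z) u ≠ 0) :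
    ∃ C, ∀ z ∈ s, ∀ u, G z u u ≤ 0 → |D z u| * |G z (k z) (k z)| ≤ C * |G z (k z) u| := by
  have hfst : ContinuousOn (Prod.fst : E × E → E) (s ×ˢ Metric.sphere 0 1) :=
    continuous_fst.continuousOn
  have hmaps : MapsTo (Prod.fst : E × E → E) (s ×ˢ Metric.sphere 0 1) s := fun p hp ↦ hp.1
  have hsnd : ContinuousOn (Prod.snd : E × E → E) (s ×ˢ Metric.sphere 0 1) :=
    continuous_snd.continuousOn
  have hG' : ContinuousOn (fun p : E × E ↦ G p.1) (s ×ˢ Metric.sphere 0 1) :=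
    hG.comp hfst hmaps
  have hk' : ContinuousOn (fun p : E × E ↦ k p.1) (s ×ˢ Metric.sphere 0 1) :=
    hk.comp hfst hmaps
  have hGuu : ContinuousOn (fun p : E × E ↦ G p.1 p.2 p.2) (s ×ˢ Metric.sphere 0 1) :=
    (hG'.clm_apply hsnd).clm_apply hsnd
  have hQ : IsCompact ((s ×ˢ Metric.sphere 0 1) ∩ (fun p : E × E ↦ G p.1 p.2 p.2) ⁻¹' Iic 0) := by
    obtain ⟨t, ht, hteq⟩ := continuousOn_iff_isClosed.1 hGuu (Iic 0) isClosed_Iic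
    rw [inter_comm, hteq, inter_comm]
    exact (hs.prod (isCompact_sphere 0 1)).inter_right ht
  obtain ⟨c, hc, hcb⟩ := hQ.exists_forall_le' (f := fun p : E × E ↦ |G p.1 (k p.1) p.2|) (a := 0)
    ((((hG'.clm_apply hk').clm_apply hsnd).abs).mono inter_subset_left) (fun p hp ↦ abs_pos.2
      (hne p.1 hp.1.1 p.2 (by
        intro h0
        have := hp.1.2
        rw [h0] at this
        simp at this) hp.2))
  obtain ⟨C, hC⟩ := hQ.exists_bound_of_continuousOn
    (f := fun p : E × E ↦ |D p.1 p.2| * |G p.1 (k p.1) (k p.1)|)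
    (((((hD.comp hfst hmaps).clm_apply hsnd).abs).mul
      ((hG'.clm_apply hk').clm_apply hk').abs).mono inter_subset_left)
  refine ⟨C / c, fun z hz u hu ↦ ?_⟩
  by_cases h0 : u = 0
  · simp [h0]
  have hn : 0 < ‖u‖ := norm_pos_iff.2 h0
  have hmem : (z, ‖u‖⁻¹ • u) ∈ (s ×ˢ Metric.sphere 0 1) ∩
      (fun p : E × E ↦ G p.1 p.2 p.2) ⁻¹' Iic 0 := by
    refine ⟨⟨hz, by simp [norm_smul, hn.ne']⟩, ?_⟩
    change G z (‖u‖⁻¹ • u) (‖u‖⁻¹ • u) ≤ 0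
    simp only [map_smul, smul_apply, smul_eq_mul]
    have : 0 ≤ ‖u‖⁻¹ := by positivity
    exact mul_nonpos_of_nonneg_of_nonpos this (mul_nonpos_of_nonneg_of_nonpos this hu)
  have h1 := hcb _ hmem
  have h2 := (Real.le_norm_self _).trans (hC _ hmem)
  have hC0 : 0 ≤ C := (norm_nonneg _).trans (hC _ hmem)
  simp only [map_smul, smul_eq_mul, abs_mul, abs_inv, abs_norm] at h1 h2
  rw [inv_mul_eq_div, le_div_iff₀ hn] at h1
  rw [inv_mul_eq_div, div_mul_eq_mul_div, div_le_iff₀ hn] at h2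
  calc |D z u| * |G z (k z) (k z)| ≤ C * ‖u‖ := h2
    _ = C / c * (c * ‖u‖) := by field_simp
    _ ≤ C / c * |G z (k z) u| := by gcongr

theorem LorentzMetric.IsStaticField.exists_local_bound (hK : g.IsStaticField K) {F : M → ℝ}
    (hF : ContMDiff (𝓡 d) 𝓘(ℝ, ℝ) ∞ F) (m : M) :
    ∃ C, ∀ᶠ x in 𝓝 m, ∀ v : TangentSpace (𝓡 d) x, g.val x v v ≤ 0 →
      |realDeriv F x v| * |g.val x (K x) (K x)| ≤ C * |g.val x (K x) v| := by
  have hopen := isOpen_extChartAt_target (I := 𝓡 d) m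
  have hy := mem_extChartAt_target (I := 𝓡 d) m
  set y := extChartAt (𝓡 d) m m
  obtain ⟨r, hr, hball⟩ := Metric.nhds_basis_closedBall.mem_iff.1 (hopen.mem_nhds hy)
  let f : EuclideanSpace ℝ (Fin d) → ℝ := fun z ↦ F ((extChartAt (𝓡 d) m).symm z)
  have hf : ContDiffOn ℝ ∞ f (extChartAt (𝓡 d) m).target := by
    rw [← contMDiffOn_iff_contDiffOn]
    exact hF.comp_contMDiffOn (contMDiffOn_extChartAt_symm m)
  have hfd : ContinuousOn (fderiv ℝ f) (extChartAt (𝓡 d) m).target :=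
    hf.continuousOn_fderiv_of_isOpen hopen (by simp)
  obtain ⟨C, hC⟩ := exists_bound_on_cone (isCompact_closedBall y r)
    ((g.contDiffOn_chartMetric m).continuousOn.mono hball)
    ((contDiffOn_chartField hK.smooth).continuousOn.mono hball) (hfd.mono hball) (by
      intro z hz u hu huu h0
      have hinv := (isLocalDiffeomorphAt_extChartAt_symm m (hball hz)).isInvertible_mfderiv
      rw [g.chartMetric_apply, mfderiv_symm_chartField K m (hball hz)] at h0
      refine (g.pos_of_orthogonal (hK.timelike _) h0 fun h ↦ hu ?_).not_ge huu
      exact hinv.injective (h.trans (map_zero _).symm))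
  refine ⟨C, ?_⟩
  filter_upwards [extChartAt_source_mem_nhds (I := 𝓡 d) m,
    (continuousAt_extChartAt (I := 𝓡 d) m).eventually (Metric.closedBall_mem_nhds y hr)]
    with x hx hxb v hv
  have h1 := hC _ hxb (mfderiv (𝓡 d) 𝓘(ℝ, EuclideanSpace ℝ (Fin d)) (extChartAt (𝓡 d) m) x v)
    (by rw [g.chartMetric_mfderiv hx]; exact hv)
  have hd := ((hf.contDiffAt (hopen.mem_nhds (hball hxb))).differentiableAt (by simp)).hasFDerivAt
  have h2 := hd.hasMFDerivAt.comp x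
    ((isLocalDiffeomorphAt_extChartAt m hx).mdifferentiableAt (by simp)).hasMFDerivAt
  have h3 := h2.congr_of_eventuallyEq (f₁ := F) (by
    filter_upwards [(isOpen_extChartAt_source (I := 𝓡 d) m).mem_nhds hx] with z hz
    simp only [f, Function.comp_apply, (extChartAt (𝓡 d) m).left_inv hz])
  have h4 : realDeriv F x v = fderiv ℝ f (extChartAt (𝓡 d) m x)
      (mfderiv (𝓡 d) 𝓘(ℝ, EuclideanSpace ℝ (Fin d)) (extChartAt (𝓡 d) m) x v) :=
    DFunLike.congr_fun h3.mfderiv v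
  rw [h4]
  rw [chartField_extChartAt K hx, g.chartMetric_mfderiv hx, g.chartMetric_mfderiv hx] at h1
  exact h1

/-- This is |dF(v)| ≤ C |θ(v)| for causal v, cleared of the denominator g(K, K). Compactness of M
makes the constant global; on the covering it controls the projected curve by the variation of τ. -/
theorem LorentzMetric.IsStaticField.exists_bound [CompactSpace M] (hK : g.IsStaticField K)
    {F : M → ℝ} (hF : ContMDiff (𝓡 d) 𝓘(ℝ, ℝ) ∞ F) :
    ∃ C, ∀ (x : M) (v : TangentSpace (𝓡 d) x), g.val x v v ≤ 0 →
      |realDeriv F x v| * |g.val x (K x) (K x)| ≤ C * |g.val x (K x) v| := by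
  choose C hC using hK.exists_local_bound hF
  obtain ⟨t, ht⟩ := CompactSpace.elim_nhds_subcover _ hC
  obtain ⟨S, hS⟩ := (t.image C).exists_le
  refine ⟨S, fun x v hv ↦ ?_⟩
  have hx : x ∈ (⊤ : Set M) := trivial
  rw [← ht] at hx
  simp only [mem_iUnion] at hx
  obtain ⟨m, hm, hx⟩ := hx
  exact (hx v hv).trans (mul_le_mul_of_nonneg_right (hS _ (Finset.mem_image_of_mem _ hm))
    (abs_nonneg _))

end Cone

/-! ### One-sided velocities and monotonicity along causal curves -/

section CausalCurves

variable {d : ℕ} {N : Type v} [TopologicalSpace N] [ChartedSpace (EuclideanSpace ℝ (Fin d)) N]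

/-- Only finitely many break points lie in [t, t'], so some interval to the right of t contains
none. Right derivatives thus exist also at break points, and estimates based on them need no
subdivision of the curve. -/
theorem IsPiecewiseSmoothCurve.exists_right_velocity {P : Π x : N, TangentSpace (𝓡 d) x → Prop}
    {J : Set ℝ} {γ : ℝ → N} (hγ : IsPiecewiseSmoothCurve P J γ) {t t' : ℝ} (ht : t ∈ J)
    (ht' : t' ∈ J) (htt' : t < t') :
    ∃ v : TangentSpace (𝓡 d) (γ t), P (γ t) v ∧ ∀ F : N → ℝ,
      MDifferentiableAt (𝓡 d) 𝓘(ℝ, ℝ) F (γ t) →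
        HasDerivWithinAt (fun s ↦ F (γ s)) (realDeriv F (γ t) v) (Ici t) t := by
  obtain ⟨B, hB, hpieces⟩ := hγ.pieces
  have hnhds : ((B ∩ Icc t t') \ {t})ᶜ ∈ 𝓝[>] t := by
    refine mem_nhdsWithin_of_mem_nhds ?_
    exact ((hB t ht t' ht').subset sdiff_subset).isClosed.isOpen_compl.mem_nhds (by simp)
  obtain ⟨e, he, hsub⟩ := (mem_nhdsGT_iff_exists_Ioo_subset' htt').1 hnhds
  have hlt : t < min e t' := lt_min he htt'
  have hdisj : Disjoint B (Ioo t (min e t')) := by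
    rw [Set.disjoint_left]
    intro s hs hs'
    exact hsub ⟨hs'.1, hs'.2.trans_le (min_le_left _ _)⟩
      ⟨⟨hs, hs'.1.le, hs'.2.le.trans (min_le_right _ _)⟩, hs'.1.ne'⟩
  obtain ⟨h1, h2⟩ := hpieces t ht _ (hγ.ordConnected.out ht ht' ⟨hlt.le, min_le_right _ _⟩) hlt hdisj
  have hmem : t ∈ Icc t (min e t') := left_mem_Icc.2 hlt.le
  refine ⟨_, h2 t hmem, fun F hF ↦ ?_⟩
  have h3 := ((h1 t hmem).mdifferentiableWithinAt (by simp)).hasMFDerivWithinAt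
  have h4 : HasDerivWithinAt (fun s ↦ F (γ s)) _ (Icc t (min e t')) t :=
    HasFDerivWithinAt.hasDerivWithinAt (F := ℝ)
      (hF.hasMFDerivAt.comp_hasMFDerivWithinAt t h3).hasFDerivWithinAt
  exact h4.mono_of_mem_nhdsWithin (Icc_mem_nhdsGE hlt)

theorem abs_sub_le_sub_of_right_deriv {J : Set ℝ} (hJ : J.OrdConnected) {f τ : ℝ → ℝ}
    (hf : ContinuousOn f J) (hτ : ContinuousOn τ J) {C : ℝ}
    (h : ∀ t ∈ J, ∀ t' ∈ J, t < t' → ∃ a b, HasDerivWithinAt f a (Ici t) t ∧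
      HasDerivWithinAt τ b (Ici t) t ∧ |a| ≤ C * b) {s t : ℝ} (hs : s ∈ J) (ht : t ∈ J)
    (hst : s ≤ t) : |f t - f s| ≤ C * (τ t - τ s) := by
  have hsub : Icc s t ⊆ J := hJ.out hs ht
  choose! a b ha hb hab using fun r (hr : r ∈ Ico s t) ↦
    h r (hsub ⟨hr.1, hr.2.le⟩) t ht hr.2
  exact image_norm_le_of_norm_deriv_right_le_deriv_boundary' (f := fun r ↦ f r - f s) (f' := a)
    (B := fun r ↦ C * (τ r - τ s)) (B' := fun r ↦ C * b r)
    ((hf.mono hsub).sub continuousOn_const) (fun r hr ↦ (ha r hr).sub_const _) (by simp)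
    (((hτ.mono hsub).sub continuousOn_const).const_mul C)
    (fun r hr ↦ ((hb r hr).sub_const _).const_mul C) hab (right_mem_Icc.2 hst)

/-- The previous estimate with f = 0 gives monotonicity. Equal values at s < t would make τ constant
between them, with right derivative 0 at s. -/
theorem strictMonoOn_of_right_deriv_pos {J : Set ℝ} (hJ : J.OrdConnected) {τ : ℝ → ℝ}
    (hτ : ContinuousOn τ J)
    (h : ∀ t ∈ J, ∀ t' ∈ J, t < t' → ∃ b, HasDerivWithinAt τ b (Ici t) t ∧ 0 < b) :
    StrictMonoOn τ J := by
  have hmono : MonotoneOn τ J := by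
    intro s hs t ht hst
    have := abs_sub_le_sub_of_right_deriv (f := fun _ ↦ 0) (C := 1) hJ continuousOn_const hτ
      (fun t ht t' ht' htt' ↦ by
        obtain ⟨b, hb, hb0⟩ := h t ht t' ht' htt'
        exact ⟨0, b, hasDerivWithinAt_const _ _ _, hb, by simpa using hb0.le⟩) hs ht hst
    simp only [sub_self, abs_zero, one_mul] at this
    linarith
  intro s hs t ht hst
  refine (hmono hs ht hst.le).lt_of_ne fun heq ↦ ?_
  obtain ⟨b, hb, hb0⟩ := h s hs t ht hst
  have hconst : HasDerivWithinAt τ 0 (Icc s t) s := by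
    refine (hasDerivWithinAt_const s (Icc s t) (τ s)).congr (fun r hr ↦ ?_) rfl
    have hr' : r ∈ J := hJ.out hs ht hr
    exact le_antisymm ((hmono hr' ht hr.2).trans heq.ge) (hmono hs hr' hr.1)
  have hb' : HasDerivWithinAt τ b (Icc s t) s := hb.mono Icc_subset_Ici_self
  have := (uniqueDiffOn_Icc hst s (left_mem_Icc.2 hst.le)).eq_deriv _ hb' hconst
  exact hb0.ne' this

end CausalCurves

/-! ### The slice τ = 0 is a Cauchy hypersurface -/

section Cauchy

variable {d : ℕ} {M : Type u} [TopologicalSpace M] [T2Space M] [CompactSpace M]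
  [ChartedSpace (EuclideanSpace ℝ (Fin d)) M] [IsManifold (𝓡 d) ∞ M]
  {N : Type v} [TopologicalSpace N] [ChartedSpace (EuclideanSpace ℝ (Fin d)) N]
  [IsManifold (𝓡 d) ∞ N]
  {g : LorentzMetric d M} {K : Π x : M, TangentSpace (𝓡 d) x}
  {gN : LorentzMetric d N} {proj : N → M}

theorem LorentzMetric.IsUniversalLorentzianCovering.isCauchyHypersurface
    (h : g.IsUniversalLorentzianCovering gN proj) (hK : g.IsStaticField K) {τ : N → ℝ}
    (hτ : ContMDiff (𝓡 d) 𝓘(ℝ, ℝ) ∞ τ) (hdτ : ∀ (x : N) (v : TangentSpace (𝓡 d) x),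
      gN.val x (VectorField.mpullback (𝓡 d) (𝓡 d) proj K x)
        (VectorField.mpullback (𝓡 d) (𝓡 d) proj K x) * realDeriv τ x v =
      gN.val x (VectorField.mpullback (𝓡 d) (𝓡 d) proj K x) v) :
    gN.IsCauchyHypersurface (VectorField.mpullback (𝓡 d) (𝓡 d) proj K) {x | τ x = 0} := by
  intro J γ hγ hinext
  set KN := VectorField.mpullback (𝓡 d) (𝓡 d) proj K with hKN
  have htime : ∀ x, gN.val x (KN x) (KN x) < 0 := h.timelike_mpullback hK
  have hτm : ∀ x, MDifferentiableAt (𝓡 d) 𝓘(ℝ, ℝ) τ x := fun x ↦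
    (hτ x).mdifferentiableAt (by simp)
  have hτpos : ∀ (x : N) (v : TangentSpace (𝓡 d) x), gN.FutureCausal KN x v →
      0 < realDeriv τ x v := by
    intro x v hv
    have h1 := hdτ x v
    have h2 : gN.val x (KN x) v < 0 := by rw [gN.symm]; exact hv.2
    by_contra! hcon
    have := mul_nonneg_of_nonpos_of_nonpos (htime x).le hcon
    linarith
  have hτc : ContinuousOn (fun t ↦ τ (γ t)) J := hτ.continuous.comp_continuousOn hγ.continuousOn
  have hstrict : StrictMonoOn (fun t ↦ τ (γ t)) J :=
    strictMonoOn_of_right_deriv_pos hγ.ordConnected hτc fun t ht t' ht' htt' ↦ by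
      obtain ⟨v, hv, hd⟩ := hγ.exists_right_velocity ht ht' htt'
      exact ⟨_, hd τ (hτm _), hτpos _ v hv⟩
  -- Along the curve, F ∘ proj is Lipschitz as a function of τ; the factor |g(K, K)| of the cone
  -- estimate cancels against dτ = θ.
  have hbound : ∀ F : M → ℝ, ContMDiff (𝓡 d) 𝓘(ℝ, ℝ) ∞ F → ∃ C, ∀ a b : J,
      |F (proj (γ a)) - F (proj (γ b))| ≤ C * |τ (γ a) - τ (γ b)| := by
    intro F hF
    obtain ⟨C, hC⟩ := hK.exists_bound hF
    have hFm : ∀ x, MDifferentiableAt (𝓡 d) 𝓘(ℝ, ℝ) F x := fun x ↦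
      (hF x).mdifferentiableAt (by simp)
    have key : ∀ s ∈ J, ∀ t ∈ J, s ≤ t →
        |F (proj (γ t)) - F (proj (γ s))| ≤ C * (τ (γ t) - τ (γ s)) := by
      intro s hs t ht hst
      refine abs_sub_le_sub_of_right_deriv (f := fun t ↦ F (proj (γ t)))
        (τ := fun t ↦ τ (γ t)) hγ.ordConnected
        ((hF.continuous.comp h.isLocalDiffeomorph.contMDiff.continuous).comp_continuousOn
          hγ.continuousOn) hτc (fun t ht t' ht' htt' ↦ ?_) hs ht hst
      obtain ⟨v, hv, hd⟩ := hγ.exists_right_velocity ht ht' htt'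
      refine ⟨_, _, hd (fun x ↦ F (proj x)) ((hFm _).comp _ (h.mdifferentiableAt _)),
        hd τ (hτm _), ?_⟩
      rw [realDeriv_comp (hFm _) (h.mdifferentiableAt _)]
      have h1 := hC (proj (γ t)) (mfderiv (𝓡 d) (𝓡 d) proj (γ t) v) (by
        rw [← h.isometry]; exact hv.1)
      rw [← h.mfderiv_mpullback K (γ t), ← h.isometry, ← h.isometry, ← hdτ (γ t) v, abs_mul,
        abs_of_pos (hτpos _ v hv)] at h1
      refine le_of_mul_le_mul_right (h1.trans_eq ?_) (abs_pos.2 (htime (γ t)).ne)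
      ring
    refine ⟨C, fun a b ↦ ?_⟩
    rcases le_total (a : ℝ) b with hab | hab
    · have h1 : τ (γ a) ≤ τ (γ b) := hstrict.monotoneOn a.2 b.2 hab
      rw [abs_sub_comm, abs_sub_comm (τ (γ a)), abs_of_nonneg (sub_nonneg.2 h1)]
      exact key a a.2 b b.2 hab
    · have h1 : τ (γ b) ≤ τ (γ a) := hstrict.monotoneOn b.2 a.2 hab
      rw [abs_of_nonneg (sub_nonneg.2 h1)]
      exact key b b.2 a a.2 hab
  have hγc : Continuous (fun t : J ↦ γ t) := continuousOn_iff_continuous_domRestrict.1 hγ.continuousOn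
  -- A finite limit of τ at an end of the curve forces an end point of γ: the projection converges
  -- because every smooth function does along it, and the covering lifts the limit.
  have hconv : ∀ (l : Filter J) [l.NeBot], (∀ s ∈ l, ∃ T ∈ l, T ⊆ s ∧ IsPreconnected T) →
      ∀ L : ℝ, Tendsto (fun t : J ↦ τ (γ t)) l (𝓝 L) → ∃ x, Tendsto (fun t : J ↦ γ t) l (𝓝 x) := by
    intro l _ hl L hL
    obtain ⟨m, hm⟩ := exists_tendsto_of_forall_contMDiff (c := fun t : J ↦ proj (γ t)) (l := l)
      fun F hF ↦ by
        obtain ⟨C, hC⟩ := hbound F hF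
        exact exists_tendsto_of_abs_sub_le hL hC
    exact h.isCoveringMap.exists_tendsto_of_tendsto_comp h.surjective hl hγc hm
  have hsc := h.simplyConnected
  obtain ⟨x₀⟩ : Nonempty N := inferInstance
  -- On an empty interval `atTop` is the trivial filter, which tends to every point, so such a curve
  -- is not inextendible.
  have hJne : Nonempty J := by
    by_contra hcon
    rw [not_nonempty_iff] at hcon
    refine (hinext x₀).1 ?_
    rw [Filter.filter_eq_bot_of_isEmpty (atTop : Filter J)]
    exact tendsto_bot
  have hpre : ∀ s : Set J, s.OrdConnected → IsPreconnected s := by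
    intro s hs
    rw [← Topology.IsInducing.subtypeVal.isPreconnected_image]
    refine OrdConnected.isPreconnected ⟨?_⟩
    rintro _ ⟨a, ha, rfl⟩ _ ⟨b, hb, rfl⟩ r hr
    exact ⟨⟨r, hγ.ordConnected.out a.2 b.2 hr⟩, hs.out ha hb hr, rfl⟩
  have hmono : Monotone (fun t : J ↦ τ (γ t)) := fun a b hab ↦ hstrict.monotoneOn a.2 b.2 hab
  have hex : ∃ t ∈ J, τ (γ t) = 0 := by
    by_contra! hcon
    -- By the intermediate value theorem τ keeps one sign; being monotone, it converges at the
    -- future end if negative and at the past end if positive.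
    have hsign : (∀ t ∈ J, τ (γ t) < 0) ∨ ∀ t ∈ J, 0 < τ (γ t) := by
      by_contra! hcon'
      obtain ⟨⟨t, ht, ht0⟩, s, hs, hs0⟩ := hcon'
      obtain ⟨r, hr, hr0⟩ := hγ.ordConnected.isPreconnected.intermediate_value hs ht hτc ⟨hs0, ht0⟩
      exact hcon r hr hr0
    rcases hsign with hneg | hpos
    · obtain ⟨x, hx⟩ := hconv atTop (fun s hs ↦ by
        obtain ⟨a, ha⟩ := mem_atTop_sets.1 hs
        exact ⟨Ici a, Ici_mem_atTop a, ha, hpre _ ordConnected_Ici⟩) _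
        (tendsto_atTop_ciSup hmono ⟨0, by rintro _ ⟨t, rfl⟩; exact (hneg t t.2).le⟩)
      exact (hinext x).1 hx
    · obtain ⟨x, hx⟩ := hconv atBot (fun s hs ↦ by
        obtain ⟨a, ha⟩ := mem_atBot_sets.1 hs
        exact ⟨Iic a, Iic_mem_atBot a, ha, hpre _ ordConnected_Iic⟩) _
        (tendsto_atBot_ciInf hmono ⟨0, by rintro _ ⟨t, rfl⟩; exact (hpos t t.2).le⟩)
      exact (hinext x).2 hx
  obtain ⟨t, ht, ht0⟩ := hex
  exact ⟨t, ⟨ht, ht0⟩, fun s hs ↦ hstrict.injOn hs.1 ht (hs.2.trans ht0.symm)⟩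

end Cauchy

theorem theorem4p1 {n : ℕ} (hn : 1 ≤ n) {M : Type u} [TopologicalSpace M] [T2Space M]
    [ChartedSpace (EuclideanSpace ℝ (Fin (n + 1))) M] [IsManifold (𝓡 (n + 1)) ∞ M]
    [CompactSpace M] [ConnectedSpace M]
    (g : LorentzMetric (n + 1) M) (K : Π x : M, TangentSpace (𝓡 (n + 1)) x)
    (hK : g.IsStaticField K) :
    (∀ (N : Type v) [TopologicalSpace N] [T2Space N] [SecondCountableTopology N]
      [ChartedSpace (EuclideanSpace ℝ (Fin (n + 1))) N] [IsManifold (𝓡 (n + 1)) ∞ N]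
      (gN : LorentzMetric (n + 1) N) (proj : N → M),
      g.IsUniversalLorentzianCovering gN proj →
        gN.IsStandardStatic ∧
        ∃ A : Set N, gN.IsCauchyHypersurface
          (VectorField.mpullback (𝓡 (n + 1)) (𝓡 (n + 1)) proj K) A) ∧
    (∀ p : M, g.chronologicalFuture K p = univ ∧ g.chronologicalPast K p = univ) := by
  refine ⟨fun N _ _ _ _ _ gN proj h ↦ ?_, hK.totally_vicious⟩
  obtain ⟨φ, hφ⟩ := exists_isSmoothFlow_of_compactSpace hK.smooth
  obtain ⟨φN, hφN, hlift⟩ := h.exists_lift_flow hφ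
  obtain ⟨τ, hτ, hdτ⟩ := h.exists_primitive hK
  exact ⟨gN.isStandardStatic_of_flow (h.contMDiff_mpullback hK.smooth) (h.timelike_mpullback hK)
    hτ hdτ hφN (h.val_lift_flow hK hφ hφN hlift), _, h.isCauchyHypersurface hK hτ hdτ⟩

end
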